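/- **Setting.** Let $\Lambda$ be the $d$-dimensional torus of side length one ($d\ge 1$) with Lebesgue measure $\lambda$, $T>0$, $p_1,p_2\ge 0$ with $p_1+p_2=1$, $a_1,a_2\in\mathbb R$, $\theta>0$, and let $J\in C^1(\Lambda)$ be real-valued with $J(-r)=J(r)$ and $\int_\Lambda J\,d\lambda=1$. Write $\langle v,w\rangle=\int_\Lambda vw\,d\lambda$ (summed over $i=1,2$ for pairs) and $(J*u)(r)=\int_\Lambda J(r-r')u(r')\,dr'$. For $\overline u=(u_1,u_2)$ put $u=u_1+u_2$. Let $B_{q_1,q_2}=\{\overline u\in (L^\infty(\Lambda))^2:\|u_i\|_\infty\le q_i,\ i=1,2\}$. Let $(H_k)_{k\ge0}$ be a dense sequence in the closed unit ball of $C(\Lambda)$; equip $B_{1,1}$ with the distance $\rho(\overline u,\overline v)=\sum_{i=1,2}\sum_{k\ge 0}2^{-k}|\langle u_i-v_i,H_k\rangle|$ (the weak topology against $C(\Lambda)$), and the space $D([0,T],B_{1,1})$ of right-continuous paths with left limits with the Skorohod ($J_1$) topology. A continuous path $\overline\phi:[0,T]\to B_{1,1}$ is *absolutely continuous* if there are $\dot\phi_1,\dot\phi_2\in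 L^1([0,T]\times\Lambda)$ with $\phi_j(t)-\phi_j(t')=\int_{t'}^t\dot\phi_j(s,\cdot)\,ds$ $\lambda$-a.e. for all $0\le t'\le t\le T$, $j=1,2$. For $\overline V\in(L^\infty(\Lambda))^2$, $\overline u\in B_{1,1}$, $\overline g\in(L^1(\Lambda))^2$ let $$\Gamma_{\overline V}(\overline u)=\sum_{i=1,2}\langle p_i,\ \tanh(J*u+a_i\theta)\sinh(2V_i)+\cosh(2V_i)-1\rangle-\sum_{i=1,2}\langle u_i,\ \tanh(J*u+a_i\theta)[\cosh(2V_i)-1]+\sinh(2V_i)\rangle,$$ $$\mathcal H^*(\overline u,\overline g)=\sup_{\overline V\in(L^\infty(\Lambda))^2}\Big[\langle\overline V,\overline g\rangle-\tfrac12\Gamma_{\overline V}(\overline u)\Big].$$ For $\overline\phi\in D([0,T],B_{1,1})$ let $I_0(\overline\phi)=\int_0^T\mathcal H^*(\overline\phi(s,\cdot),\dot{\overline\phi}(s,\cdot))\,ds$ if $\overline\phi$ is absolutely continuous, and $I_0(\overline\phi)=+\infty$ otherwise. For a continuous $m_0:\Lambda\to[-1,1]$ let $I_{m_0}(\overline\phi)=I_0(\overline\phi)$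 if $\phi_i(0,\cdot)=p_im_0$ for $i=1,2$, and $I_{m_0}(\overline\phi)=+\infty$ otherwise. Consider the limiting equation $$\partial_t\phi_i=-\phi_i+p_i\tanh\big(J*(\phi_1+\phi_2)+a_i\theta\big),\qquad i=1,2,\tag{E}$$ understood weakly: for all $G\in C(\Lambda)$, $i=1,2$ and $t\in[0,T]$, $\langle\phi_i(t),G\rangle=\langle\phi_i(0),G\rangle+\int_0^t\langle-\phi_i(s)+p_i\tanh(J*(\phi_1+\phi_2)(s)+a_i\theta),G\rangle\,ds$. **Proposition.** 1. $I_0$ is lower semicontinuous on $D([0,T],B_{1,1})$. 2. For every $L\in\mathbb R$ the set $\{\overline\phi: I_0(\overline\phi)\le L\}$ is compact in $D([0,T],B_{1,1})$. 3. $I_0(\overline\phi)\ge0$ for all $\overline\phi\in D([0,T],B_{1,1})$, and $I_0(\overline\phi)=0$ if and only if $\overline\phi(0)\in B_{p_1,p_2}$ and $\overline\phi$ is a weak solution of (E). Consequently, for every continuous $m_0:\Lambda\to[-1,1]$, $I_{m_0}(\overline\phi)=0$ if and only if $\overline\phi$ is a weak solution of (E) with initial condition $\phi_i(0,\cdot)=p_im_0$,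 $i=1,2$. -/

import Mathlib

open MeasureTheory Set Filter Topology

namespace KacRate

noncomputable section

/-- The `d`-dimensional torus of side length one; its `volume` is the normalized Lebesgue
(Haar) measure, written `λ` in the mathematics. -/
abbrev Torus (d : ℕ) : Type := Fin d → UnitAddCircle

/-! ### The space `B_{1,1}` -/

/-- `B_{1,1}`: pairs `u = (u₁, u₂)` of classes of `L^∞` functions on the torus with
`‖u_i‖_∞ ≤ 1`. The index `H` is the sequence of test functions by which the distance `ρ`
below is built; it is carried in the type because the metric structure depends on it. -/
structure B11 (d : ℕ) (H : ℕ → C(Torus d, ℝ)) where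
  /-- the two densities -/
  val : Fin 2 → Lp ℝ ⊤ (volume : Measure (Torus d))
  norm_le : ∀ i, ‖val i‖ ≤ 1

namespace B11

variable {d : ℕ} {H : ℕ → C(Torus d, ℝ)}

/-- The densities as functions on the torus. -/
def fn (u : B11 d H) (i : Fin 2) (r : Torus d) : ℝ := u.val i r

/-- `⟨u_i, G⟩ = ∫ G u_i dλ`. -/
def pair (u : B11 d H) (i : Fin 2) (G : C(Torus d, ℝ)) : ℝ := ∫ r, G r * u.fn i r

/-- The distance `ρ(u, v) = ∑_{i=1,2} ∑_{k ≥ 0} 2^{-k} |⟨u_i - v_i, H_k⟩|`. It is written with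
values in `[0,∞]`, and is finite when all `H_k` lie in the unit ball of `C(Λ)`. -/
instance : PseudoEMetricSpace (B11 d H) where
  edist u v := ∑ i, ∑' k, ENNReal.ofReal ((1 / 2 : ℝ) ^ k * |u.pair i (H k) - v.pair i (H k)|)
  edist_self u := by simp
  edist_comm u v := by simp only [abs_sub_comm]
  edist_triangle u v w := by
    rw [← Finset.sum_add_distrib]
    refine Finset.sum_le_sum fun i _ => ?_
    rw [← ENNReal.tsum_add]
    refine ENNReal.tsum_le_tsum fun k => ?_
    rw [← ENNReal.ofReal_add (by positivity) (by positivity), ← mul_add]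
    exact ENNReal.ofReal_le_ofReal
      (mul_le_mul_of_nonneg_left (abs_sub_le _ _ _) (by positivity))

end B11

/-! ### The Skorohod space `D([0,T], E)` -/

/-- Right continuous paths with left limits from `[0,T]` to `E`. -/
structure Cadlag (T : ℝ) (E : Type*) [PseudoEMetricSpace E] where
  /-- the path -/
  toFun : Icc (0 : ℝ) T → E
  right_cont : ∀ t, ContinuousWithinAt toFun (Ici t) t
  left_lim : ∀ t, ∃ l, Tendsto toFun (𝓝[<] t) (𝓝 l)

namespace Cadlag

variable {T : ℝ} {E : Type*} [PseudoEMetricSpace E]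

instance : CoeFun (Cadlag T E) (fun _ => Icc (0 : ℝ) T → E) := ⟨toFun⟩

/-- The Skorohod (`J₁`) distance
`inf_κ max (sup_t |κ t - t|) (sup_t ρ(x t, y (κ t)))`, where `κ` runs over the increasing
bijections of `[0,T]`; the topology of `D([0,T], E)` is the one it induces. -/
instance : PseudoEMetricSpace (Cadlag T E) where
  edist x y := ⨅ κ : Icc (0 : ℝ) T ≃o Icc (0 : ℝ) T,
    max (⨆ t, edist (κ t) t) (⨆ t, edist (x t) (y (κ t)))
  edist_self x := by
    refine le_antisymm (iInf_le_of_le (OrderIso.refl _) ?_) zero_le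
    simp
  edist_comm x y := by
    have key : ∀ x y : Cadlag T E,
        (⨅ κ : Icc (0 : ℝ) T ≃o Icc (0 : ℝ) T,
          max (⨆ t, edist (κ t) t) (⨆ t, edist (x t) (y (κ t)))) ≤
        ⨅ κ : Icc (0 : ℝ) T ≃o Icc (0 : ℝ) T,
          max (⨆ t, edist (κ t) t) (⨆ t, edist (y t) (x (κ t))) := by
      intro x y
      refine le_iInf fun κ => iInf_le_of_le κ.symm (max_le_max ?_ ?_)
      · refine iSup_le fun t => ?_
        have h := le_iSup (fun t => edist (κ t) t) (κ.symm t)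
        simpa [edist_comm] using h
      · refine iSup_le fun t => ?_
        have h := le_iSup (fun t => edist (y t) (x (κ t))) (κ.symm t)
        simpa [edist_comm] using h
    exact le_antisymm (key x y) (key y x)
  edist_triangle x y z := by
    refine ENNReal.le_iInf_add_iInf fun κ η => iInf_le_of_le (κ.trans η) (max_le ?_ ?_)
    · refine iSup_le fun t => ?_
      calc edist (η (κ t)) t ≤ edist (η (κ t)) (κ t) + edist (κ t) t := edist_triangle _ _ _
        _ ≤ _ := by
          rw [add_comm]
          exact add_le_add
            ((le_iSup (fun t => edist (κ t) t) t).trans (le_max_left _ _))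
            ((le_iSup (fun t => edist (η t) t) (κ t)).trans (le_max_left _ _))
    · refine iSup_le fun t => ?_
      calc edist (x t) (z (η (κ t)))
          ≤ edist (x t) (y (κ t)) + edist (y (κ t)) (z (η (κ t))) := edist_triangle _ _ _
        _ ≤ _ := add_le_add
            ((le_iSup (fun t => edist (x t) (y (κ t))) t).trans (le_max_right _ _))
            ((le_iSup (fun t => edist (y t) (z (η t))) (κ t)).trans (le_max_right _ _))

end Cadlag

/-! ### The rate functional -/

/-- The data of the model: the probabilities `p₁, p₂` and values `a₁, a₂` of the random field,
its strength `θ`, and the interaction `J` on the torus. The inverse temperature is one. -/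
structure Data (d : ℕ) where
  p : Fin 2 → ℝ
  a : Fin 2 → ℝ
  θ : ℝ
  J : Torus d → ℝ

/-- The standing assumptions of the model. The class `C¹` on the torus is expressed by the
periodic lift to `ℝ^d`. -/
structure Data.Admissible {d : ℕ} (M : Data d) : Prop where
  p_nonneg : ∀ i, 0 ≤ M.p i
  p_sum : ∑ i, M.p i = 1
  θ_pos : 0 < M.θ
  J_symm : ∀ r, M.J (-r) = M.J r
  J_integral : ∫ r, M.J r = 1
  J_C1 : ContDiff ℝ 1 (fun x : Fin d → ℝ => M.J (fun i => (x i : UnitAddCircle)))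

section Functional

/-- Lebesgue measure on the time interval `[0,T]`. -/
abbrev timeMeasure (T : ℝ) : Measure (Icc (0 : ℝ) T) := volume.comap Subtype.val

variable {d : ℕ} (M : Data d)

/-- `((u₁ + u₂) * J)(r) + a_i θ`, with `(u * J)(r) = ∫ J(r - r') u(r') dr'`. -/
def Data.field (u : Fin 2 → Torus d → ℝ) (i : Fin 2) (r : Torus d) : ℝ :=
  (∫ r', M.J (r - r') * (∑ j, u j r')) + M.a i * M.θ

/-- `F_V(μ, π)` for pairs of measures `μ = (w₁λ, w₂λ)`, `π = (u₁λ, u₂λ)` given by densities. -/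
def Data.F (V w u : Fin 2 → Torus d → ℝ) : ℝ :=
  (∑ i, ∫ r, w i r *
    (Real.tanh (M.field u i r) * Real.sinh (2 * V i r) + Real.cosh (2 * V i r) - 1)) -
  ∑ i, ∫ r, u i r *
    (Real.tanh (M.field u i r) * (Real.cosh (2 * V i r) - 1) + Real.sinh (2 * V i r))

/-- `Γ_V(u) = F_V((p₁λ, p₂λ), (u₁λ, u₂λ))`. -/
def Data.Gam (V u : Fin 2 → Torus d → ℝ) : ℝ := M.F V (fun i _ => M.p i) u

/-- `𝓗*(u, g) = sup_{V ∈ (L^∞(Λ))²} [⟨V, g⟩ - Γ_V(u) / 2]`. -/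
def Data.Hstar (u g : Fin 2 → Torus d → ℝ) : EReal :=
  ⨆ V ∈ {V : Fin 2 → Torus d → ℝ | ∀ i, MemLp (V i) ⊤ volume},
    (((∑ i, ∫ r, V i r * g i r) - 1 / 2 * M.Gam V u : ℝ) : EReal)

/-- The integral of a function with values in `[-∞,∞]`: the integral of the positive part minus
the integral of the negative part. -/
def erealIntegral {α : Type*} [MeasurableSpace α] (μ : Measure α) (f : α → EReal) : EReal :=
  ((∫⁻ x, (f x).toENNReal ∂μ : ENNReal) : EReal) -
    ((∫⁻ x, (-f x).toENNReal ∂μ : ENNReal) : EReal)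

variable {T : ℝ} {H : ℕ → C(Torus d, ℝ)}

/-- `φ` belongs to `𝒜𝒞([0,T], B_{1,1})` with time derivative `g = (g₁, g₂)`: the path is
continuous, `g_j ∈ L¹([0,T] × Λ)`, and `φ_j(t) - φ_j(t') = ∫_{t'}^t g_j(s, ·) ds` `λ`-a.s. for
all `0 ≤ t' ≤ t ≤ T`. -/
structure HasTimeDeriv (φ : Icc (0 : ℝ) T → B11 d H)
    (g : Fin 2 → Icc (0 : ℝ) T → Torus d → ℝ) : Prop where
  cont : Continuous φ
  integrable : ∀ j, Integrable (fun z : Icc (0 : ℝ) T × Torus d => g j z.1 z.2)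
    ((timeMeasure T).prod volume)
  eq_integral : ∀ j, ∀ t' t, t' ≤ t →
    ∀ᵐ r, (φ t).fn j r - (φ t').fn j r = ∫ s in Ioc t' t, g j s r ∂(timeMeasure T)

/-- The rate functional `I₀` on `D([0,T], B_{1,1})`: it is `∫_0^T 𝓗*(φ(s), φ'(s)) ds` when `φ` is
absolutely continuous with time derivative `φ'`, and `+∞` otherwise. The derivative is unique
almost everywhere on `[0,T] × Λ`, so the infimum ranges over equal values (or over the empty
set, where it is `+∞`). -/
def Data.I0 (φ : Cadlag T (B11 d H)) : EReal :=
  ⨅ (g : Fin 2 → Icc (0 : ℝ) T → Torus d → ℝ) (_ : HasTimeDeriv φ g),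
    erealIntegral (timeMeasure T)
      (fun s => M.Hstar (φ s).fn (fun i => g i s))

/-! ### The limiting equation -/

/-- The initial value of a path. -/
def initial (hT : 0 < T) (φ : Cadlag T (B11 d H)) : B11 d H := φ ⟨0, le_rfl, hT.le⟩

/-- `φ` is a weak solution on `[0,T]` of the system
`∂_t φ_i = -φ_i + p_i tanh (J * (φ₁ + φ₂) + a_i θ)`, `i = 1, 2`: tested against every continuous
function on the torus and integrated in time. -/
def Data.IsWeakSolution (hT : 0 < T) (φ : Cadlag T (B11 d H)) : Prop :=
  ∀ i, ∀ G : C(Torus d, ℝ), ∀ t : Icc (0 : ℝ) T,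
    (φ t).pair i G = (initial hT φ).pair i G +
      ∫ s in Iic t, (∫ r, G r *
        (-(φ s).fn i r + M.p i * Real.tanh (M.field (φ s).fn i r))) ∂(timeMeasure T)

/-- The initial condition `φ_i(0, ·) = p_i m₀`, `i = 1, 2`. -/
def Data.HasInitialDatum (hT : 0 < T) (m₀ : C(Torus d, ℝ)) (φ : Cadlag T (B11 d H)) : Prop :=
  ∀ i, ∀ᵐ r, (initial hT φ).fn i r = M.p i * m₀ r

open Classical in
/-- The rate functional `I_{m₀}`: it is `I₀` on the paths that start from `(p₁ m₀, p₂ m₀)`, and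
`+∞` elsewhere. -/
def Data.Im (hT : 0 < T) (m₀ : C(Torus d, ℝ)) (φ : Cadlag T (B11 d H)) : EReal :=
  if M.HasInitialDatum hT m₀ φ then M.I0 φ else ⊤

end Functional

end

end KacRate

open KacRate

/-! Everything rests on a variational formula in space-time. Write `cost` for the pointwise
integrand of ⟨V, g⟩ - Γ_V(u)/2. Then ∫ 𝓗*(φ, φ') ds is the supremum, over bounded measurable V on
[0,T] × Λ, of the space-time integral of `cost`: a fixed V restricts to a competitor at almost every
time (`ofReal_integral_costAt_le`), and conversely nearly optimal V are selected measurably, point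
by point, from a countable dense set of values (`lintegral_Hstar_le`). Hence a bound I₀ ≤ L can be
tested one V at a time; `IsRep` records this.

Lower semicontinuity and compactness. Taking V = c sgn(g_i) on a set E gives c ∫_E |g_i| ≤ L + 2
cosh(2c) |E|. As c is arbitrary, the derivatives of paths with I₀ ≤ L are uniformly integrable. They
are therefore weakly sequentially compact in L¹ (Dunford-Pettis), and the paths are equicontinuous
for ρ. A subsequence converges uniformly, and its limit is the path obtained by integrating the
limiting derivative. For fixed V the cost functional passes to the limit: it is linear in g;
convolution with J turns weak convergence of u into pointwise convergence of the field; and u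
multiplies the field only through a product of a weakly and a strongly convergent factor. This is
`IsRep.exists_limit`. It yields compactness, closed sublevel sets and attainment of the infimum
defining I₀.

Zeros. Non-negativity comes from V = 0. If I₀ = 0, the test V = ε sgn(g_i - drift_i) with ε → 0
forces g to be the right side of (E). With this known, V = c sgn(u_i) on {|u_i| > p_i} with c → ∞
forces |u_i| ≤ p_i almost everywhere, because |tanh| < 1 makes the coefficient of the growing
exponential strictly positive; the bound reaches time 0 because the path is Lipschitz in L¹.
Conversely, if |u_i| ≤ p_i and g is the drift, the cost is minus a non-negative combination of e^x -
1 - x at x = ±2V_i, so it is at most 0. A weak solution is put into this form by freezing its own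
field: (E) becomes a linear equation, solved pointwise by Duhamel's formula with values in [-p_i,
p_i], and Grönwall's inequality identifies the solution with the given path. -/

namespace KacRate

/-! ### Weak sequential compactness in L¹ -/

section WeakCompactness

variable {Ω : Type*} [MeasurableSpace Ω]

/-- Bounded sequences in a separable real Hilbert space have weakly convergent subsequences. -/
theorem exists_weak_subseq_hilbert {E : Type*} [NormedAddCommGroup E] [InnerProductSpace ℝ E]
    [CompleteSpace E] [TopologicalSpace.SeparableSpace E] (x : ℕ → E) (R : ℝ)
    (hx : ∀ n, ‖x n‖ ≤ R) :
    ∃ ψ : ℕ → ℕ, StrictMono ψ ∧ ∃ y : E, ∀ z : E,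
      Tendsto (fun n => inner ℝ (x (ψ n)) z) atTop (𝓝 (inner ℝ y z)) := by
  have hc := WeakDual.isSeqCompact_closedBall ℝ E 0 R
  let X : ℕ → WeakDual ℝ E := fun n =>
    StrongDual.toWeakDual (InnerProductSpace.toDual ℝ E (x n))
  have hX : ∀ n, X n ∈ (WeakDual.toStrongDual ⁻¹' Metric.closedBall (0 : StrongDual ℝ E) R) := by
    intro n
    simp only [mem_preimage, Metric.mem_closedBall, dist_zero_right]
    have : WeakDual.toStrongDual (X n) = InnerProductSpace.toDual ℝ E (x n) := rfl
    rw [this, LinearIsometryEquiv.norm_map]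
    exact hx n
  obtain ⟨a, -, ψ, hψ, hlim⟩ := hc hX
  refine ⟨ψ, hψ, (InnerProductSpace.toDual ℝ E).symm (WeakDual.toStrongDual a), fun z => ?_⟩
  have h1 : Tendsto (fun n => X (ψ n) z) atTop (𝓝 (a z)) :=
    (WeakDual.eval_continuous z).continuousAt.tendsto.comp hlim
  have h2 : inner ℝ ((InnerProductSpace.toDual ℝ E).symm (WeakDual.toStrongDual a)) z = a z := by
    rw [InnerProductSpace.toDual_symm_apply]; rfl
  rw [h2]
  exact h1

/-- On a finite measure space a uniform bound is an L² bound, and L² is separable because the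
σ-algebra is countably generated. -/
theorem exists_weak_subseq_of_bounded [MeasurableSpace.CountablyGenerated Ω] (μ : Measure Ω)
    [IsFiniteMeasure μ] (f : ℕ → Ω → ℝ) (hf : ∀ n, AEStronglyMeasurable (f n) μ) (K : ℝ)
    (hK : ∀ n, ∀ᵐ x ∂μ, ‖f n x‖ ≤ K) :
    ∃ ψ : ℕ → ℕ, StrictMono ψ ∧ ∃ g : Ω → ℝ, MemLp g 2 μ ∧ ∀ h : Ω → ℝ, MemLp h 2 μ →
      Tendsto (fun n => ∫ x, f (ψ n) x * h x ∂μ) atTop (𝓝 (∫ x, g x * h x ∂μ)) := by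
  have hm : ∀ n, MemLp (f n) 2 μ := fun n => MemLp.of_bound (hf n) K (hK n)
  have : Fact ((2 : ENNReal) ≠ ⊤) := ⟨by norm_num⟩
  obtain ⟨ψ, hψ, y, hy⟩ := exists_weak_subseq_hilbert (fun n => (hm n).toLp)
    (((μ univ).toNNReal : ℝ) ^ (2 : ENNReal).toReal⁻¹ * max K 0) (fun n => by
      have := Lp.norm_le_of_ae_bound (p := 2) (f := (hm n).toLp) (C := max K 0) (le_max_right _ _)
        (by filter_upwards [hK n, (hm n).coeFn_toLp] with x hx h1; rw [h1]; exact hx.trans (le_max_left _ _))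
      exact this)
  refine ⟨ψ, hψ, y, Lp.memLp y, fun h hh => ?_⟩
  have key : ∀ z : Lp ℝ 2 μ, ∀ w : Ω → ℝ, w =ᵐ[μ] z →
      inner ℝ z hh.toLp = ∫ x, w x * h x ∂μ := by
    intro z w hw
    rw [L2.inner_def]
    refine integral_congr_ae ?_
    filter_upwards [hw, hh.coeFn_toLp] with x h1 h2
    rw [h1, h2]; simp [mul_comm]
  have := hy hh.toLp
  simp only [key y y (ae_eq_refl _)] at this
  refine this.congr fun n => key _ _ (hm (ψ n)).coeFn_toLp.symm

/-- Truncation at level `K`. -/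
noncomputable def trunc (K x : ℝ) : ℝ := max (-K) (min K x)

theorem continuous_trunc (K : ℝ) : Continuous (trunc K) := by unfold trunc; fun_prop

theorem abs_trunc_le {K : ℝ} (hK : 0 ≤ K) (x : ℝ) : |trunc K x| ≤ K := by
  unfold trunc; rw [abs_le]
  exact ⟨le_max_left _ _, max_le (by linarith) (min_le_left _ _)⟩

theorem abs_sub_trunc_le {K : ℝ} (hK : 0 ≤ K) (x : ℝ) :
    |x - trunc K x| ≤ {y : ℝ | K ≤ |y|}.indicator (fun y => |y|) x := by
  unfold trunc
  by_cases h : K ≤ |x|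
  · rw [indicator_of_mem (by exact h)]
    rcases le_total 0 x with h0 | h0
    · rw [abs_of_nonneg h0] at h
      rw [min_eq_left h, max_eq_right (by linarith), abs_of_nonneg (by linarith), abs_of_nonneg h0]
      linarith
    · rw [abs_of_nonpos h0] at h
      rw [min_eq_right (by linarith), max_eq_left (by linarith), abs_of_nonpos (by linarith),
        abs_of_nonpos h0]
      linarith
  · rw [indicator_of_notMem (by exact h)]
    push Not at h
    rw [abs_lt] at h
    rw [min_eq_right h.2.le, max_eq_right h.1.le]; simp

/-- A nowhere vanishing version of the sign function. -/
noncomputable def sgn (x : ℝ) : ℝ := if 0 ≤ x then 1 else -1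

theorem measurable_sgn : Measurable sgn :=
  Measurable.ite measurableSet_Ici measurable_const measurable_const

theorem abs_sgn (x : ℝ) : |sgn x| = 1 := by unfold sgn; split_ifs <;> simp

theorem mul_sgn (x : ℝ) : x * sgn x = |x| := by
  unfold sgn; split_ifs with h
  · rw [abs_of_nonneg h, mul_one]
  · rw [abs_of_neg (not_le.1 h)]; ring

/-- All truncation levels at once. -/
theorem exists_weak_subseq_trunc [MeasurableSpace.CountablyGenerated Ω] (μ : Measure Ω)
    [IsFiniteMeasure μ] (f : ℕ → Ω → ℝ) (hf : ∀ n, AEStronglyMeasurable (f n) μ) :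
    ∃ ψ : ℕ → ℕ, StrictMono ψ ∧ ∃ G : ℕ → Ω → ℝ, (∀ k, Integrable (G k) μ) ∧
      ∀ (k : ℕ) (h : Ω → ℝ), Measurable h → (∃ C, ∀ x, ‖h x‖ ≤ C) →
      Tendsto (fun n => ∫ x, trunc k (f (ψ n) x) * h x ∂μ) atTop (𝓝 (∫ x, G k x * h x ∂μ)) := by
  -- The truncation level becomes a second variable, weighted by a finite measure charging every
  -- level, so that one extraction on Ω × ℕ replaces a diagonal argument.
  let ν : Measure ℕ := Measure.sum fun k => ENNReal.ofReal ((1 / 2 : ℝ) ^ k) • Measure.dirac k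
  have hνk : ∀ k, ν {k} = ENNReal.ofReal ((1 / 2 : ℝ) ^ k) := by
    intro k
    rw [Measure.sum_apply _ (measurableSet_singleton k), tsum_eq_single k]
    · simp
    · intro j hj
      simp [hj]
  have : IsFiniteMeasure ν := by
    constructor
    rw [Measure.sum_apply _ MeasurableSet.univ]
    simp only [Measure.smul_apply, measure_univ, smul_eq_mul, mul_one]
    rw [← ENNReal.ofReal_tsum_of_nonneg (fun n => by positivity) summable_geometric_two]
    exact ENNReal.ofReal_lt_top
  have hνpos : ∀ k, 0 < ν.real {k} := by
    intro k
    rw [Measure.real, hνk, ENNReal.toReal_ofReal (by positivity)]; positivity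
  let f' : ℕ → Ω → ℝ := fun n => (hf n).mk (f n)
  have hf'm : ∀ n, Measurable (f' n) := fun n => (hf n).stronglyMeasurable_mk.measurable
  -- Division by k + 1 makes the family bounded by 1 uniformly in the level; it is undone at the
  -- end.
  let F : ℕ → Ω × ℕ → ℝ := fun n z => trunc z.2 (f' n z.1) / (z.2 + 1)
  have hFm : ∀ n, Measurable (F n) := by
    intro n
    refine measurable_from_prod_countable_left fun k => ?_
    exact ((continuous_trunc k).measurable.comp (hf'm n)).div_const ((k : ℝ) + 1)
  have hF1 : ∀ n z, ‖F n z‖ ≤ 1 := by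
    intro n z
    have h2 : (0 : ℝ) < z.2 + 1 := by positivity
    rw [Real.norm_eq_abs, abs_div, abs_of_pos h2, div_le_one h2]
    exact (abs_trunc_le (by positivity) _).trans (by linarith)
  obtain ⟨ψ, hψ, g, hg, hlim⟩ := exists_weak_subseq_of_bounded (μ.prod ν) F
    (fun n => (hFm n).aestronglyMeasurable) 1 (fun n => ae_of_all _ (hF1 n))
  have hgi : Integrable g (μ.prod ν) := hg.integrable (by norm_num)
  -- Each level is an atom of ν, so a property of almost every section holds for every section.
  have hsec : ∀ k, Integrable (fun x => g (x, k)) μ := by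
    have := hgi.prod_left_ae
    intro k
    by_contra hk
    have h0 : ν {k} = 0 := measure_mono_null (fun j hj => by
      rw [mem_singleton_iff.1 hj]; exact hk) (ae_iff.1 this)
    have := hνpos k
    simp [Measure.real, h0] at this
  have hint : ∀ (k : ℕ) (u : Ω × ℕ → ℝ) (h : Ω → ℝ),
      Integrable (fun z : Ω × ℕ => u z * ({k} : Set ℕ).indicator (fun _ => h z.1) z.2) (μ.prod ν) →
      ∫ z, u z * ({k} : Set ℕ).indicator (fun _ => h z.1) z.2 ∂(μ.prod ν) =
        ν.real {k} * ∫ x, u (x, k) * h x ∂μ := by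
    intro k u h hi
    rw [integral_prod_symm _ hi]
    have : ∀ y : ℕ, (∫ x, u (x, y) * ({k} : Set ℕ).indicator (fun _ => h x) y ∂μ) =
        ({k} : Set ℕ).indicator (fun j => ∫ x, u (x, j) * h x ∂μ) y := by
      intro y
      by_cases hy : y ∈ ({k} : Set ℕ)
      · simp [indicator_of_mem hy]
      · simp [indicator_of_notMem hy]
    simp only [this]
    rw [integral_indicator (measurableSet_singleton k), integral_singleton, smul_eq_mul]
  refine ⟨ψ, hψ, fun k x => (k + 1) * g (x, k), fun k => (hsec k).const_mul _, ?_⟩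
  rintro k h hh ⟨C, hC⟩
  let hk : Ω × ℕ → ℝ := fun z => ({k} : Set ℕ).indicator (fun _ => h z.1) z.2
  have hkm : Measurable hk := by
    refine measurable_from_prod_countable_left fun j => ?_
    by_cases hj : j ∈ ({k} : Set ℕ)
    · simp only [hk, indicator_of_mem hj]
      exact hh
    · simp only [hk, indicator_of_notMem hj]
      exact measurable_const
  have hkb : ∀ z, ‖hk z‖ ≤ C := fun z =>
    (norm_indicator_le_norm_self _ _).trans (hC _)
  have hk2 : MemLp hk 2 (μ.prod ν) :=
    MemLp.of_bound hkm.aestronglyMeasurable C (ae_of_all _ hkb)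
  have h1 := hlim hk hk2
  have h2 : ∀ n, Integrable (fun z => F n z * hk z) (μ.prod ν) := fun n =>
    (MemLp.integrable_mul (p := 2) (q := 2) (MemLp.of_bound (hFm n).aestronglyMeasurable 1
      (ae_of_all _ (hF1 n))) hk2)
  rw [hint k g h (MemLp.integrable_mul hg hk2)] at h1
  have h3 := (h1.const_mul (ν.real {k})⁻¹).const_mul ((k : ℝ) + 1)
  have hne := (hνpos k).ne'
  refine (h3.congr fun n => ?_).trans_eq ?_
  · rw [hint k _ h (h2 _), inv_mul_cancel_left₀ hne, ← integral_const_mul]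
    refine integral_congr_ae ?_
    filter_upwards [(hf (ψ n)).ae_eq_mk] with x hx
    simp only [F, f', ← hx]
    have : (k : ℝ) + 1 ≠ 0 := by positivity
    field_simp
  · rw [inv_mul_cancel_left₀ hne, ← integral_const_mul]
    simp only [mul_assoc]

/-- A sequential form of the Dunford-Pettis theorem. -/
theorem exists_weak_subseq_of_unifIntegrable [MeasurableSpace.CountablyGenerated Ω] (μ : Measure Ω)
    [IsFiniteMeasure μ] (f : ℕ → Ω → ℝ) (hf : ∀ n, Integrable (f n) μ)
    (hui : ∀ ε > 0, ∃ k : ℕ, ∀ l ≥ k, ∀ n, ∫ x, |f n x - trunc l (f n x)| ∂μ ≤ ε) :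
    ∃ ψ : ℕ → ℕ, StrictMono ψ ∧ ∃ g : Ω → ℝ, Measurable g ∧ Integrable g μ ∧
      ∀ h : Ω → ℝ, Measurable h → (∃ C, ∀ x, ‖h x‖ ≤ C) →
      Tendsto (fun n => ∫ x, f (ψ n) x * h x ∂μ) atTop (𝓝 (∫ x, g x * h x ∂μ)) := by
  obtain ⟨ψ, hψ, G, hGi, hG⟩ := exists_weak_subseq_trunc μ f (fun n => (hf n).1)
  have htr : ∀ k : ℕ, ∀ n, Integrable (fun x => trunc k (f n x)) μ := fun k n =>
    Integrable.of_bound ((continuous_trunc k).comp_aestronglyMeasurable (hf n).1) k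
      (ae_of_all _ fun x => abs_trunc_le (by positivity) _)
  have hmulb : ∀ (u h : Ω → ℝ), Integrable u μ → Measurable h → (∃ C, ∀ x, ‖h x‖ ≤ C) →
      Integrable (fun x => u x * h x) μ := by
    rintro u h hu hh ⟨C, hC⟩
    exact hu.mul_bdd (c := C) hh.aestronglyMeasurable (ae_of_all _ hC)
  have hsub : ∀ (u v h : Ω → ℝ) (C : ℝ), Integrable u μ → Integrable v μ → Measurable h →
      (∀ x, ‖h x‖ ≤ C) →
      |(∫ x, u x * h x ∂μ) - ∫ x, v x * h x ∂μ| ≤ C * ∫ x, |u x - v x| ∂μ := by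
    intro u v h C hu hv hh hC
    rw [← integral_sub (hmulb u h hu hh ⟨C, hC⟩) (hmulb v h hv hh ⟨C, hC⟩), ← integral_const_mul]
    refine (abs_integral_le_integral_abs).trans (integral_mono ?_ ((hu.sub hv).abs.const_mul C) ?_)
    · exact ((hmulb u h hu hh ⟨C, hC⟩).sub (hmulb v h hv hh ⟨C, hC⟩)).abs
    · intro x
      simp only
      rw [← sub_mul, abs_mul, mul_comm]
      exact mul_le_mul_of_nonneg_right (hC x) (abs_nonneg _)
  -- The weak limits of the truncations are Cauchy in L¹: testing with the sign of G l - G k shows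
  -- that their L¹ distance is at most the uniform distance between the truncations, hence at most
  -- two truncation errors.
  have hGG : ∀ ε > 0, ∃ k : ℕ, ∀ l ≥ k, ∫ x, |G l x - G k x| ∂μ ≤ ε := by
    intro ε hε
    obtain ⟨k, hk⟩ := hui (ε / 2) (by positivity)
    refine ⟨k, fun l hl => ?_⟩
    have hi := (hGi l).sub (hGi k)
    let h : Ω → ℝ := fun x => sgn (hi.1.mk _ x)
    have hh : Measurable h := measurable_sgn.comp hi.1.stronglyMeasurable_mk.measurable
    have hh1 : ∀ x, ‖h x‖ ≤ 1 := fun x => (abs_sgn _).le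
    have hlim := (hG l h hh ⟨1, hh1⟩).sub (hG k h hh ⟨1, hh1⟩)
    have e1 : (∫ x, G l x * h x ∂μ) - ∫ x, G k x * h x ∂μ = ∫ x, |G l x - G k x| ∂μ := by
      rw [← integral_sub (hmulb _ h (hGi l) hh ⟨1, hh1⟩) (hmulb _ h (hGi k) hh ⟨1, hh1⟩)]
      refine integral_congr_ae ?_
      filter_upwards [hi.1.ae_eq_mk] with x hx
      simp only [h, ← sub_mul, ← hx, Pi.sub_apply]
      rw [mul_sgn]
    rw [e1] at hlim
    refine le_of_tendsto hlim (Eventually.of_forall fun n => ?_)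
    refine (le_abs_self _).trans ((hsub _ _ h 1 (htr l _) (htr k _) hh hh1).trans ?_)
    rw [one_mul]
    have hI := fun j : ℕ => ((hf (ψ n)).sub (htr j (ψ n))).abs
    refine (integral_mono ((htr l (ψ n)).sub (htr k (ψ n))).abs ((hI l).add (hI k)) fun x => ?_).trans ?_
    · simp only [Pi.add_apply, Pi.sub_apply]
      rw [abs_sub_comm (f (ψ n) x) (trunc l _)]
      exact abs_sub_le _ _ _
    · rw [integral_add' (hI l) (hI k)]
      have := hk l hl (ψ n)
      have := hk k le_rfl (ψ n)
      simp only [Pi.sub_apply]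
      linarith
  have hd : ∀ (u v : Ω → ℝ) (hu : Integrable u μ) (hv : Integrable v μ),
      dist (hu.toL1 u) (hv.toL1 v) = ∫ x, |u x - v x| ∂μ := by
    intro u v hu hv
    rw [dist_eq_norm, ← Integrable.toL1_sub, L1.norm_eq_integral_norm]
    refine integral_congr_ae ?_
    filter_upwards [(hu.sub hv).coeFn_toL1] with x hx
    rw [hx]; rfl
  have hcau : CauchySeq fun k => (hGi k).toL1 (G k) := by
    rw [Metric.cauchySeq_iff']
    intro ε hε
    obtain ⟨k, hk⟩ := hGG (ε / 2) (by positivity)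
    refine ⟨k, fun l hl => ?_⟩
    rw [hd]
    exact (hk l hl).trans_lt (by linarith)
  obtain ⟨g₀, hg₀⟩ := cauchySeq_tendsto_of_complete hcau
  have hgi₀ := L1.integrable_coeFn g₀
  let g : Ω → ℝ := hgi₀.1.mk _
  have hgm : Measurable g := hgi₀.1.stronglyMeasurable_mk.measurable
  have hgi : Integrable g μ := hgi₀.congr hgi₀.1.ae_eq_mk
  have hgg : hgi.toL1 g = g₀ := by
    refine Lp.ext ?_
    filter_upwards [hgi.coeFn_toL1, hgi₀.1.ae_eq_mk] with x h1 h2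
    rw [h1, h2]
  have hGg : Tendsto (fun k => ∫ x, |G k x - g x| ∂μ) atTop (𝓝 0) := by
    rw [← hgg, tendsto_iff_dist_tendsto_zero] at hg₀
    simpa only [hd] using hg₀
  refine ⟨ψ, hψ, g, hgm, hgi, ?_⟩
  rintro h hh ⟨C, hC⟩
  -- A strictly positive bound is needed, as the tolerances below are divided by it.
  have hC' : ∀ x, ‖h x‖ ≤ |C| + 1 := fun x => (hC x).trans ((le_abs_self C).trans (by linarith))
  set D := |C| + 1 with hD
  have hD0 : 0 < D := by positivity
  rw [Metric.tendsto_atTop]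
  intro ε hε
  obtain ⟨k₁, hk₁⟩ := hui (ε / (4 * D)) (by positivity)
  obtain ⟨k₂, hk₂⟩ := (Metric.tendsto_atTop.1 hGg) (ε / (4 * D)) (by positivity)
  let k := max k₁ k₂
  obtain ⟨N, hN⟩ := (Metric.tendsto_atTop.1 (hG k h hh ⟨C, hC⟩)) (ε / 4) (by positivity)
  refine ⟨N, fun n hn => ?_⟩
  have b1 := hsub (f (ψ n)) (fun x => trunc k (f (ψ n) x)) h D (hf _) (htr k _) hh hC'
  have b2 := hsub (G k) g h D (hGi k) hgi hh hC'
  have b3 := hN n hn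
  have b4 := hk₁ k (le_max_left _ _) (ψ n)
  have b5 := hk₂ k (le_max_right _ _)
  rw [Real.dist_eq, sub_zero, abs_of_nonneg (integral_nonneg fun x => abs_nonneg _)] at b5
  have c1 := mul_le_mul_of_nonneg_left b4 hD0.le
  have c2 := mul_le_mul_of_nonneg_left b5.le hD0.le
  have e : D * (ε / (4 * D)) = ε / 4 := by field_simp
  rw [e] at c1 c2
  rw [Real.dist_eq] at b3 ⊢
  have t1 := abs_sub_le (∫ x, f (ψ n) x * h x ∂μ) (∫ x, trunc k (f (ψ n) x) * h x ∂μ)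
    (∫ x, g x * h x ∂μ)
  have t2 := abs_sub_le (∫ x, trunc k (f (ψ n) x) * h x ∂μ) (∫ x, G k x * h x ∂μ)
    (∫ x, g x * h x ∂μ)
  linarith

/-- Test with the sign of f on {|f| > K}: there |f| - K would be positive with integral at most 0.
Through this duality the constraint ‖u_i‖_∞ ≤ 1 survives weak limits. -/
theorem ae_abs_le_of_forall_integral_mul_le {μ : Measure Ω} [IsFiniteMeasure μ] {f : Ω → ℝ}
    (hf : Integrable f μ) {K : ℝ}
    (h : ∀ h : Ω → ℝ, Measurable h → (∃ C, ∀ x, ‖h x‖ ≤ C) →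
      ∫ x, f x * h x ∂μ ≤ K * ∫ x, |h x| ∂μ) :
    ∀ᵐ x ∂μ, |f x| ≤ K := by
  let f' := hf.1.mk f
  have hf'm : Measurable f' := hf.1.stronglyMeasurable_mk.measurable
  have hf' : Integrable f' μ := hf.congr hf.1.ae_eq_mk
  let E : Set Ω := {x | K < |f' x|}
  have hE : MeasurableSet E := measurableSet_lt measurable_const hf'm.abs
  have h1 := h (E.indicator fun x => sgn (f' x)) ((measurable_sgn.comp hf'm).indicator hE)
    ⟨1, fun x => (norm_indicator_le_norm_self _ _).trans (abs_sgn _).le⟩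
  have e1 : ∫ x, f x * E.indicator (fun x => sgn (f' x)) x ∂μ = ∫ x in E, |f' x| ∂μ := by
    rw [← integral_indicator hE]
    refine integral_congr_ae ?_
    filter_upwards [hf.1.ae_eq_mk] with x hx
    rw [hx]
    by_cases hxE : x ∈ E
    · simp only [indicator_of_mem hxE]; exact mul_sgn _
    · simp [indicator_of_notMem hxE]
  have e2 : K * ∫ x, |E.indicator (fun x => sgn (f' x)) x| ∂μ = ∫ x in E, K ∂μ := by
    rw [← integral_indicator hE, ← integral_const_mul]
    congr 1 with x
    by_cases hxE : x ∈ E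
    · simp [indicator_of_mem hxE, abs_sgn]
    · simp [indicator_of_notMem hxE]
  rw [e1, e2] at h1
  have h2 : ∫ x in E, (|f' x| - K) ∂μ = 0 := by
    refine le_antisymm ?_ (setIntegral_nonneg hE fun x hx => sub_nonneg.2 (le_of_lt hx))
    rw [integral_sub hf'.abs.integrableOn (integrable_const K)]
    linarith
  rw [integral_eq_zero_iff_of_nonneg_ae] at h2
  · rw [Filter.EventuallyEq, ae_restrict_iff' hE] at h2
    filter_upwards [h2, hf.1.ae_eq_mk] with x hx hx2
    rw [hx2]
    by_contra hc
    have h3 := hx (not_le.1 hc)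
    have h4 : K < |f' x| := not_le.1 hc
    simp only [Pi.zero_apply] at h3
    linarith
  · exact (ae_restrict_iff' hE).2 (ae_of_all _ fun x hx => sub_nonneg.2 (le_of_lt hx))
  · exact (hf'.abs.sub (integrable_const K)).integrableOn

end WeakCompactness

/-- f is the pointwise limit of t ↦ f(c n t), where c n t is the next point of the grid of mesh
1/(n+1) to the right of t, capped at T. These functions factor through an integer part, so they are
measurable. -/
theorem measurable_of_right_continuous {T : ℝ} {f : Icc (0 : ℝ) T → ℝ}
    (hf : ∀ t, ContinuousWithinAt f (Ici t) t) : Measurable f := by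
  let c : ℕ → Icc (0 : ℝ) T → Icc (0 : ℝ) T := fun n t =>
    ⟨min T ((⌊(t : ℝ) * (n + 1)⌋₊ + 1) / (n + 1)), le_min (t.2.1.trans t.2.2) (by positivity),
      min_le_left _ _⟩
  have hle : ∀ n (t : Icc (0 : ℝ) T), (t : ℝ) ≤ c n t := fun n t => by
    refine le_min t.2.2 ?_
    rw [le_div_iff₀ (by positivity)]
    exact (Nat.lt_floor_add_one _).le
  have hge : ∀ n (t : Icc (0 : ℝ) T), (c n t : ℝ) ≤ t + 1 / ((n : ℝ) + 1) := fun n t => by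
    refine (min_le_right _ _).trans ?_
    rw [add_div]
    gcongr
    rw [div_le_iff₀ (by positivity)]
    exact Nat.floor_le (mul_nonneg t.2.1 (by positivity))
  have hc : ∀ t, Tendsto (fun n => c n t) atTop (𝓝[Ici t] t) := by
    intro t
    refine tendsto_nhdsWithin_iff.2 ⟨?_, Eventually.of_forall fun n => hle n t⟩
    rw [tendsto_subtype_rng]
    refine tendsto_of_tendsto_of_tendsto_of_le_of_le tendsto_const_nhds ?_ (fun n => hle n t)
      (fun n => hge n t)
    simpa using tendsto_one_div_add_atTop_nhds_zero_nat.const_add (t : ℝ)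
  refine measurable_of_tendsto_metrizable (f := fun n t => f (c n t)) (fun n => ?_)
    (tendsto_pi_nhds.2 fun t => (hf t).tendsto.comp (hc t))
  by_cases hT : 0 ≤ T
  · have : (fun t => f (c n t)) = (fun k : ℕ => f ⟨min T ((k + 1) / (n + 1)),
        le_min hT (by positivity), min_le_left _ _⟩) ∘ fun t : Icc (0 : ℝ) T => ⌊(t : ℝ) * (n + 1)⌋₊ := rfl
    rw [this]
    exact (measurable_of_countable _).comp
      (Nat.measurable_floor.comp (measurable_subtype_coe.mul_const _))
  · have : IsEmpty (Icc (0 : ℝ) T) := ⟨fun t => hT (t.2.1.trans t.2.2)⟩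
    exact measurable_of_empty _

end KacRate

/-! ### The interaction field -/

namespace KacRate

section Interaction

variable {d : ℕ} {M : Data d}

/-- The covering ℝ^d → Λ is an open quotient map, so continuity of the periodic lift descends. -/
theorem Data.Admissible.continuous_J (hM : M.Admissible) : Continuous M.J := by
  have hq : IsOpenQuotientMap (fun x : Fin d → ℝ => (fun i => (x i : UnitAddCircle))) :=
    IsOpenQuotientMap.piMap fun _ => QuotientAddGroup.isOpenQuotientMap_mk
  exact (hq.isQuotientMap.continuous_iff).2 hM.J_C1.continuous

theorem Data.Admissible.exists_J_bound (hM : M.Admissible) : ∃ C, 0 ≤ C ∧ ∀ r, |M.J r| ≤ C := by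
  obtain ⟨C, hC⟩ := isCompact_univ.exists_bound_of_continuousOn hM.continuous_J.continuousOn
  exact ⟨C, (norm_nonneg _).trans (hC 0 (mem_univ _)), fun r => hC r (mem_univ _)⟩

theorem Data.Admissible.p_le_one (hM : M.Admissible) (i : Fin 2) : M.p i ≤ 1 := by
  rw [← hM.p_sum]
  exact Finset.single_le_sum (fun j _ => hM.p_nonneg j) (Finset.mem_univ i)

theorem Data.field_congr {u v : Fin 2 → Torus d → ℝ} (h : ∀ j, u j =ᵐ[volume] v j) (i : Fin 2)
    (r : Torus d) : M.field u i r = M.field v i r := by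
  unfold Data.field
  congr 1
  refine integral_congr_ae ?_
  filter_upwards [h 0, h 1] with x h0 h1
  simp [h0, h1]

theorem Data.Gam_congr {V u v : Fin 2 → Torus d → ℝ} (h : ∀ j, u j =ᵐ[volume] v j) :
    M.Gam V u = M.Gam V v := by
  unfold Data.Gam Data.F
  simp only [Data.field_congr h]
  congr 1
  refine Finset.sum_congr rfl fun i _ => integral_congr_ae ?_
  filter_upwards [h i] with x hx
  rw [hx]

theorem Data.Hstar_congr {u v g k : Fin 2 → Torus d → ℝ} (h : ∀ j, u j =ᵐ[volume] v j)
    (hg : ∀ j, g j =ᵐ[volume] k j) : M.Hstar u g = M.Hstar v k := by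
  unfold Data.Hstar
  refine iSup_congr fun V => iSup_congr fun _ => ?_
  have e : ∑ i, ∫ r, V i r * g i r = ∑ i, ∫ r, V i r * k i r := by
    refine Finset.sum_congr rfl fun i _ => integral_congr_ae ?_
    filter_upwards [hg i] with x hx
    rw [hx]
  rw [Data.Gam_congr h, e]

theorem Data.Hstar_nonneg (u g : Fin 2 → Torus d → ℝ) : 0 ≤ M.Hstar u g := by
  refine le_iSup₂_of_le (fun _ _ => 0) (fun i => MemLp.zero) ?_
  simp [Data.Gam, Data.F]

theorem measurable_field (hM : M.Admissible) {X : Type*} [MeasurableSpace X]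
    {w : Fin 2 → X × Torus d → ℝ} (hw : ∀ j, Measurable (w j)) (i : Fin 2) :
    Measurable fun z : X × Torus d => M.field (fun j r' => w j (z.1, r')) i z.2 := by
  unfold Data.field
  refine Measurable.add_const ?_ _
  have : Measurable fun y : (X × Torus d) × Torus d =>
      M.J (y.1.2 - y.2) * ∑ j, w j (y.1.1, y.2) := by
    refine (hM.continuous_J.measurable.comp ?_).mul (Finset.measurable_sum _ fun j _ =>
      (hw j).comp ?_)
    · exact (measurable_snd.comp measurable_fst).sub measurable_snd
    · exact (measurable_fst.comp measurable_fst).prodMk measurable_snd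
  exact (this.stronglyMeasurable.integral_prod_right').measurable

theorem Data.continuous_field (hM : M.Admissible) {u : Fin 2 → Torus d → ℝ}
    (hu : ∀ j, Integrable (u j)) (i : Fin 2) : Continuous (M.field u i) := by
  obtain ⟨C, hC0, hC⟩ := hM.exists_J_bound
  unfold Data.field
  refine Continuous.add ?_ continuous_const
  have hs : Integrable fun r => ∑ j, u j r := integrable_finsetSum _ fun j _ => hu j
  refine continuous_of_dominated (bound := fun r' => C * |∑ j, u j r'|) ?_ ?_ (hs.abs.const_mul C) ?_
  · intro r
    exact (hM.continuous_J.comp (continuous_const.sub continuous_id)).aestronglyMeasurable.mul hs.1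
  · intro r
    refine ae_of_all _ fun r' => ?_
    rw [norm_mul]
    exact mul_le_mul_of_nonneg_right (hC _) (norm_nonneg _)
  · refine ae_of_all _ fun r' => ?_
    exact (hM.continuous_J.comp (continuous_id.sub continuous_const)).mul continuous_const

end Interaction

theorem abs_tanh_le_one (x : ℝ) : |Real.tanh x| ≤ 1 := (Real.abs_tanh_lt_one x).le

theorem continuous_tanh : Continuous Real.tanh := by
  have : Real.tanh = fun x => Real.sinh x / Real.cosh x := funext Real.tanh_eq_sinh_div_cosh
  rw [this]
  exact Real.continuous_sinh.div Real.continuous_cosh fun x => (Real.cosh_pos x).ne'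

/-! ### The weak metric on `B_{1,1}` -/

namespace B11

variable {d : ℕ} {H : ℕ → C(Torus d, ℝ)}

theorem measurable_fn (u : B11 d H) (i : Fin 2) : Measurable (u.fn i) :=
  (Lp.stronglyMeasurable (u.val i)).measurable

theorem ae_abs_fn_le_norm (u : B11 d H) (i : Fin 2) : ∀ᵐ r, |u.fn i r| ≤ ‖u.val i‖ := by
  have h := ae_le_eLpNormEssSup (μ := volume) (f := u.val i)
  filter_upwards [h] with r hr
  rw [Lp.norm_def, eLpNorm_exponent_top, ← Real.norm_eq_abs, ← toReal_enorm]
  refine ENNReal.toReal_mono ?_ hr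
  rw [← eLpNorm_exponent_top]
  exact (Lp.memLp (u.val i)).2.ne

theorem ae_abs_fn_le_one (u : B11 d H) (i : Fin 2) : ∀ᵐ r, |u.fn i r| ≤ 1 := by
  filter_upwards [u.ae_abs_fn_le_norm i] with r hr
  exact hr.trans (u.norm_le i)

theorem norm_val_le_iff (u : B11 d H) (i : Fin 2) {K : ℝ} (hK : 0 ≤ K) :
    ‖u.val i‖ ≤ K ↔ ∀ᵐ r, |u.fn i r| ≤ K := by
  constructor
  · intro h
    filter_upwards [u.ae_abs_fn_le_norm i] with r hr
    exact hr.trans h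
  · intro h
    have := Lp.norm_le_of_ae_bound (p := ⊤) (f := u.val i) hK h
    simpa using this

theorem integrable_fn (u : B11 d H) (i : Fin 2) : Integrable (u.fn i) :=
  Integrable.of_bound (u.measurable_fn i).aestronglyMeasurable 1 (u.ae_abs_fn_le_one i)

theorem exists_of_ae_abs_le (H : ℕ → C(Torus d, ℝ)) (f : Fin 2 → Torus d → ℝ)
    (hf : ∀ i, Measurable (f i)) (hb : ∀ i, ∀ᵐ r, |f i r| ≤ 1) :
    ∃ u : B11 d H, ∀ i, u.fn i =ᵐ[volume] f i := by
  have hm : ∀ i, MemLp (f i) ⊤ (volume : Measure (Torus d)) := fun i =>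
    memLp_top_of_bound (hf i).aestronglyMeasurable 1 (hb i)
  refine ⟨⟨fun i => (hm i).toLp, fun i => ?_⟩, fun i => (hm i).coeFn_toLp⟩
  have := Lp.norm_le_of_ae_bound (p := ⊤) (f := (hm i).toLp) zero_le_one (by
    filter_upwards [hb i, (hm i).coeFn_toLp] with r hr h2
    rw [h2]; exact hr)
  simpa using this

theorem ext_of_ae_eq {u v : B11 d H} (h : ∀ i, u.fn i =ᵐ[volume] v.fn i) : u = v := by
  have : u.val = v.val := funext fun i => Lp.ext (h i)
  cases u; cases v; simp_all

theorem edist_def (u v : B11 d H) : edist u v =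
    ∑ i, ∑' k, ENNReal.ofReal ((1 / 2 : ℝ) ^ k * |u.pair i (H k) - v.pair i (H k)|) := rfl

theorem integrable_mul_fn (u : B11 d H) (i : Fin 2) (G : C(Torus d, ℝ)) :
    Integrable fun r => G r * u.fn i r :=
  (u.integrable_fn i).bdd_mul (c := ‖G‖) G.continuous.aestronglyMeasurable
    (ae_of_all _ fun r => G.norm_coe_le_norm r)

theorem abs_pair_sub_le (u v : B11 d H) (i : Fin 2) (G : C(Torus d, ℝ)) :
    |u.pair i G - v.pair i G| ≤ ‖G‖ * ∫ r, |u.fn i r - v.fn i r| := by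
  unfold pair
  rw [← integral_sub (u.integrable_mul_fn i G) (v.integrable_mul_fn i G), ← integral_const_mul]
  refine abs_integral_le_integral_abs.trans (integral_mono
    ((u.integrable_mul_fn i G).sub (v.integrable_mul_fn i G)).abs
    (((u.integrable_fn i).sub (v.integrable_fn i)).abs.const_mul _) fun r => ?_)
  simp only [← mul_sub, abs_mul]
  exact mul_le_mul_of_nonneg_right (G.norm_coe_le_norm r) (abs_nonneg _)

theorem tsum_ofReal_le {x : ℕ → ℝ} {C : ℝ} (hx : ∀ k, x k ≤ C) :
    ∑' k, ENNReal.ofReal ((1 / 2 : ℝ) ^ k * x k) ≤ 2 * ENNReal.ofReal C := by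
  calc ∑' k, ENNReal.ofReal ((1 / 2 : ℝ) ^ k * x k)
      ≤ ∑' k, ENNReal.ofReal ((1 / 2 : ℝ) ^ k) * ENNReal.ofReal C := by
        refine ENNReal.tsum_le_tsum fun k => ?_
        rw [← ENNReal.ofReal_mul (by positivity)]
        exact ENNReal.ofReal_le_ofReal (mul_le_mul_of_nonneg_left (hx k) (by positivity))
    _ = 2 * ENNReal.ofReal C := by
        rw [ENNReal.tsum_mul_right, ← ENNReal.ofReal_tsum_of_nonneg (fun n => by positivity)
          summable_geometric_two, tsum_geometric_two]
        norm_num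

/-- The factor 2 is the sum of the weights 2^{-k}. This domination by the L¹ distance turns bounds
on time derivatives into equicontinuity for ρ. -/
theorem edist_le (hH : ∀ k, ‖H k‖ ≤ 1) (u v : B11 d H) :
    edist u v ≤ ∑ i, 2 * ENNReal.ofReal (∫ r, |u.fn i r - v.fn i r|) := by
  rw [edist_def]
  refine Finset.sum_le_sum fun i _ => tsum_ofReal_le fun k => ?_
  refine (abs_pair_sub_le u v i (H k)).trans (mul_le_of_le_one_left ?_ (hH k))
  exact integral_nonneg fun r => abs_nonneg _

theorem integral_abs_sub_le (u v : B11 d H) (i : Fin 2) :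
    ∫ r, |u.fn i r - v.fn i r| ≤ 2 * (volume : Measure (Torus d)).real univ := by
  have : ∫ r : Torus d, (2 : ℝ) = 2 * (volume : Measure (Torus d)).real univ := by
    simp [mul_comm]
  rw [← this]
  refine integral_mono_ae ((u.integrable_fn i).sub (v.integrable_fn i)).abs (integrable_const _) ?_
  filter_upwards [u.ae_abs_fn_le_one i, v.ae_abs_fn_le_one i] with r h1 h2
  exact (abs_sub _ _).trans (by linarith)

/-- Convergence in `B_{1,1}` follows from convergence of the pairings with the sequence `H`. -/
theorem tendsto_of_tendsto_pair (hH : ∀ k, ‖H k‖ ≤ 1) {α : Type*} {l : Filter α} {x : α → B11 d H}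
    {y : B11 d H}
    (h : ∀ i k, Tendsto (fun a => (x a).pair i (H k)) l (𝓝 (y.pair i (H k)))) :
    Tendsto x l (𝓝 y) := by
  rw [tendsto_iff_edist_tendsto_0]
  set C := 2 * (volume : Measure (Torus d)).real univ with hC
  have hb : ∀ (a : α) (i : Fin 2) (k : ℕ), |(x a).pair i (H k) - y.pair i (H k)| ≤ C := fun a i k =>
    ((abs_pair_sub_le _ _ i (H k)).trans (mul_le_of_le_one_left
      (integral_nonneg fun r => abs_nonneg _) (hH k))).trans (integral_abs_sub_le _ _ i)
  have hs : Summable fun k : ℕ => (1 / 2 : ℝ) ^ k * C := summable_geometric_two.mul_right C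
  have e : ∀ a, edist (x a) y = ENNReal.ofReal
      (∑ i, ∑' k, (1 / 2 : ℝ) ^ k * |(x a).pair i (H k) - y.pair i (H k)|) := by
    intro a
    rw [edist_def, ENNReal.ofReal_sum_of_nonneg fun i _ => tsum_nonneg fun k => by positivity]
    refine Finset.sum_congr rfl fun i _ => ?_
    rw [ENNReal.ofReal_tsum_of_nonneg (fun k => by positivity)]
    exact Summable.of_nonneg_of_le (fun k => by positivity)
      (fun k => mul_le_mul_of_nonneg_left (hb a i k) (by positivity)) hs
  simp only [e]
  rw [← ENNReal.ofReal_zero]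
  refine (ENNReal.continuous_ofReal.tendsto 0).comp ?_
  have z : (0 : ℝ) = ∑ i : Fin 2, ∑' k : ℕ, (0 : ℝ) := by simp
  rw [z]
  refine tendsto_finsetSum _ fun i _ => tendsto_tsum_of_dominated_convergence hs (fun k => ?_)
    (Eventually.of_forall fun a k => ?_)
  · have := ((h i k).sub_const (y.pair i (H k))).abs.const_mul ((1 / 2 : ℝ) ^ k)
    simpa using this
  · rw [norm_mul, Real.norm_eq_abs, Real.norm_eq_abs, abs_abs, abs_of_nonneg (by positivity)]
    exact mul_le_mul_of_nonneg_left (hb a i k) (by positivity)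

theorem ofReal_abs_pair_sub_le (u v : B11 d H) (i : Fin 2) (k : ℕ) :
    ENNReal.ofReal |u.pair i (H k) - v.pair i (H k)| ≤ 2 ^ k * edist u v := by
  have h1 : ENNReal.ofReal ((1 / 2 : ℝ) ^ k * |u.pair i (H k) - v.pair i (H k)|) ≤ edist u v := by
    rw [edist_def]
    refine (ENNReal.le_tsum k).trans (Finset.single_le_sum (f := fun i => ∑' k,
      ENNReal.ofReal ((1 / 2 : ℝ) ^ k * |u.pair i (H k) - v.pair i (H k)|))
      (fun j _ => zero_le) (Finset.mem_univ i))
  calc ENNReal.ofReal |u.pair i (H k) - v.pair i (H k)|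
      = 2 ^ k * ENNReal.ofReal ((1 / 2 : ℝ) ^ k * |u.pair i (H k) - v.pair i (H k)|) := by
        rw [show (2 : ENNReal) ^ k = ENNReal.ofReal (2 ^ k) by
          rw [ENNReal.ofReal_pow (by norm_num)]; norm_num, ← ENNReal.ofReal_mul (by positivity),
          ← mul_assoc, ← mul_pow]
        norm_num
    _ ≤ _ := mul_le_mul_right h1 _

theorem continuous_pair_seq (i : Fin 2) (k : ℕ) : Continuous fun u : B11 d H => u.pair i (H k) := by
  refine continuous_iff_continuousAt.2 fun u => tendsto_iff_edist_tendsto_0.2 ?_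
  have h : Tendsto (fun v : B11 d H => 2 ^ k * edist v u) (𝓝 u) (𝓝 (2 ^ k * 0)) :=
    ENNReal.Tendsto.const_mul (tendsto_iff_edist_tendsto_0.1 tendsto_id)
      (Or.inr (ENNReal.pow_ne_top (by norm_num)))
  rw [mul_zero] at h
  refine tendsto_of_tendsto_of_tendsto_of_le_of_le tendsto_const_nhds h (fun _ => zero_le)
    fun v => ?_
  change edist (v.pair i (H k)) (u.pair i (H k)) ≤ _
  rw [edist_dist, Real.dist_eq]
  exact ofReal_abs_pair_sub_le v u i k

/-- Every continuous function is uniformly approximated by multiples of the `H_k`. -/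
theorem exists_approx (hHd : Metric.closedBall (0 : C(Torus d, ℝ)) 1 ⊆ closure (Set.range H))
    (G : C(Torus d, ℝ)) {ε : ℝ} (hε : 0 < ε) : ∃ c : ℝ, ∃ k, ‖G - c • H k‖ ≤ ε := by
  -- The scaling brings G into the unit ball; the added 1 covers G = 0.
  set c := ‖G‖ + 1 with hc
  have hc0 : 0 < c := by positivity
  have hm : c⁻¹ • G ∈ Metric.closedBall (0 : C(Torus d, ℝ)) 1 := by
    rw [mem_closedBall_zero_iff, norm_smul, norm_inv, Real.norm_of_nonneg hc0.le,
      inv_mul_le_iff₀ hc0]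
    linarith
  obtain ⟨_, ⟨k, rfl⟩, hk⟩ := Metric.mem_closure_iff.1 (hHd hm) (ε / c) (by positivity)
  refine ⟨c, k, ?_⟩
  have : G - c • H k = c • (c⁻¹ • G - H k) := by
    rw [smul_sub, smul_smul, mul_inv_cancel₀ hc0.ne', one_smul]
  rw [this, norm_smul, Real.norm_of_nonneg hc0.le]
  rw [dist_eq_norm] at hk
  calc c * ‖c⁻¹ • G - H k‖ ≤ c * (ε / c) := by gcongr
    _ = ε := by field_simp

theorem pair_smul (u : B11 d H) (i : Fin 2) (c : ℝ) (G : C(Torus d, ℝ)) :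
    u.pair i (c • G) = c * u.pair i G := by
  unfold pair
  rw [← integral_const_mul]
  congr 1 with r
  simp [mul_assoc]

theorem abs_pair_le (u : B11 d H) (i : Fin 2) (G : C(Torus d, ℝ)) :
    |u.pair i G| ≤ ‖G‖ * (volume : Measure (Torus d)).real univ := by
  unfold pair
  have := norm_integral_le_of_norm_le_const (μ := volume) (f := fun r => G r * u.fn i r)
    (C := ‖G‖) (by
      filter_upwards [u.ae_abs_fn_le_one i] with r hr
      rw [norm_mul]
      calc _ ≤ ‖G‖ * 1 := mul_le_mul (G.norm_coe_le_norm r) hr (abs_nonneg _) (norm_nonneg _)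
        _ = _ := mul_one _)
  simpa using this

theorem pair_sub (u : B11 d H) (i : Fin 2) (F G : C(Torus d, ℝ)) :
    u.pair i (F - G) = u.pair i F - u.pair i G := by
  unfold pair
  rw [← integral_sub (u.integrable_mul_fn i F) (u.integrable_mul_fn i G)]
  congr 1 with r
  simp [sub_mul]

/-- On `B_{1,1}` a pairing is bounded by the sup norm of its test function, so pairing with G is a
uniform limit of multiples of pairings with the H_k, each continuous for ρ. -/
theorem continuous_pair (hHd : Metric.closedBall (0 : C(Torus d, ℝ)) 1 ⊆ closure (Set.range H))
    (i : Fin 2) (G : C(Torus d, ℝ)) : Continuous fun u : B11 d H => u.pair i G := by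
  refine continuous_of_uniform_approx_of_continuous fun U hU => ?_
  obtain ⟨ε, hε, hεU⟩ := Metric.mem_uniformity_dist.1 hU
  set m := (volume : Measure (Torus d)).real univ with hm
  have hm0 : 0 ≤ m := measureReal_nonneg
  obtain ⟨c, k, hck⟩ := exists_approx hHd G (ε := ε / 2 / (m + 1)) (by positivity)
  refine ⟨fun u => c * u.pair i (H k), continuous_const.mul (continuous_pair_seq i k),
    fun u => hεU ?_⟩
  change dist (u.pair i G) (c * u.pair i (H k)) < ε
  rw [Real.dist_eq, ← pair_smul, ← pair_sub]
  refine (u.abs_pair_le i _).trans_lt ?_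
  calc ‖G - c • H k‖ * m ≤ ε / 2 / (m + 1) * m := by gcongr
    _ = ε / 2 * (m / (m + 1)) := by ring
    _ ≤ ε / 2 * 1 := by
      gcongr
      rw [div_le_one (by positivity)]
      linarith
    _ < ε := by linarith

/-- Since |f|, |g| ≤ 1, the functions 1 + f and 1 + g are densities of finite positive measures, and
finite measures are determined by their integrals of continuous functions. -/
theorem ae_eq_of_forall_integral_eq {f g : Torus d → ℝ} (hf : Measurable f) (hg : Measurable g)
    (hfb : ∀ᵐ r, |f r| ≤ 1) (hgb : ∀ᵐ r, |g r| ≤ 1)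
    (h : ∀ G : C(Torus d, ℝ), ∫ r, G r * f r = ∫ r, G r * g r) : f =ᵐ[volume] g := by
  have hi : ∀ f : Torus d → ℝ, Measurable f → (∀ᵐ r, |f r| ≤ 1) → Integrable f := fun f hf hfb =>
    Integrable.of_bound hf.aestronglyMeasurable 1 hfb
  have key : ∀ f : Torus d → ℝ, Measurable f → (∀ᵐ r, |f r| ≤ 1) → ∀ G : C(Torus d, ℝ),
      ∫ r, G r ∂(volume.withDensity fun r => ENNReal.ofReal (1 + f r)) =
        (∫ r, G r) + ∫ r, G r * f r := by
    intro f hf hfb G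
    rw [integral_withDensity_eq_integral_toReal_smul (by fun_prop) (by simp)]
    have hG : Integrable (fun r => G r * f r) := (hi f hf hfb).bdd_mul (c := ‖G‖)
      G.continuous.aestronglyMeasurable (ae_of_all _ fun r => G.norm_coe_le_norm r)
    have hG' : Integrable (fun r => G r) := Integrable.of_bound
      G.continuous.aestronglyMeasurable ‖G‖ (ae_of_all _ fun r => G.norm_coe_le_norm r)
    rw [← integral_add hG' hG]
    refine integral_congr_ae ?_
    filter_upwards [hfb] with r hr
    rw [ENNReal.toReal_ofReal (by linarith [(abs_le.1 hr).1]), smul_eq_mul]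
    ring
  have hfin : ∀ f : Torus d → ℝ, Measurable f → (∀ᵐ r, |f r| ≤ 1) →
      IsFiniteMeasure (volume.withDensity fun r => ENNReal.ofReal (1 + f r)) := fun f hf hfb =>
    isFiniteMeasure_withDensity_ofReal ((integrable_const 1).add (hi f hf hfb)).2
  have := hfin f hf hfb
  have := hfin g hg hgb
  have heq : volume.withDensity (fun r => ENNReal.ofReal (1 + f r)) =
      volume.withDensity (fun r => ENNReal.ofReal (1 + g r)) := by
    refine ext_of_forall_integral_eq_of_IsFiniteMeasure fun G => ?_
    have e1 := key f hf hfb G.toContinuousMap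
    have e2 := key g hg hgb G.toContinuousMap
    rw [h] at e1
    exact e1.trans e2.symm
  have h2 := (withDensity_eq_iff (by fun_prop) (by fun_prop) ((integrable_const (1 : ℝ)).add
    (hi f hf hfb)).lintegral_lt_top.ne).1 heq
  filter_upwards [h2, hfb, hgb] with r hr h1 h2
  change ENNReal.ofReal (1 + f r) = ENNReal.ofReal (1 + g r) at hr
  have := (ENNReal.ofReal_eq_ofReal_iff (by linarith [(abs_le.1 h1).1])
    (by linarith [(abs_le.1 h2).1])).1 hr
  linarith

/-- Points at distance zero are not separated by continuous functions, in particular not by the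
pairings, which determine the densities. Thus ρ is a genuine metric, and limits of densities are
unique. -/
theorem eq_of_edist_eq_zero
    (hHd : Metric.closedBall (0 : C(Torus d, ℝ)) 1 ⊆ closure (Set.range H)) {u v : B11 d H}
    (h : edist u v = 0) : u = v := by
  have hi : Inseparable u v := EMetric.inseparable_iff.2 h
  refine ext_of_ae_eq fun i => ae_eq_of_forall_integral_eq (u.measurable_fn i) (v.measurable_fn i)
    (u.ae_abs_fn_le_one i) (v.ae_abs_fn_le_one i) fun G => ?_
  exact (hi.map (continuous_pair hHd i G)).eq

end B11

end KacRate

/-! ### The variational formula in space-time -/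

namespace KacRate

noncomputable section

instance (T : ℝ) : IsFiniteMeasure (timeMeasure T) := by
  constructor
  rw [(MeasurableEmbedding.subtype_coe measurableSet_Icc).comap_apply]
  refine (measure_mono (image_subset_iff.2 fun x _ => x.2)).trans_lt
    (measure_Icc_lt_top (a := (0 : ℝ)) (b := T))

/-- The integrand of `⟨V, g⟩ - Γ_V(u) / 2` as a function of the values at a point. -/
def cost (p τ u g v : ℝ) : ℝ :=
  v * g - 1 / 2 * ((p - u * τ) * (Real.cosh (2 * v) - 1) + (p * τ - u) * Real.sinh (2 * v))

@[simp] theorem cost_zero (p τ u g : ℝ) : cost p τ u g 0 = 0 := by simp [cost]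

theorem continuous_cost (p τ u g : ℝ) : Continuous fun v => cost p τ u g v := by
  unfold cost; fun_prop

theorem abs_sinh_le {x C : ℝ} (h : |x| ≤ C) : |Real.sinh x| ≤ Real.cosh C := by
  rw [Real.abs_sinh]
  exact (Real.sinh_lt_cosh _).le.trans (Real.cosh_le_cosh.2 (by rwa [abs_abs, abs_of_nonneg ((abs_nonneg x).trans h)]))

theorem abs_cosh_sub_one_le {x C : ℝ} (h : |x| ≤ C) : |Real.cosh x - 1| ≤ Real.cosh C := by
  have h1 := Real.one_le_cosh x
  have h2 : Real.cosh x ≤ Real.cosh C :=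
    Real.cosh_le_cosh.2 (by rwa [abs_of_nonneg ((abs_nonneg x).trans h)])
  rw [abs_of_nonneg (by linarith)]
  linarith

theorem abs_rate_le {p τ u v C : ℝ} (hp : |p| ≤ 1) (hτ : |τ| ≤ 1) (hu : |u| ≤ 1) (hv : |v| ≤ C) :
    |(p - u * τ) * (Real.cosh (2 * v) - 1) + (p * τ - u) * Real.sinh (2 * v)| ≤
      4 * Real.cosh (2 * C) := by
  have h2 : |2 * v| ≤ 2 * C := by rw [abs_mul, abs_two]; linarith
  have a1 := abs_sinh_le h2
  have a2 := abs_cosh_sub_one_le h2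
  have b1 : |p - u * τ| ≤ 2 := (abs_sub _ _).trans (by
    rw [abs_mul]; have := mul_le_one₀ hu (abs_nonneg τ) hτ; linarith)
  have b2 : |p * τ - u| ≤ 2 := (abs_sub _ _).trans (by
    rw [abs_mul]; have := mul_le_one₀ hp (abs_nonneg τ) hτ; linarith)
  refine (abs_add_le _ _).trans ?_
  rw [abs_mul, abs_mul]
  have c1 := mul_le_mul b1 a2 (abs_nonneg _) (by norm_num)
  have c2 := mul_le_mul b2 a1 (abs_nonneg _) (by norm_num)
  linarith

theorem integrable_rate {Ω : Type*} [MeasurableSpace Ω] {μ : Measure Ω} [IsFiniteMeasure μ] {p : ℝ}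
    {τ u v : Ω → ℝ} (hp : |p| ≤ 1) (hτm : AEStronglyMeasurable τ μ) (hτ : ∀ᵐ x ∂μ, |τ x| ≤ 1)
    (hum : AEStronglyMeasurable u μ) (hu : ∀ᵐ x ∂μ, |u x| ≤ 1) (hvm : AEStronglyMeasurable v μ)
    {C : ℝ} (hv : ∀ᵐ x ∂μ, |v x| ≤ C) :
    Integrable (fun x => (p - u x * τ x) * (Real.cosh (2 * v x) - 1) +
      (p * τ x - u x) * Real.sinh (2 * v x)) μ := by
  refine Integrable.of_bound ?_ (4 * Real.cosh (2 * C)) ?_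
  · have h1 : AEStronglyMeasurable (fun x => Real.cosh (2 * v x)) μ :=
      (Real.continuous_cosh.comp (continuous_const.mul continuous_id)).comp_aestronglyMeasurable hvm
    have h2 : AEStronglyMeasurable (fun x => Real.sinh (2 * v x)) μ :=
      (Real.continuous_sinh.comp (continuous_const.mul continuous_id)).comp_aestronglyMeasurable hvm
    exact ((aestronglyMeasurable_const.sub (hum.mul hτm)).mul
      (h1.sub aestronglyMeasurable_const)).add (((aestronglyMeasurable_const.mul hτm).sub hum).mul h2)
  · filter_upwards [hτ, hu, hv] with x h1 h2 h3
    exact abs_rate_le hp h1 h2 h3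

theorem integrable_cost {Ω : Type*} [MeasurableSpace Ω] {μ : Measure Ω} [IsFiniteMeasure μ] {p : ℝ}
    {τ u g v : Ω → ℝ} (hp : |p| ≤ 1) (hτm : AEStronglyMeasurable τ μ) (hτ : ∀ᵐ x ∂μ, |τ x| ≤ 1)
    (hum : AEStronglyMeasurable u μ) (hu : ∀ᵐ x ∂μ, |u x| ≤ 1) (hvm : AEStronglyMeasurable v μ)
    {C : ℝ} (hv : ∀ᵐ x ∂μ, |v x| ≤ C) (hg : Integrable g μ) :
    Integrable (fun x => cost p (τ x) (u x) (g x) (v x)) μ :=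
  (hg.bdd_mul (c := C) hvm hv).sub ((integrable_rate hp hτm hτ hum hu hvm hv).const_mul _)

theorem exists_ae_abs_le_of_memLp_top {Ω : Type*} [MeasurableSpace Ω] {μ : Measure Ω} {f : Ω → ℝ}
    (hf : MemLp f ⊤ μ) : ∃ C, ∀ᵐ r ∂μ, |f r| ≤ C := by
  refine ⟨(eLpNorm f ⊤ μ).toReal, ?_⟩
  have h := ae_le_eLpNormEssSup (μ := μ) (f := f)
  filter_upwards [h] with r hr
  rw [eLpNorm_exponent_top, ← Real.norm_eq_abs, ← toReal_enorm]
  refine ENNReal.toReal_mono ?_ hr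
  rw [← eLpNorm_exponent_top]
  exact hf.2.ne

section Lagrangian

variable {d : ℕ} {M : Data d}

theorem Data.Admissible.abs_p_le (hM : M.Admissible) (i : Fin 2) : |M.p i| ≤ 1 := by
  rw [abs_of_nonneg (hM.p_nonneg i)]; exact hM.p_le_one i

theorem measurable_tanh : Measurable Real.tanh := continuous_tanh.measurable

theorem continuous_tanh_field (hM : M.Admissible) {u : Fin 2 → Torus d → ℝ}
    (hu : ∀ j, Integrable (u j)) (i : Fin 2) :
    Continuous fun r => Real.tanh (M.field u i r) :=
  continuous_tanh.comp (M.continuous_field hM hu i)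

/-- Collecting the coefficients of cosh - 1 and sinh makes Γ a single integral of a function of
point values, so that the supremum over V can be taken pointwise. -/
theorem Gam_eq (hM : M.Admissible) {V u : Fin 2 → Torus d → ℝ} (hu : ∀ j, Measurable (u j))
    (hub : ∀ j, ∀ᵐ r, |u j r| ≤ 1) (hV : ∀ j, MemLp (V j) ⊤ volume) :
    M.Gam V u = ∑ i, ∫ r, ((M.p i - u i r * Real.tanh (M.field u i r)) *
      (Real.cosh (2 * V i r) - 1) + (M.p i * Real.tanh (M.field u i r) - u i r) *
        Real.sinh (2 * V i r)) := by
  have hui : ∀ j, Integrable (u j) := fun j =>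
    Integrable.of_bound (hu j).aestronglyMeasurable 1 (hub j)
  unfold Data.Gam Data.F
  rw [← Finset.sum_sub_distrib]
  refine Finset.sum_congr rfl fun i _ => ?_
  have hτ := (continuous_tanh_field hM hui i).aestronglyMeasurable (μ := volume)
  obtain ⟨C, hC⟩ := exists_ae_abs_le_of_memLp_top (hV i)
  -- The p-part of Γ is the rate with u replaced by 0 while the field stays that of u.
  have h0 := integrable_rate (μ := volume) (p := M.p i) (u := fun _ => 0) (hM.abs_p_le i) hτ
    (ae_of_all _ fun r => abs_tanh_le_one _) aestronglyMeasurable_const (by simp) (hV i).1 hC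
  have h1 := integrable_rate (μ := volume) (p := M.p i) (hM.abs_p_le i) hτ
    (ae_of_all _ fun r => abs_tanh_le_one _) (hu i).aestronglyMeasurable (hub i) (hV i).1 hC
  have e0 : (fun r => M.p i * (Real.tanh (M.field u i r) * Real.sinh (2 * V i r) +
      Real.cosh (2 * V i r) - 1)) = fun r => ((M.p i - 0 * Real.tanh (M.field u i r)) *
      (Real.cosh (2 * V i r) - 1) + (M.p i * Real.tanh (M.field u i r) - 0) *
        Real.sinh (2 * V i r)) := by
    funext r; ring
  rw [e0, ← integral_sub h0]
  · congr 1 with r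
    ring
  · refine (h0.sub h1).congr (ae_of_all _ fun r => ?_)
    simp only [Pi.sub_apply]
    ring

theorem lagrangian_eq (hM : M.Admissible) {V u g : Fin 2 → Torus d → ℝ} (hu : ∀ j, Measurable (u j))
    (hub : ∀ j, ∀ᵐ r, |u j r| ≤ 1) (hg : ∀ j, Integrable (g j)) (hV : ∀ j, MemLp (V j) ⊤ volume) :
    (∑ i, ∫ r, V i r * g i r) - 1 / 2 * M.Gam V u =
      ∑ i, ∫ r, cost (M.p i) (Real.tanh (M.field u i r)) (u i r) (g i r) (V i r) := by
  have hui : ∀ j, Integrable (u j) := fun j =>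
    Integrable.of_bound (hu j).aestronglyMeasurable 1 (hub j)
  rw [Gam_eq hM hu hub hV, Finset.mul_sum, ← Finset.sum_sub_distrib]
  refine Finset.sum_congr rfl fun i _ => ?_
  obtain ⟨C, hC⟩ := exists_ae_abs_le_of_memLp_top (hV i)
  rw [← integral_const_mul, ← integral_sub ((hg i).bdd_mul (c := C) (hV i).1 hC)
    ((integrable_rate (hM.abs_p_le i)
      (continuous_tanh_field hM hui i).aestronglyMeasurable
      (ae_of_all _ fun r => abs_tanh_le_one _) (hu i).aestronglyMeasurable (hub i) (hV i).1
        hC).const_mul _)]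
  rfl

end Lagrangian

section SpaceTime

variable {d : ℕ} {M : Data d} {T : ℝ}

/-- The product of Lebesgue measure on `[0,T]` and on the torus. -/
abbrev spaceTime (T : ℝ) (d : ℕ) : Measure (Icc (0 : ℝ) T × Torus d) :=
  (timeMeasure T).prod volume

/-- `tanh (J * u + a_i θ)` along a path of densities. -/
def Data.tanhField (M : Data d) (w : Fin 2 → Icc (0 : ℝ) T × Torus d → ℝ) (i : Fin 2)
    (z : Icc (0 : ℝ) T × Torus d) : ℝ :=
  Real.tanh (M.field (fun j r' => w j (z.1, r')) i z.2)

/-- The space-time integrand of the variational formula. -/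
def Data.costAt (M : Data d) (w g V : Fin 2 → Icc (0 : ℝ) T × Torus d → ℝ) (i : Fin 2)
    (z : Icc (0 : ℝ) T × Torus d) : ℝ :=
  cost (M.p i) (M.tanhField w i z) (w i z) (g i z) (V i z)

/-- Bounded measurable pairs of functions. -/
def BddMeas {Ω : Type*} [MeasurableSpace Ω] (V : Fin 2 → Ω → ℝ) : Prop :=
  (∀ i, Measurable (V i)) ∧ ∃ C, ∀ i z, |V i z| ≤ C

theorem measurable_tanhField (hM : M.Admissible) {w : Fin 2 → Icc (0 : ℝ) T × Torus d → ℝ}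
    (hw : ∀ j, Measurable (w j)) (i : Fin 2) : Measurable (M.tanhField w i) :=
  measurable_tanh.comp (measurable_field hM hw i)

theorem abs_tanhField_le (w : Fin 2 → Icc (0 : ℝ) T × Torus d → ℝ) (i : Fin 2)
    (z : Icc (0 : ℝ) T × Torus d) : |M.tanhField w i z| ≤ 1 := abs_tanh_le_one _

theorem integrable_costAt (hM : M.Admissible) {w g V : Fin 2 → Icc (0 : ℝ) T × Torus d → ℝ}
    (hw : ∀ j, Measurable (w j)) (hwb : ∀ j z, |w j z| ≤ 1)
    (hg : ∀ j, Integrable (g j) (spaceTime T d)) (hV : BddMeas V) (i : Fin 2) :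
    Integrable (M.costAt w g V i) (spaceTime T d) := by
  obtain ⟨hVm, C, hC⟩ := hV
  exact integrable_cost (hM.abs_p_le i) (measurable_tanhField hM hw i).aestronglyMeasurable
    (ae_of_all _ fun z => abs_tanhField_le w i z) (hw i).aestronglyMeasurable
    (ae_of_all _ fun z => hwb i z) (hVm i).aestronglyMeasurable (ae_of_all _ fun z => hC i z) (hg i)

theorem measurable_costAt (hM : M.Admissible) {w g V : Fin 2 → Icc (0 : ℝ) T × Torus d → ℝ}
    (hw : ∀ j, Measurable (w j)) (hg : ∀ j, Measurable (g j)) (hV : ∀ j, Measurable (V j))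
    (i : Fin 2) : Measurable (M.costAt w g V i) := by
  have h1 := measurable_tanhField hM hw i
  have h2 := hw i
  have h3 := hg i
  have h4 : Measurable fun z => 2 * V i z := (hV i).const_mul 2
  have h5 := Real.continuous_cosh.measurable.comp h4
  have h6 := Real.continuous_sinh.measurable.comp h4
  exact ((hV i).mul h3).sub ((((measurable_const.sub (h2.mul h1)).mul (h5.sub measurable_const)).add
    (((measurable_const.mul h1).sub h2).mul h6)).const_mul _)

theorem ofReal_integral_le_lintegral {Ω : Type*} [MeasurableSpace Ω] {μ : Measure Ω} (f : Ω → ℝ) :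
    ENNReal.ofReal (∫ x, f x ∂μ) ≤ ∫⁻ x, ENNReal.ofReal (f x) ∂μ := by
  by_cases hf : Integrable f μ
  · rw [integral_eq_lintegral_pos_part_sub_lintegral_neg_part hf]
    refine (ENNReal.ofReal_le_ofReal (sub_le_self _ ENNReal.toReal_nonneg)).trans
      ENNReal.ofReal_toReal_le
  · rw [integral_undef hf]; simp

/-- The lower bound in the variational formula. -/
theorem ofReal_integral_costAt_le (hM : M.Admissible)
    {w g V : Fin 2 → Icc (0 : ℝ) T × Torus d → ℝ}
    (hw : ∀ j, Measurable (w j)) (hwb : ∀ j z, |w j z| ≤ 1)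
    (hg : ∀ j, Integrable (g j) (spaceTime T d)) (hV : BddMeas V) :
    ENNReal.ofReal (∫ z, ∑ i, M.costAt w g V i z ∂(spaceTime T d)) ≤
      ∫⁻ s, (M.Hstar (fun i r => w i (s, r)) (fun i r => g i (s, r))).toENNReal
        ∂(timeMeasure T) := by
  have hi := integrable_finsetSum Finset.univ fun i _ => integrable_costAt hM hw hwb hg hV i
  rw [integral_prod _ hi]
  refine (ofReal_integral_le_lintegral _).trans (lintegral_mono_ae ?_)
  have hgs : ∀ᵐ s ∂(timeMeasure T), ∀ j, Integrable fun r => g j (s, r) :=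
    ae_all_iff.2 fun j => (hg j).prod_right_ae
  have hcs : ∀ᵐ s ∂(timeMeasure T), ∀ j, Integrable fun r => M.costAt w g V j (s, r) :=
    ae_all_iff.2 fun j => (integrable_costAt hM hw hwb hg hV j).prod_right_ae
  obtain ⟨hVm, C, hC⟩ := hV
  filter_upwards [hgs, hcs] with s h1 h2
  rw [integral_finsetSum _ fun i _ => h2 i]
  have hVs : ∀ j, MemLp (fun r => V j (s, r)) ⊤ volume := fun j =>
    memLp_top_of_bound ((hVm j).comp measurable_prodMk_left).aestronglyMeasurable C
      (ae_of_all _ fun r => hC j _)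
  have e := lagrangian_eq hM (V := fun j r => V j (s, r)) (u := fun j r => w j (s, r))
    (g := fun j r => g j (s, r)) (fun j => (hw j).comp measurable_prodMk_left)
    (fun j => ae_of_all _ fun r => hwb j _) h1 hVs
  have e2 : ∑ i, ∫ r, M.costAt w g V i (s, r) = (∑ i, ∫ r, V i (s, r) * g i (s, r)) -
    1 / 2 * M.Gam (fun j r => V j (s, r)) (fun j r => w j (s, r)) := e.symm
  rw [e2, ← EReal.real_coe_toENNReal]
  refine EReal.toENNReal_le_toENNReal ?_
  exact le_iSup₂_of_le (fun j r => V j (s, r)) hVs le_rfl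

/-- The upper bound in the variational formula. -/
theorem lintegral_Hstar_le (hM : M.Admissible)
    {w g : Fin 2 → Icc (0 : ℝ) T × Torus d → ℝ}
    (hw : ∀ j, Measurable (w j)) (hwb : ∀ j z, |w j z| ≤ 1) (hgm : ∀ j, Measurable (g j))
    (hg : ∀ j, Integrable (g j) (spaceTime T d)) {L : ℝ}
    (hL : ∀ V, BddMeas V → ∫ z, ∑ i, M.costAt w g V i z ∂(spaceTime T d) ≤ L) :
    ∫⁻ s, (M.Hstar (fun i r => w i (s, r)) (fun i r => g i (s, r))).toENNReal ∂(timeMeasure T) ≤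
      ENNReal.ofReal L := by
  let e : ℕ → ℝ := fun n => TopologicalSpace.denseSeq ℝ n
  have he : DenseRange e := TopologicalSpace.denseRange_denseSeq ℝ
  let c : Fin 2 → Icc (0 : ℝ) T × Torus d → ℝ → ℝ := fun i z v =>
    cost (M.p i) (M.tanhField w i z) (w i z) (g i z) v
  -- A greedy measurable selection: V n takes at each point a best value among 0 and the first n
  -- members of a dense sequence. Starting from 0 makes all the costs non-negative, and they
  -- increase with n.
  let V : ℕ → Fin 2 → Icc (0 : ℝ) T × Torus d → ℝ := fun n => Nat.rec (fun _ _ => 0)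
    (fun n W i z => if c i z (W i z) < c i z (e n) then e n else W i z) n
  have hVs : ∀ n i z, V (n + 1) i z = if c i z (V n i z) < c i z (e n) then e n else V n i z :=
    fun n i z => rfl
  have hVb : ∀ n, BddMeas (V n) := by
    intro n
    induction n with
    | zero => exact ⟨fun i => measurable_const, 0, fun i z => by simp [V]⟩
    | succ n ih =>
      obtain ⟨hm, C, hC⟩ := ih
      refine ⟨fun i => ?_, max C |e n|, fun i z => ?_⟩
      · have : V (n + 1) i = fun z => if c i z (V n i z) < c i z (e n) then e n else V n i z :=
          funext fun z => hVs n i z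
        rw [this]
        refine Measurable.ite (measurableSet_lt (measurable_costAt hM hw hgm hm i)
          (measurable_costAt hM hw hgm (V := fun _ _ => e n) (fun _ => measurable_const) i))
          measurable_const (hm i)
      · rw [hVs]
        split_ifs
        · exact le_max_right _ _
        · exact (hC i z).trans (le_max_left _ _)
  have hmono : ∀ i z, Monotone fun n => c i z (V n i z) := by
    intro i z
    refine monotone_nat_of_le_succ fun n => ?_
    rw [hVs]
    split_ifs with h
    · exact h.le
    · exact le_rfl
  have hge : ∀ n i z, c i z (e n) ≤ c i z (V (n + 1) i z) := by
    intro n i z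
    rw [hVs]
    split_ifs with h
    · exact le_rfl
    · exact not_lt.1 h
  have hpos : ∀ n i z, 0 ≤ c i z (V n i z) := by
    intro n i z
    refine le_trans ?_ (hmono i z (Nat.zero_le n))
    simp [c, V]
  let Ψ : Fin 2 → Icc (0 : ℝ) T × Torus d → ENNReal := fun i z =>
    ⨆ n, ENNReal.ofReal (c i z (V n i z))
  -- The cost is continuous in v, so the supremum along a dense sequence dominates every value.
  have hΨ : ∀ i z v, ENNReal.ofReal (c i z v) ≤ Ψ i z := by
    intro i z v
    have hcl : IsClosed {v | ENNReal.ofReal (c i z v) ≤ Ψ i z} :=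
      isClosed_le (ENNReal.continuous_ofReal.comp (continuous_cost _ _ _ _)) continuous_const
    have : range e ⊆ {v | ENNReal.ofReal (c i z v) ≤ Ψ i z} := by
      rintro _ ⟨n, rfl⟩
      exact (ENNReal.ofReal_le_ofReal (hge n i z)).trans
        (le_iSup (fun n => ENNReal.ofReal (c i z (V n i z))) (n + 1))
    exact (hcl.closure_subset_iff.2 this) (he v)
  have hcm : ∀ n i, Measurable fun z => ENNReal.ofReal (c i z (V n i z)) := fun n i =>
    (measurable_costAt hM hw hgm (hVb n).1 i).ennreal_ofReal
  have hΨm : ∀ i, Measurable (Ψ i) := fun i => Measurable.iSup fun n => hcm n i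
  calc ∫⁻ s, (M.Hstar (fun i r => w i (s, r)) (fun i r => g i (s, r))).toENNReal ∂(timeMeasure T)
      -- The lower integral is monotone for arbitrary functions, so no measurability of s ↦ 𝓗* is
      -- needed: only the majorant Ψ has to be measurable.
      ≤ ∫⁻ s, (∫⁻ r, ∑ i, Ψ i (s, r)) ∂(timeMeasure T) := by
        refine lintegral_mono_ae ?_
        have hgs : ∀ᵐ s ∂(timeMeasure T), ∀ j, Integrable fun r => g j (s, r) :=
          ae_all_iff.2 fun j => (hg j).prod_right_ae
        filter_upwards [hgs] with s hs
        unfold Data.Hstar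
        rw [← EReal.toENNReal_coe (x := ∫⁻ r, ∑ i, Ψ i (s, r))]
        refine EReal.toENNReal_le_toENNReal (iSup₂_le fun W hW => ?_)
        have hls := lagrangian_eq hM (V := W) (u := fun j r => w j (s, r))
          (g := fun j r => g j (s, r)) (fun j => (hw j).comp measurable_prodMk_left)
          (fun j => ae_of_all _ fun r => hwb j _) hs hW
        refine (EReal.coe_le_coe_iff.2 hls.le).trans ?_
        have h1 : ENNReal.ofReal (∑ i, ∫ r, c i (s, r) (W i r)) ≤ ∫⁻ r, ∑ i, Ψ i (s, r) := by
          rw [lintegral_finsetSum (f := fun i r => Ψ i (s, r)) _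
            fun i _ => (hΨm i).comp measurable_prodMk_left]
          rw [Fin.sum_univ_two, Fin.sum_univ_two]
          exact ENNReal.ofReal_add_le.trans (add_le_add
            ((ofReal_integral_le_lintegral _).trans (lintegral_mono fun r => hΨ 0 _ _))
            ((ofReal_integral_le_lintegral _).trans (lintegral_mono fun r => hΨ 1 _ _)))
        refine le_trans ?_ (EReal.coe_ennreal_le_coe_ennreal_iff.2 h1)
        rw [EReal.coe_ennreal_ofReal]
        exact EReal.coe_le_coe_iff.2 (le_max_left _ _)
    _ = ∫⁻ z, ∑ i, Ψ i z ∂(spaceTime T d) := by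
        rw [lintegral_prod]
        exact (Finset.measurable_sum _ fun i _ => hΨm i).aemeasurable
    _ = ∫⁻ z, ⨆ n, ∑ i, ENNReal.ofReal (c i z (V n i z)) ∂(spaceTime T d) := by
        refine lintegral_congr fun z => ?_
        exact ENNReal.finsetSum_iSup_of_monotone fun i n m hnm =>
          ENNReal.ofReal_le_ofReal (hmono i z hnm)
    _ = ⨆ n, ∫⁻ z, ∑ i, ENNReal.ofReal (c i z (V n i z)) ∂(spaceTime T d) := by
        refine lintegral_iSup (fun n => Finset.measurable_sum _ fun i _ => hcm n i) ?_
        intro n m hnm z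
        exact Finset.sum_le_sum fun i _ => ENNReal.ofReal_le_ofReal (hmono i z hnm)
    _ ≤ ENNReal.ofReal L := by
        refine iSup_le fun n => ?_
        have hi := integrable_finsetSum Finset.univ fun i _ =>
          integrable_costAt hM hw hwb hg (hVb n) i
        refine le_trans (le_of_eq ?_) (ENNReal.ofReal_le_ofReal (hL (V n) (hVb n)))
        rw [ofReal_integral_eq_lintegral_ofReal hi (ae_of_all _ fun z =>
          Finset.sum_nonneg fun i _ => hpos n i z)]
        refine lintegral_congr fun z => ?_
        exact (ENNReal.ofReal_sum_of_nonneg fun i _ => hpos n i z).symm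

end SpaceTime

end

end KacRate

/-! ### Representation of paths of bounded rate, and uniform integrability of their derivatives -/

namespace KacRate

noncomputable section

variable {d : ℕ} {M : Data d} {T : ℝ} {H : ℕ → C(Torus d, ℝ)}

/-- A jointly measurable version `w` of a path of densities. -/
structure MeasRep (φ : Icc (0 : ℝ) T → B11 d H) (w : Fin 2 → Icc (0 : ℝ) T × Torus d → ℝ) :
    Prop where
  meas : ∀ i, Measurable (w i)
  bound : ∀ i z, |w i z| ≤ 1
  ae_eq : ∀ i s, (fun r => w i (s, r)) =ᵐ[volume] (φ s).fn i

theorem ae_ae_swap {p : Icc (0 : ℝ) T × Torus d → Prop} (h : ∀ᵐ z ∂(spaceTime T d), p z) :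
    ∀ᵐ r : Torus d, ∀ᵐ s ∂(timeMeasure T), p (s, r) := by
  have h2 : ∀ᵐ z ∂((volume : Measure (Torus d)).prod (timeMeasure T)), p z.swap :=
    (Measure.measurePreserving_swap (μ := volume) (ν := timeMeasure T)).quasiMeasurePreserving.ae h
  exact Measure.ae_ae_of_ae_prod h2

theorem HasTimeDeriv.congr {φ : Icc (0 : ℝ) T → B11 d H} {g k : Fin 2 → Icc (0 : ℝ) T → Torus d → ℝ}
    (h : HasTimeDeriv φ g)
    (hgk : ∀ j, (fun z : Icc (0 : ℝ) T × Torus d => g j z.1 z.2) =ᵐ[spaceTime T d]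
      fun z => k j z.1 z.2) : HasTimeDeriv φ k where
  cont := h.cont
  integrable j := (h.integrable j).congr (hgk j)
  eq_integral j t' t ht := by
    filter_upwards [h.eq_integral j t' t ht, ae_ae_swap (hgk j)] with r h1 h2
    rw [h1]
    exact integral_congr_ae (ae_restrict_of_ae h2)

/-- The domain of integration moves with the point; as an indicator of a measurable set in one more
variable it becomes part of the integrand of a parameter integral. -/
theorem measurable_timeIntegral {g : Icc (0 : ℝ) T × Torus d → ℝ} (hg : Measurable g)
    (a : Icc (0 : ℝ) T) :
    Measurable fun z : Icc (0 : ℝ) T × Torus d => ∫ s in Ioc a z.1, g (s, z.2) ∂(timeMeasure T) := by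
  have hE : MeasurableSet {y : (Icc (0 : ℝ) T × Torus d) × Icc (0 : ℝ) T | y.2 ∈ Ioc a y.1.1} :=
    (measurableSet_lt measurable_const (measurable_subtype_coe.comp measurable_snd)).inter
      (measurableSet_le (measurable_subtype_coe.comp measurable_snd)
        (measurable_subtype_coe.comp (measurable_fst.comp measurable_fst)))
  have hm : Measurable fun y : (Icc (0 : ℝ) T × Torus d) × Icc (0 : ℝ) T => g (y.2, y.1.2) :=
    hg.comp (measurable_snd.prodMk (measurable_snd.comp measurable_fst))
  have := ((hm.indicator hE).stronglyMeasurable.integral_prod_right' (ν := timeMeasure T)).measurable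
  convert this using 2 with z
  rw [← integral_indicator measurableSet_Ioc]
  rfl

theorem trunc_eq_self {K x : ℝ} (h : |x| ≤ K) : trunc K x = x := by
  unfold trunc
  rw [min_eq_right (abs_le.1 h).2, max_eq_right (abs_le.1 h).1]

/-- The function φ(0) + ∫_0^t g is jointly measurable and represents φ(t) for every t. Truncation at
1 makes the bound hold everywhere without changing the classes. -/
theorem HasTimeDeriv.exists_measRep (hT : 0 ≤ T) {φ : Icc (0 : ℝ) T → B11 d H}
    {g : Fin 2 → Icc (0 : ℝ) T × Torus d → ℝ} (hg : ∀ j, Measurable (g j))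
    (h : HasTimeDeriv φ fun j s r => g j (s, r)) : ∃ w, MeasRep φ w := by
  let a : Icc (0 : ℝ) T := ⟨0, le_rfl, hT⟩
  refine ⟨fun i z => trunc 1 ((φ a).fn i z.2 + ∫ s in Ioc a z.1, g i (s, z.2) ∂(timeMeasure T)),
    fun i => ?_, fun i z => abs_trunc_le zero_le_one _, fun i s => ?_⟩
  · exact (continuous_trunc 1).measurable.comp
      ((((φ a).measurable_fn i).comp measurable_snd).add (measurable_timeIntegral (hg i) a))
  · filter_upwards [h.eq_integral i a s s.2.1, (φ s).ae_abs_fn_le_one i] with r h1 h2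
    rw [← h1, add_sub_cancel, trunc_eq_self h2]

theorem erealIntegral_of_nonneg {α : Type*} [MeasurableSpace α] (μ : Measure α) {f : α → EReal}
    (hf : ∀ x, 0 ≤ f x) : erealIntegral μ f = ((∫⁻ x, (f x).toENNReal ∂μ : ENNReal) : EReal) := by
  have : ∀ x, (-f x).toENNReal = 0 := fun x =>
    EReal.toENNReal_of_nonpos (by simpa using EReal.neg_le_neg_iff.2 (hf x))
  unfold erealIntegral
  simp [this]

/-- `g` is a measurable time derivative of `φ`, `w` a measurable version of `φ`, and the
variational formula gives the bound `L` for the rate functional. -/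
structure IsRep (M : Data d) (φ : Icc (0 : ℝ) T → B11 d H)
    (g w : Fin 2 → Icc (0 : ℝ) T × Torus d → ℝ) (L : ℝ) : Prop where
  g_meas : ∀ j, Measurable (g j)
  deriv : HasTimeDeriv φ fun j s r => g j (s, r)
  rep : MeasRep φ w
  bound : ∀ V, BddMeas V → ∫ z, ∑ i, M.costAt w g V i z ∂(spaceTime T d) ≤ L

theorem IsRep.g_integrable {φ : Icc (0 : ℝ) T → B11 d H}
    {g w : Fin 2 → Icc (0 : ℝ) T × Torus d → ℝ} {L : ℝ} (h : IsRep M φ g w L) (j : Fin 2) :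
    Integrable (g j) (spaceTime T d) := h.deriv.integrable j

theorem IsRep.nonneg {φ : Icc (0 : ℝ) T → B11 d H}
    {g w : Fin 2 → Icc (0 : ℝ) T × Torus d → ℝ} {L : ℝ} (h : IsRep M φ g w L) : 0 ≤ L := by
  refine le_of_eq_of_le ?_ (h.bound (fun _ _ => 0) ⟨fun _ => measurable_const, 0, by simp⟩)
  simp [Data.costAt]

theorem I0_nonneg (φ : Cadlag T (B11 d H)) : 0 ≤ M.I0 φ := by
  refine le_iInf₂ fun g _ => ?_
  rw [erealIntegral_of_nonneg _ fun s => Data.Hstar_nonneg _ _]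
  exact EReal.coe_ennreal_nonneg _

/-- The strict inequality provides a derivative whose own integral lies below L. Passing to
measurable versions of it and of φ alters 𝓗* at no more than a null set of times. -/
theorem exists_isRep_of_I0_lt (hM : M.Admissible) (hT : 0 ≤ T) {φ : Cadlag T (B11 d H)} {L : ℝ}
    (h : M.I0 φ < (L : EReal)) : ∃ g w, IsRep M φ g w L := by
  have hL : 0 < L := by exact_mod_cast (I0_nonneg φ).trans_lt h
  unfold Data.I0 at h
  simp only [iInf_lt_iff] at h
  obtain ⟨g, hg, hlt⟩ := h
  let k : Fin 2 → Icc (0 : ℝ) T × Torus d → ℝ := fun j => (hg.integrable j).1.mk _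
  have hgk : ∀ j, (fun z : Icc (0 : ℝ) T × Torus d => g j z.1 z.2) =ᵐ[spaceTime T d] k j :=
    fun j => (hg.integrable j).1.ae_eq_mk
  have hkm : ∀ j, Measurable (k j) := fun j =>
    (hg.integrable j).1.stronglyMeasurable_mk.measurable
  have hk : HasTimeDeriv φ fun j s r => k j (s, r) := hg.congr hgk
  obtain ⟨w, hw⟩ := hk.exists_measRep hT hkm
  refine ⟨k, w, hkm, hk, hw, fun V hV => ?_⟩
  have h1 := ofReal_integral_costAt_le hM hw.meas hw.bound (fun j => hk.integrable j) hV
  rw [erealIntegral_of_nonneg _ fun s => Data.Hstar_nonneg _ _] at hlt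
  have h2 : ∫⁻ s, (M.Hstar (fun i r => w i (s, r)) (fun i r => k i (s, r))).toENNReal
      ∂(timeMeasure T) = ∫⁻ s, (M.Hstar (φ s).fn (fun i => g i s)).toENNReal ∂(timeMeasure T) := by
    refine lintegral_congr_ae ?_
    have : ∀ᵐ s ∂(timeMeasure T), ∀ j, (fun r => g j s r) =ᵐ[volume] fun r => k j (s, r) :=
      ae_all_iff.2 fun j => Measure.ae_ae_of_ae_prod (hgk j)
    filter_upwards [this] with s hs
    rw [Data.Hstar_congr (fun j => hw.ae_eq j s) fun j => (hs j).symm]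
  rw [h2] at h1
  have h3 : ((ENNReal.ofReal (∫ z, ∑ i, M.costAt w k V i z ∂(spaceTime T d)) : ENNReal) : EReal)
      ≤ (L : EReal) := (EReal.coe_ennreal_le_coe_ennreal_iff.2 h1).trans hlt.le
  rw [EReal.coe_ennreal_ofReal] at h3
  exact (le_max_left _ _).trans (EReal.coe_le_coe_iff.1 h3)

theorem IsRep.I0_le (hM : M.Admissible) {φ : Cadlag T (B11 d H)}
    {g w : Fin 2 → Icc (0 : ℝ) T × Torus d → ℝ} {L : ℝ} (h : IsRep M φ g w L) :
    M.I0 φ ≤ (L : EReal) := by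
  refine iInf₂_le_of_le _ h.deriv ?_
  rw [erealIntegral_of_nonneg _ fun s => Data.Hstar_nonneg _ _]
  have h1 := lintegral_Hstar_le hM h.rep.meas h.rep.bound h.g_meas h.g_integrable h.bound
  have h2 : ∀ s, M.Hstar (φ s).fn (fun i r => g i (s, r)) =
      M.Hstar (fun i r => w i (s, r)) (fun i r => g i (s, r)) := fun s =>
    Data.Hstar_congr (fun j => (h.rep.ae_eq j s).symm) fun j => ae_eq_refl _
  simp only [h2]
  refine (EReal.coe_ennreal_le_coe_ennreal_iff.2 h1).trans ?_
  rw [EReal.coe_ennreal_ofReal, max_eq_left h.nonneg]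

/-- Γ is bounded in terms of the size of v alone, whatever g is; the term v g thus grows without
competition. -/
theorem neg_rate_le_cost {p τ u g v C : ℝ} (hp : |p| ≤ 1) (hτ : |τ| ≤ 1) (hu : |u| ≤ 1)
    (hv : |v| ≤ C) : v * g - 2 * Real.cosh (2 * C) ≤ cost p τ u g v := by
  have := (abs_le.1 (abs_rate_le hp hτ hu hv)).2
  unfold cost
  linarith

/-- The superlinear growth of `𝓗*` in the second argument, integrated over a set. -/
theorem IsRep.mul_setIntegral_abs_le (hM : M.Admissible) {φ : Icc (0 : ℝ) T → B11 d H}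
    {g w : Fin 2 → Icc (0 : ℝ) T × Torus d → ℝ} {L : ℝ} (h : IsRep M φ g w L) (i : Fin 2) {c : ℝ}
    (hc : 0 < c) {E : Set (Icc (0 : ℝ) T × Torus d)} (hE : MeasurableSet E) :
    c * ∫ z in E, |g i z| ∂(spaceTime T d) ≤
      L + 2 * Real.cosh (2 * c) * (spaceTime T d).real E := by
  -- With this V the linear term is c |g_i| on E, and the cost vanishes off E and in the other
  -- component, where V = 0.
  let V : Fin 2 → Icc (0 : ℝ) T × Torus d → ℝ := fun j =>
    if j = i then E.indicator fun z => c * sgn (g i z) else fun _ => 0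
  have hV : BddMeas V := by
    refine ⟨fun j => ?_, c, fun j z => ?_⟩
    · by_cases hj : j = i
      · simp only [V, if_pos hj]
        exact ((measurable_sgn.comp (h.g_meas i)).const_mul c).indicator hE
      · simp only [V, if_neg hj]
        exact measurable_const
    · by_cases hj : j = i
      · simp only [V, if_pos hj]
        rw [← Real.norm_eq_abs]
        refine (norm_indicator_le_norm_self _ _).trans ?_
        rw [norm_mul, Real.norm_eq_abs, Real.norm_eq_abs, abs_sgn, abs_of_pos hc, mul_one]
      · simp [V, if_neg hj, hc.le]
  have hi := integrable_finsetSum Finset.univ fun j _ =>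
    integrable_costAt hM h.rep.meas h.rep.bound h.g_integrable hV j
  have hgE : Integrable (fun z => c * |g i z| - 2 * Real.cosh (2 * c)) (spaceTime T d) :=
    ((h.g_integrable i).abs.const_mul c).sub (integrable_const _)
  have h1 : ∫ z in E, (c * |g i z| - 2 * Real.cosh (2 * c)) ∂(spaceTime T d) ≤
      ∫ z, ∑ j, M.costAt w g V j z ∂(spaceTime T d) := by
    rw [← integral_indicator hE]
    refine integral_mono (hgE.indicator hE) hi fun z => ?_
    simp only
    rw [Finset.sum_eq_single i (fun j _ hj => by simp [Data.costAt, V, hj]) (by simp)]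
    by_cases hz : z ∈ E
    · have hv : V i z = c * sgn (g i z) := by simp [V, indicator_of_mem hz]
      rw [indicator_of_mem hz]
      unfold Data.costAt
      rw [hv]
      refine le_trans (le_of_eq ?_) (neg_rate_le_cost (C := c) (hM.abs_p_le i)
        (abs_tanhField_le w i z) (h.rep.bound i z) ?_)
      · rw [mul_assoc, mul_comm (sgn _), mul_sgn]
      · rw [abs_mul, abs_sgn, abs_of_pos hc, mul_one]
    · simp [Data.costAt, V, indicator_of_notMem hz]
  have h2 := h1.trans (h.bound V hV)
  rw [integral_sub ((h.g_integrable i).abs.const_mul c).integrableOn (integrable_const _),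
    integral_const_mul, setIntegral_const, smul_eq_mul] at h2
  linarith

theorem IsRep.exists_integral_abs_le (hM : M.Admissible) (T : ℝ) (H : ℕ → C(Torus d, ℝ)) (L : ℝ) :
    ∃ K, 0 ≤ K ∧ ∀ (φ : Icc (0 : ℝ) T → B11 d H) (g w : Fin 2 → Icc (0 : ℝ) T × Torus d → ℝ),
      IsRep M φ g w L → ∀ i, ∫ z, |g i z| ∂(spaceTime T d) ≤ K := by
  refine ⟨|L| + 2 * Real.cosh (2 * 1) * (spaceTime T d).real univ, ?_, fun φ g w h i => ?_⟩
  · have := Real.cosh_pos (2 * 1)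
    positivity
  · have := h.mul_setIntegral_abs_le hM i one_pos MeasurableSet.univ
    rw [one_mul, setIntegral_univ] at this
    linarith [le_abs_self L]

theorem IsRep.exists_setIntegral_abs_le (hM : M.Admissible) (T : ℝ) (H : ℕ → C(Torus d, ℝ)) (L : ℝ)
    {ε : ℝ} (hε : 0 < ε) :
    ∃ δ, 0 < δ ∧ ∀ (φ : Icc (0 : ℝ) T → B11 d H) (g w : Fin 2 → Icc (0 : ℝ) T × Torus d → ℝ),
      IsRep M φ g w L → ∀ i, ∀ E, MeasurableSet E → (spaceTime T d).real E ≤ δ →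
        ∫ z in E, |g i z| ∂(spaceTime T d) ≤ ε := by
  -- First c is taken large to beat the rate bound L, then δ small to beat cosh(2c).
  set c := 2 * (|L| + 1) / ε with hc
  have hc0 : 0 < c := by positivity
  have hch := Real.cosh_pos (2 * c)
  refine ⟨1 / (2 * Real.cosh (2 * c)), by positivity, fun φ g w h i E hE hEδ => ?_⟩
  have h1 := h.mul_setIntegral_abs_le hM i hc0 hE
  have h2 : 2 * Real.cosh (2 * c) * (spaceTime T d).real E ≤ 1 := by
    rw [le_div_iff₀ (by positivity)] at hEδ
    linarith
  have h3 : c * ∫ z in E, |g i z| ∂(spaceTime T d) ≤ c * ε := by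
    have : c * ε = 2 * (|L| + 1) := by rw [hc]; field_simp
    rw [this]
    linarith [le_abs_self L, abs_nonneg L]
  exact le_of_mul_le_mul_left h3 hc0

/-- The truncation error lives on {|g| ≥ l}, whose measure is at most K/l ≤ δ by Markov's
inequality. This is the hypothesis of the Dunford-Pettis argument, uniform over all paths of rate at
most L. -/
theorem IsRep.exists_trunc_le (hM : M.Admissible) (T : ℝ) (H : ℕ → C(Torus d, ℝ)) (L : ℝ)
    {ε : ℝ} (hε : 0 < ε) :
    ∃ k : ℕ, ∀ l ≥ k, ∀ (φ : Icc (0 : ℝ) T → B11 d H)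
      (g w : Fin 2 → Icc (0 : ℝ) T × Torus d → ℝ), IsRep M φ g w L →
        ∀ i, ∫ z, |g i z - trunc l (g i z)| ∂(spaceTime T d) ≤ ε := by
  obtain ⟨K, hK0, hK⟩ := IsRep.exists_integral_abs_le hM T H L
  obtain ⟨δ, hδ, hE⟩ := IsRep.exists_setIntegral_abs_le hM T H L hε
  obtain ⟨k, hk⟩ := exists_nat_gt (K / δ)
  refine ⟨k, fun l hl φ g w h i => ?_⟩
  have hkl : (k : ℝ) ≤ l := by exact_mod_cast hl
  have hl0 : (0 : ℝ) < l := (div_nonneg hK0 hδ.le).trans_lt (hk.trans_le hkl)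
  let E : Set (Icc (0 : ℝ) T × Torus d) := {z | (l : ℝ) ≤ |g i z|}
  have hEm : MeasurableSet E := measurableSet_le measurable_const (h.g_meas i).abs
  have h1 : (l : ℝ) * (spaceTime T d).real E ≤ ∫ z, |g i z| ∂(spaceTime T d) :=
    mul_meas_ge_le_integral_of_nonneg (ae_of_all _ fun z => abs_nonneg _)
      (h.g_integrable i).abs l
  have h2 : (spaceTime T d).real E ≤ δ := by
    have h3 : (l : ℝ) * (spaceTime T d).real E ≤ l * δ := by
      refine (h1.trans (hK φ g w h i)).trans ?_
      have := (div_lt_iff₀ hδ).1 (hk.trans_le hkl)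
      exact this.le
    exact le_of_mul_le_mul_left h3 hl0
  refine le_trans ?_ (hE φ g w h i E hEm h2)
  rw [← integral_indicator hEm]
  have hti : Integrable (fun z => trunc l (g i z)) (spaceTime T d) :=
    Integrable.of_bound ((continuous_trunc l).measurable.comp (h.g_meas i)).aestronglyMeasurable l
      (ae_of_all _ fun x => abs_trunc_le hl0.le _)
  exact integral_mono ((h.g_integrable i).sub hti).abs ((h.g_integrable i).abs.indicator hEm)
    fun z => abs_sub_trunc_le hl0.le _

end

end KacRate

/-! ### Limits of the rates, and equicontinuity -/

namespace KacRate

noncomputable section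

theorem exists_weak_subseq_pair {Ω : Type*} [MeasurableSpace Ω]
    [MeasurableSpace.CountablyGenerated Ω] (μ : Measure Ω) [IsFiniteMeasure μ]
    (f : ℕ → Fin 2 → Ω → ℝ) (hf : ∀ n i, Integrable (f n i) μ)
    (hui : ∀ ε > 0, ∃ k : ℕ, ∀ l ≥ k, ∀ n i, ∫ x, |f n i x - trunc l (f n i x)| ∂μ ≤ ε) :
    ∃ ψ : ℕ → ℕ, StrictMono ψ ∧ ∃ g : Fin 2 → Ω → ℝ, (∀ i, Measurable (g i)) ∧
      (∀ i, Integrable (g i) μ) ∧ ∀ i, ∀ h : Ω → ℝ, Measurable h → (∃ C, ∀ x, ‖h x‖ ≤ C) →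
      Tendsto (fun n => ∫ x, f (ψ n) i x * h x ∂μ) atTop (𝓝 (∫ x, g i x * h x ∂μ)) := by
  obtain ⟨ψ₀, hψ₀, g₀, hgm₀, hgi₀, hl₀⟩ := exists_weak_subseq_of_unifIntegrable μ
    (fun n => f n 0) (fun n => hf n 0) fun ε hε => by
      obtain ⟨k, hk⟩ := hui ε hε
      exact ⟨k, fun l hl n => hk l hl n 0⟩
  obtain ⟨ψ₁, hψ₁, g₁, hgm₁, hgi₁, hl₁⟩ := exists_weak_subseq_of_unifIntegrable μ
    (fun n => f (ψ₀ n) 1) (fun n => hf _ 1) fun ε hε => by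
      obtain ⟨k, hk⟩ := hui ε hε
      exact ⟨k, fun l hl n => hk l hl _ 1⟩
  refine ⟨ψ₀ ∘ ψ₁, hψ₀.comp hψ₁, ![g₀, g₁], ?_, ?_, ?_⟩
  · exact Fin.forall_fin_two.2 ⟨hgm₀, hgm₁⟩
  · exact Fin.forall_fin_two.2 ⟨hgi₀, hgi₁⟩
  · refine Fin.forall_fin_two.2 ⟨fun h hh hb => ?_, fun h hh hb => hl₁ h hh hb⟩
    exact (hl₀ h hh hb).comp hψ₁.tendsto_atTop

/-- Passage to the limit in the rates: strong convergence of `τ`, weak convergence of `w`. -/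
theorem tendsto_integral_rate {Ω : Type*} [MeasurableSpace Ω] {μ : Measure Ω} [IsFiniteMeasure μ]
    {p : ℝ} (hp : |p| ≤ 1) {τ u : ℕ → Ω → ℝ} {τ' u' v : Ω → ℝ}
    (hτm : ∀ n, Measurable (τ n)) (hτ : ∀ n x, |τ n x| ≤ 1) (hτm' : Measurable τ')
    (hτ' : ∀ x, |τ' x| ≤ 1) (hum : ∀ n, Measurable (u n)) (hu : ∀ n x, |u n x| ≤ 1)
    (hum' : Measurable u') (hu' : ∀ x, |u' x| ≤ 1) (hvm : Measurable v) {C : ℝ}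
    (hv : ∀ x, |v x| ≤ C)
    (hlim : ∀ x, Tendsto (fun n => τ n x) atTop (𝓝 (τ' x)))
    (hweak : ∀ h : Ω → ℝ, Measurable h → (∃ C, ∀ x, ‖h x‖ ≤ C) →
      Tendsto (fun n => ∫ x, u n x * h x ∂μ) atTop (𝓝 (∫ x, u' x * h x ∂μ))) :
    Tendsto (fun n => ∫ x, ((p - u n x * τ n x) * (Real.cosh (2 * v x) - 1) +
      (p * τ n x - u n x) * Real.sinh (2 * v x)) ∂μ) atTop
      (𝓝 (∫ x, ((p - u' x * τ' x) * (Real.cosh (2 * v x) - 1) +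
      (p * τ' x - u' x) * Real.sinh (2 * v x)) ∂μ)) := by
  set K := Real.cosh (2 * C) with hK
  have hv2 : ∀ x, |2 * v x| ≤ 2 * C := fun x => by rw [abs_mul, abs_two]; linarith [hv x]
  have hsh : ∀ x, |Real.sinh (2 * v x)| ≤ K := fun x => abs_sinh_le (hv2 x)
  have hch : ∀ x, |Real.cosh (2 * v x) - 1| ≤ K := fun x => abs_cosh_sub_one_le (hv2 x)
  have hshm : Measurable fun x => Real.sinh (2 * v x) :=
    Real.continuous_sinh.measurable.comp (hvm.const_mul 2)
  have hchm : Measurable fun x => Real.cosh (2 * v x) - 1 :=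
    (Real.continuous_cosh.measurable.comp (hvm.const_mul 2)).sub_const 1
  have hK0 : 0 < K := Real.cosh_pos _
  -- The rate is split as S - u h with h fixed. In S the densities u n occur only next to τ n - τ',
  -- so S converges pointwise boundedly, while ∫ u n h converges by weak convergence.
  let h : Ω → ℝ := fun x => τ' x * (Real.cosh (2 * v x) - 1) + Real.sinh (2 * v x)
  have hhm : Measurable h := (hτm'.mul hchm).add hshm
  have hhb : ∀ x, ‖h x‖ ≤ 2 * K := fun x => by
    refine (abs_add_le _ _).trans ?_
    rw [abs_mul]
    have := mul_le_mul (hτ' x) (hch x) (abs_nonneg _) zero_le_one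
    linarith [hsh x]
  let S : (Ω → ℝ) → (Ω → ℝ) → Ω → ℝ := fun t y x => p * (Real.cosh (2 * v x) - 1) +
    p * t x * Real.sinh (2 * v x) - y x * ((t x - τ' x) * (Real.cosh (2 * v x) - 1))
  have hSm : ∀ t y : Ω → ℝ, Measurable t → Measurable y → Measurable (S t y) := fun t y ht hy =>
    ((hchm.const_mul p).add ((ht.const_mul p).mul hshm)).sub (hy.mul ((ht.sub hτm').mul hchm))
  have hSb : ∀ t y : Ω → ℝ, (∀ x, |t x| ≤ 1) → (∀ x, |y x| ≤ 1) → ∀ x, ‖S t y x‖ ≤ 4 * K := by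
    intro t y ht hy x
    have a1 : |p * (Real.cosh (2 * v x) - 1)| ≤ 1 * K := by
      rw [abs_mul]; exact mul_le_mul hp (hch x) (abs_nonneg _) zero_le_one
    have a2 : |p * t x * Real.sinh (2 * v x)| ≤ 1 * 1 * K := by
      rw [abs_mul, abs_mul]
      exact mul_le_mul (mul_le_mul hp (ht x) (abs_nonneg _) zero_le_one) (hsh x) (abs_nonneg _)
        (by norm_num)
    have a3 : |y x * ((t x - τ' x) * (Real.cosh (2 * v x) - 1))| ≤ 1 * (2 * K) := by
      rw [abs_mul, abs_mul]
      refine mul_le_mul (hy x) (mul_le_mul ?_ (hch x) (abs_nonneg _) zero_le_two) (by positivity)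
        zero_le_one
      exact (abs_sub _ _).trans (by linarith [ht x, hτ' x])
    refine (abs_sub _ _).trans ?_
    have := abs_add_le (p * (Real.cosh (2 * v x) - 1)) (p * t x * Real.sinh (2 * v x))
    linarith
  have hSi : ∀ t y : Ω → ℝ, Measurable t → Measurable y → (∀ x, |t x| ≤ 1) → (∀ x, |y x| ≤ 1) →
      Integrable (S t y) μ := fun t y ht hy ht1 hy1 =>
    Integrable.of_bound (hSm t y ht hy).aestronglyMeasurable _ (ae_of_all _ (hSb t y ht1 hy1))
  have huh : ∀ y : Ω → ℝ, Measurable y → (∀ x, |y x| ≤ 1) → Integrable (fun x => y x * h x) μ :=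
    fun y hy hy1 => (Integrable.of_bound hy.aestronglyMeasurable 1 (ae_of_all _ hy1)).mul_bdd
      (c := 2 * K) hhm.aestronglyMeasurable (ae_of_all _ hhb)
  have hsplit : ∀ t y : Ω → ℝ, Measurable t → Measurable y → (∀ x, |t x| ≤ 1) → (∀ x, |y x| ≤ 1) →
      ∫ x, ((p - y x * t x) * (Real.cosh (2 * v x) - 1) +
        (p * t x - y x) * Real.sinh (2 * v x)) ∂μ = (∫ x, S t y x ∂μ) - ∫ x, y x * h x ∂μ := by
    intro t y ht hy ht1 hy1
    rw [← integral_sub (hSi t y ht hy ht1 hy1) (huh y hy hy1)]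
    congr 1 with x
    simp only [S, h]
    ring
  simp only [hsplit _ _ hτm' hum' hτ' hu', fun n => hsplit _ _ (hτm n) (hum n) (hτ n) (hu n)]
  refine Tendsto.sub ?_ (hweak h hhm ⟨_, hhb⟩)
  refine tendsto_integral_of_dominated_convergence (fun _ => 4 * K)
    (fun n => (hSm _ _ (hτm n) (hum n)).aestronglyMeasurable) (integrable_const _)
    (fun n => ae_of_all _ (hSb _ _ (hτ n) (hu n))) (ae_of_all _ fun x => ?_)
  have h1 : Tendsto (fun n => u n x * ((τ n x - τ' x) * (Real.cosh (2 * v x) - 1))) atTop (𝓝 0) := by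
    have h2 : Tendsto (fun n => (τ n x - τ' x) * (Real.cosh (2 * v x) - 1)) atTop (𝓝 0) := by
      simpa using ((hlim x).sub_const (τ' x)).mul_const (Real.cosh (2 * v x) - 1)
    refine squeeze_zero_norm (a := fun n => |(τ n x - τ' x) * (Real.cosh (2 * v x) - 1)|)
      (fun n => ?_) (by simpa using h2.abs)
    rw [norm_mul]
    exact mul_le_of_le_one_left (abs_nonneg _) (hu n x)
  have h3 := ((((hlim x).const_mul p).mul_const (Real.sinh (2 * v x))).const_add
    (p * (Real.cosh (2 * v x) - 1))).sub h1
  refine h3.congr_dist ?_ |>.trans_eq ?_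
  · simp [S]
  · simp [S]

variable {d : ℕ} {M : Data d} {T : ℝ} {H : ℕ → C(Torus d, ℝ)}

/-- Time integration followed by integration against a test function. -/
theorem integral_timeIntegral_mul {G : Icc (0 : ℝ) T × Torus d → ℝ} (hG : Integrable G (spaceTime T d))
    {h : Torus d → ℝ} (hh : Measurable h) (hb : ∃ C, ∀ r, ‖h r‖ ≤ C) (a t : Icc (0 : ℝ) T) :
    ∫ r, (∫ s in Ioc a t, G (s, r) ∂(timeMeasure T)) * h r =
      ∫ z, G z * (Ioc a t ×ˢ univ).indicator (fun z => h z.2) z ∂(spaceTime T d) := by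
  obtain ⟨C, hC⟩ := hb
  have hE : MeasurableSet (Ioc a t ×ˢ (univ : Set (Torus d))) := measurableSet_Ioc.prod .univ
  have hi : Integrable (fun z => G z * (Ioc a t ×ˢ univ).indicator (fun z => h z.2) z)
      (spaceTime T d) :=
    hG.mul_bdd (c := C) ((hh.comp measurable_snd).indicator hE).aestronglyMeasurable
      (ae_of_all _ fun z => (norm_indicator_le_norm_self _ _).trans (hC _))
  rw [integral_prod_symm _ hi]
  congr 1 with r
  rw [← integral_indicator measurableSet_Ioc, ← integral_mul_const]
  congr 1 with s
  by_cases hs : s ∈ Ioc a t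
  · simp [indicator_of_mem, hs]
  · simp [indicator_of_notMem, hs]

theorem integrable_timeIntegral {G : Icc (0 : ℝ) T × Torus d → ℝ} (hG : Integrable G (spaceTime T d))
    (a t : Icc (0 : ℝ) T) :
    Integrable fun r => ∫ s in Ioc a t, G (s, r) ∂(timeMeasure T) := by
  have hE : MeasurableSet (Ioc a t ×ˢ (univ : Set (Torus d))) := measurableSet_Ioc.prod .univ
  refine (hG.indicator hE).integral_prod_right.congr (ae_of_all _ fun r => ?_)
  simp only
  rw [← integral_indicator measurableSet_Ioc]
  congr 1 with s
  by_cases hs : s ∈ Ioc a t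
  · simp [indicator_of_mem, hs]
  · simp [indicator_of_notMem, hs]

/-- Fubini's theorem reduces the L¹ modulus of continuity of the path to the mass of |g| on a thin
time slab, which uniform integrability controls. -/
theorem HasTimeDeriv.integral_abs_sub_le {φ : Icc (0 : ℝ) T → B11 d H}
    {g : Fin 2 → Icc (0 : ℝ) T × Torus d → ℝ} (h : HasTimeDeriv φ fun j s r => g j (s, r))
    (i : Fin 2) {a t : Icc (0 : ℝ) T} (hat : a ≤ t) :
    ∫ r, |(φ t).fn i r - (φ a).fn i r| ≤
      ∫ z in Ioc a t ×ˢ univ, |g i z| ∂(spaceTime T d) := by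
  have hE : MeasurableSet (Ioc a t ×ˢ (univ : Set (Torus d))) := measurableSet_Ioc.prod .univ
  have hi : Integrable (g i) (spaceTime T d) := h.integrable i
  have e := integral_timeIntegral_mul hi.abs (h := fun _ => 1) measurable_const ⟨1, by simp⟩ a t
  have e2 : ∫ z in Ioc a t ×ˢ univ, |g i z| ∂(spaceTime T d) =
      ∫ r, (∫ s in Ioc a t, |g i (s, r)| ∂(timeMeasure T)) := by
    rw [← integral_indicator hE]
    simp only [mul_one] at e
    rw [e]
    congr 1 with z
    by_cases hz : z ∈ Ioc a t ×ˢ (univ : Set (Torus d))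
    · rw [indicator_of_mem hz, indicator_of_mem hz, mul_one]
    · rw [indicator_of_notMem hz, indicator_of_notMem hz, mul_zero]
  rw [e2]
  refine integral_mono_ae (((φ t).integrable_fn i).sub ((φ a).integrable_fn i)).abs
    (integrable_timeIntegral hi.abs a t) ?_
  filter_upwards [h.eq_integral i a t hat] with r hr
  rw [hr]
  exact abs_integral_le_integral_abs

theorem spaceTime_real_Ioc_le (a t : Icc (0 : ℝ) T) :
    (spaceTime T d).real (Ioc a t ×ˢ univ) ≤
      dist a t * (volume : Measure (Torus d)).real univ := by
  rw [measureReal_prod_prod]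
  refine mul_le_mul_of_nonneg_right ?_ measureReal_nonneg
  have h1 : timeMeasure T (Ioc a t) ≤ ENNReal.ofReal (dist a t) := by
    rw [(MeasurableEmbedding.subtype_coe measurableSet_Icc).comap_apply]
    have : Subtype.val '' Ioc a t ⊆ Ioc (a : ℝ) t := by
      rintro _ ⟨s, hs, rfl⟩
      exact ⟨hs.1, hs.2⟩
    refine (measure_mono this).trans ?_
    rw [Real.volume_Ioc, Subtype.dist_eq, dist_comm, Real.dist_eq]
    exact ENNReal.ofReal_le_ofReal (le_abs_self _)
  exact ENNReal.toReal_le_of_le_ofReal dist_nonneg h1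

/-- Paths of bounded rate are equicontinuous. -/
theorem IsRep.equicontinuous (hM : M.Admissible) (hH : ∀ k, ‖H k‖ ≤ 1) {ι : Type*}
    {φ : ι → Icc (0 : ℝ) T → B11 d H} {g w : ι → Fin 2 → Icc (0 : ℝ) T × Torus d → ℝ} {L : ℝ}
    (h : ∀ n, IsRep M (φ n) (g n) (w n) L) : Equicontinuous φ := by
  have key : ∀ ε > 0, ∃ δ > 0, ∀ n, ∀ a t : Icc (0 : ℝ) T, a ≤ t → dist a t < δ →
      edist (φ n t) (φ n a) < ε := by
    intro ε hε
    -- The factor 4 is two components times the total weight 2 in ρ; ε = ∞ is possible and is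
    -- treated apart.
    obtain ⟨η, hη, hηε⟩ : ∃ η : ℝ, 0 < η ∧ 4 * ENNReal.ofReal η < ε := by
      by_cases hε' : ε = ⊤
      · exact ⟨1, one_pos, by rw [hε']; exact ENNReal.mul_lt_top (by norm_num) ENNReal.ofReal_lt_top⟩
      · have hpos : 0 < ε.toReal := ENNReal.toReal_pos hε.ne' hε'
        refine ⟨ε.toReal / 8, by positivity, ?_⟩
        rw [show (4 : ENNReal) = ENNReal.ofReal 4 by norm_num, ← ENNReal.ofReal_mul (by norm_num),
          ENNReal.ofReal_lt_iff_lt_toReal (by positivity) hε']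
        linarith
    obtain ⟨δ, hδ, hE⟩ := IsRep.exists_setIntegral_abs_le hM T H L hη
    set m := (volume : Measure (Torus d)).real univ with hm
    have hm0 : 0 ≤ m := measureReal_nonneg
    refine ⟨δ / (m + 1), by positivity, fun n a t hat hd => ?_⟩
    have hE' : (spaceTime T d).real (Ioc a t ×ˢ univ) ≤ δ := by
      refine (spaceTime_real_Ioc_le a t).trans ?_
      have := (lt_div_iff₀ (by positivity)).1 hd
      nlinarith [dist_nonneg (x := a) (y := t)]
    refine (B11.edist_le hH _ _).trans_lt (lt_of_le_of_lt ?_ hηε)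
    have h1 : ∀ i, 2 * ENNReal.ofReal (∫ r, |(φ n t).fn i r - (φ n a).fn i r|) ≤
        2 * ENNReal.ofReal η := fun i => by
      gcongr
      exact ((h n).deriv.integral_abs_sub_le i hat).trans
        (hE _ _ _ (h n) i _ (measurableSet_Ioc.prod .univ) hE')
    rw [Fin.sum_univ_two]
    refine (add_le_add (h1 0) (h1 1)).trans (le_of_eq ?_)
    ring
  intro t U hU
  obtain ⟨ε, hε, hεU⟩ := mem_uniformity_edist.1 hU
  obtain ⟨δ, hδ, hd⟩ := key ε hε
  filter_upwards [Metric.ball_mem_nhds t hδ] with s hs n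
  rw [Metric.mem_ball] at hs
  refine hεU ?_
  rcases le_total s t with hst | hst
  · exact hd n s t hst hs
  · rw [edist_comm]
    exact hd n t s hst (by rwa [dist_comm])

end

end KacRate

/-! ### Limits of paths of bounded rate -/

namespace KacRate

noncomputable section

variable {d : ℕ} {M : Data d} {T : ℝ} {H : ℕ → C(Torus d, ℝ)}

theorem IsRep.mono {φ : Icc (0 : ℝ) T → B11 d H} {g w : Fin 2 → Icc (0 : ℝ) T × Torus d → ℝ}
    {L L' : ℝ} (h : IsRep M φ g w L) (hL : L ≤ L') : IsRep M φ g w L' :=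
  ⟨h.g_meas, h.deriv, h.rep, fun V hV => (h.bound V hV).trans hL⟩

theorem integrable_mul_of_bdd {Ω : Type*} [MeasurableSpace Ω] {μ : Measure Ω} [IsFiniteMeasure μ]
    {u h : Ω → ℝ} (hu : Integrable u μ) (hh : Measurable h) (hb : ∃ C, ∀ x, ‖h x‖ ≤ C) :
    Integrable (fun x => u x * h x) μ := by
  obtain ⟨C, hC⟩ := hb
  exact hu.mul_bdd (c := C) hh.aestronglyMeasurable (ae_of_all _ hC)

/-- Weak convergence at each time implies weak convergence in space-time. -/
theorem tendsto_spaceTime_of_forall_time {u : ℕ → Icc (0 : ℝ) T × Torus d → ℝ}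
    {u' : Icc (0 : ℝ) T × Torus d → ℝ} (hum : ∀ n, Measurable (u n)) (hu : ∀ n x, |u n x| ≤ 1)
    (hum' : Measurable u') (hu' : ∀ x, |u' x| ≤ 1)
    (hw : ∀ s, ∀ h : Torus d → ℝ, Measurable h → (∃ C, ∀ x, ‖h x‖ ≤ C) →
      Tendsto (fun n => ∫ r, u n (s, r) * h r) atTop (𝓝 (∫ r, u' (s, r) * h r)))
    {h : Icc (0 : ℝ) T × Torus d → ℝ} (hh : Measurable h) (hb : ∃ C, ∀ x, ‖h x‖ ≤ C) :
    Tendsto (fun n => ∫ z, u n z * h z ∂(spaceTime T d)) atTop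
      (𝓝 (∫ z, u' z * h z ∂(spaceTime T d))) := by
  have hi : ∀ y : Icc (0 : ℝ) T × Torus d → ℝ, Measurable y → (∀ x, |y x| ≤ 1) →
      Integrable (fun z => y z * h z) (spaceTime T d) := fun y hy hy1 =>
    integrable_mul_of_bdd (Integrable.of_bound hy.aestronglyMeasurable 1 (ae_of_all _ hy1)) hh hb
  rw [integral_prod _ (hi u' hum' hu')]
  simp only [fun n => integral_prod _ (hi (u n) (hum n) (hu n))]
  obtain ⟨C, hC⟩ := hb
  refine tendsto_integral_of_dominated_convergence
    (fun _ => C * (volume : Measure (Torus d)).real univ)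
    (fun n => (hi (u n) (hum n) (hu n)).integral_prod_left.1) (integrable_const _)
    (fun n => ae_of_all _ fun s => ?_) (ae_of_all _ fun s =>
      hw s _ (hh.comp measurable_prodMk_left) ⟨C, fun r => hC _⟩)
  refine norm_integral_le_of_norm_le_const (ae_of_all _ fun r => ?_)
  rw [norm_mul]
  calc ‖u n (s, r)‖ * ‖h (s, r)‖ ≤ 1 * C :=
        mul_le_mul (hu n _) (hC _) (norm_nonneg _) zero_le_one
    _ = C := one_mul C

/-- For fixed r the function J(r - ·) is a bounded test function. Convolution thus upgrades weak
convergence of the densities to pointwise convergence of the field, the only nonlinear quantity in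
the density. -/
theorem tendsto_tanhField (hM : M.Admissible) {u : ℕ → Fin 2 → Icc (0 : ℝ) T × Torus d → ℝ}
    {u' : Fin 2 → Icc (0 : ℝ) T × Torus d → ℝ} (hum : ∀ n j, Measurable (u n j))
    (hu : ∀ n j x, |u n j x| ≤ 1) (hum' : ∀ j, Measurable (u' j)) (hu' : ∀ j x, |u' j x| ≤ 1)
    (hw : ∀ j s, ∀ h : Torus d → ℝ, Measurable h → (∃ C, ∀ x, ‖h x‖ ≤ C) →
      Tendsto (fun n => ∫ r, u n j (s, r) * h r) atTop (𝓝 (∫ r, u' j (s, r) * h r)))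
    (i : Fin 2) (z : Icc (0 : ℝ) T × Torus d) :
    Tendsto (fun n => M.tanhField (u n) i z) atTop (𝓝 (M.tanhField u' i z)) := by
  obtain ⟨C, -, hC⟩ := hM.exists_J_bound
  have hJ : Measurable fun r' => M.J (z.2 - r') :=
    (hM.continuous_J.comp (continuous_const.sub continuous_id)).measurable
  have hJb : ∃ C, ∀ r', ‖M.J (z.2 - r')‖ ≤ C := ⟨C, fun r' => hC _⟩
  refine (continuous_tanh.tendsto _).comp (Tendsto.add_const _ ?_)
  have e : ∀ y : Fin 2 → Icc (0 : ℝ) T × Torus d → ℝ, (∀ j, Measurable (y j)) →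
      (∀ j x, |y j x| ≤ 1) → ∫ r', M.J (z.2 - r') * ∑ j, y j (z.1, r') =
        ∑ j, ∫ r', y j (z.1, r') * M.J (z.2 - r') := by
    intro y hy hy1
    rw [← integral_finsetSum]
    · congr 1 with r'
      rw [Finset.mul_sum]
      exact Finset.sum_congr rfl fun j _ => mul_comm _ _
    · intro j _
      exact integrable_mul_of_bdd (Integrable.of_bound
        ((hy j).comp measurable_prodMk_left).aestronglyMeasurable 1
        (ae_of_all _ fun r => hy1 j _)) hJ hJb
  simp only [e u' hum' hu', fun n => e (u n) (hum n) (hu n)]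
  exact tendsto_finsetSum _ fun j _ => hw j z.1 _ hJ hJb

/-- Separates the part linear in g, which passes to weak limits, from the rates, which need
`tendsto_integral_rate`. -/
theorem integral_sum_costAt (hM : M.Admissible) {w g V : Fin 2 → Icc (0 : ℝ) T × Torus d → ℝ}
    (hw : ∀ j, Measurable (w j)) (hwb : ∀ j z, |w j z| ≤ 1)
    (hg : ∀ j, Integrable (g j) (spaceTime T d)) (hV : BddMeas V) :
    ∫ z, ∑ i, M.costAt w g V i z ∂(spaceTime T d) =
      ∑ i, ((∫ z, g i z * V i z ∂(spaceTime T d)) - 1 / 2 * ∫ z,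
        ((M.p i - w i z * M.tanhField w i z) * (Real.cosh (2 * V i z) - 1) +
          (M.p i * M.tanhField w i z - w i z) * Real.sinh (2 * V i z)) ∂(spaceTime T d)) := by
  rw [integral_finsetSum _ fun i _ => integrable_costAt hM hw hwb hg hV i]
  obtain ⟨hVm, C, hC⟩ := hV
  refine Finset.sum_congr rfl fun i _ => ?_
  rw [← integral_const_mul, ← integral_sub
    (integrable_mul_of_bdd (hg i) (hVm i) ⟨C, fun z => hC i z⟩)
    ((integrable_rate (hM.abs_p_le i) (measurable_tanhField hM hw i).aestronglyMeasurable
      (ae_of_all _ fun z => abs_tanhField_le w i z) (hw i).aestronglyMeasurable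
      (ae_of_all _ fun z => hwb i z) (hVm i).aestronglyMeasurable
      (ae_of_all _ fun z => hC i z)).const_mul _)]
  congr 1 with z
  unfold Data.costAt cost
  ring

/-- Weak testing of a path in terms of its derivative. -/
theorem HasTimeDeriv.integral_mul_eq {φ : Icc (0 : ℝ) T → B11 d H}
    {g : Fin 2 → Icc (0 : ℝ) T × Torus d → ℝ} (hd : HasTimeDeriv φ fun j s r => g j (s, r))
    {h : Torus d → ℝ} (hh : Measurable h) (hb : ∃ C, ∀ r, ‖h r‖ ≤ C) (i : Fin 2)
    {a t : Icc (0 : ℝ) T} (hat : a ≤ t) :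
    ∫ r, (φ t).fn i r * h r = (∫ r, (φ a).fn i r * h r) +
      ∫ z, g i z * (Ioc a t ×ˢ univ).indicator (fun z => h z.2) z ∂(spaceTime T d) := by
  have hgi : Integrable (g i) (spaceTime T d) := hd.integrable i
  rw [← integral_timeIntegral_mul hgi hh hb, ← integral_add
    (integrable_mul_of_bdd ((φ a).integrable_fn i) hh hb)
    (integrable_mul_of_bdd (integrable_timeIntegral hgi a t) hh hb)]
  refine integral_congr_ae ?_
  filter_upwards [hd.eq_integral i a t hat] with r hr
  simp only [← hr]
  ring

/-- Sequences of paths of bounded rate have uniformly convergent subsequences, and the rate is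
lower semicontinuous along them. -/
theorem IsRep.exists_limit (hM : M.Admissible) (hT : 0 ≤ T) (hH : ∀ k, ‖H k‖ ≤ 1)
    {φ : ℕ → Icc (0 : ℝ) T → B11 d H} {g w : ℕ → Fin 2 → Icc (0 : ℝ) T × Torus d → ℝ}
    {L : ℕ → ℝ} {L₀ L' : ℝ} (hL₀ : ∀ n, L n ≤ L₀) (hL : Tendsto L atTop (𝓝 L'))
    (h : ∀ n, IsRep M (φ n) (g n) (w n) (L n)) :
    ∃ ψ : ℕ → ℕ, StrictMono ψ ∧ ∃ φ' : Icc (0 : ℝ) T → B11 d H, ∃ g' w',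
      IsRep M φ' g' w' L' ∧ TendstoUniformly (fun n => φ (ψ n)) φ' atTop := by
  let a : Icc (0 : ℝ) T := ⟨0, le_rfl, hT⟩
  have ha : ∀ t : Icc (0 : ℝ) T, a ≤ t := fun t => t.2.1
  have h₀ : ∀ n, IsRep M (φ n) (g n) (w n) L₀ := fun n => (h n).mono (hL₀ n)
  obtain ⟨ψ₁, hψ₁, G, hGm, hGi, hG⟩ := exists_weak_subseq_pair (spaceTime T d) g
    (fun n i => (h n).g_integrable i) fun ε hε => by
      obtain ⟨k, hk⟩ := IsRep.exists_trunc_le hM T H L₀ hε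
      exact ⟨k, fun l hl n i => hk l hl _ _ _ (h₀ n) i⟩
  -- The initial values are bounded by 1, so truncation at any level l ≥ 1 leaves them unchanged.
  obtain ⟨ψ₂, hψ₂, u, hum, hui, hu⟩ := exists_weak_subseq_pair (volume : Measure (Torus d))
    (fun n i => (φ (ψ₁ n) a).fn i) (fun n i => (φ (ψ₁ n) a).integrable_fn i) fun ε hε => by
      refine ⟨1, fun l hl n i => le_of_eq_of_le (integral_eq_zero_of_ae ?_) hε.le⟩
      filter_upwards [(φ (ψ₁ n) a).ae_abs_fn_le_one i] with r hr
      rw [trunc_eq_self (hr.trans (by exact_mod_cast hl))]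
      simp
  let ψ := ψ₁ ∘ ψ₂
  have hG' : ∀ i, ∀ h : Icc (0 : ℝ) T × Torus d → ℝ, Measurable h → (∃ C, ∀ x, ‖h x‖ ≤ C) →
      Tendsto (fun n => ∫ x, g (ψ n) i x * h x ∂(spaceTime T d)) atTop
        (𝓝 (∫ x, G i x * h x ∂(spaceTime T d))) := fun i h hh hb =>
    (hG i h hh hb).comp hψ₂.tendsto_atTop
  -- The candidate limit: the weak limit of the initial values plus the time integral of the weak
  -- limit of the derivatives. Testing at a fixed time t involves g against a bounded function on
  -- [0,t] × Λ, so convergence holds at every t.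
  let W : Fin 2 → Icc (0 : ℝ) T × Torus d → ℝ := fun i z =>
    u i z.2 + ∫ s in Ioc a z.1, G i (s, z.2) ∂(timeMeasure T)
  have hWm : ∀ i, Measurable (W i) := fun i =>
    ((hum i).comp measurable_snd).add (measurable_timeIntegral (hGm i) a)
  have hWi : ∀ i t, Integrable fun r => W i (t, r) := fun i t =>
    (hui i).add (integrable_timeIntegral (hGi i) a t)
  have hWlim : ∀ i t, ∀ f : Torus d → ℝ, Measurable f → (∃ C, ∀ r, ‖f r‖ ≤ C) →
      Tendsto (fun n => ∫ r, (φ (ψ n) t).fn i r * f r) atTop (𝓝 (∫ r, W i (t, r) * f r)) := by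
    intro i t f hf hb
    have e : ∫ r, W i (t, r) * f r = (∫ r, u i r * f r) +
        ∫ z, G i z * (Ioc a t ×ˢ univ).indicator (fun z => f z.2) z ∂(spaceTime T d) := by
      rw [← integral_timeIntegral_mul (hGi i) hf hb, ← integral_add
        (integrable_mul_of_bdd (hui i) hf hb)
        (integrable_mul_of_bdd (integrable_timeIntegral (hGi i) a t) hf hb)]
      congr 1 with r
      exact add_mul _ _ _
    rw [e]
    simp only [fun n => (h (ψ n)).deriv.integral_mul_eq hf hb i (ha t)]
    refine (hu i f hf hb).add (hG' i _ ?_ ?_)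
    · exact (hf.comp measurable_snd).indicator (measurableSet_Ioc.prod .univ)
    · obtain ⟨C, hC⟩ := hb
      exact ⟨C, fun z => (norm_indicator_le_norm_self _ _).trans (hC _)⟩
  have hWb : ∀ i t, ∀ᵐ r, |W i (t, r)| ≤ 1 := by
    intro i t
    refine ae_abs_le_of_forall_integral_mul_le (hWi i t) fun f hf hb => ?_
    refine le_of_tendsto (hWlim i t f hf hb) (Eventually.of_forall fun n => ?_)
    rw [one_mul]
    have hfi : Integrable f := by
      obtain ⟨C, hC⟩ := hb
      exact Integrable.of_bound hf.aestronglyMeasurable C (ae_of_all _ hC)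
    refine integral_mono_ae (integrable_mul_of_bdd ((φ (ψ n) t).integrable_fn i) hf hb) hfi.abs ?_
    filter_upwards [(φ (ψ n) t).ae_abs_fn_le_one i] with r hr
    refine (le_abs_self _).trans ?_
    rw [abs_mul]
    exact mul_le_of_le_one_left (abs_nonneg _) hr
  choose φ' hφ' using fun t => B11.exists_of_ae_abs_le H (fun i r => W i (t, r))
    (fun i => (hWm i).comp measurable_prodMk_left) fun i => hWb i t
  let w' : Fin 2 → Icc (0 : ℝ) T × Torus d → ℝ := fun i z => trunc 1 (W i z)
  have hrep : MeasRep φ' w' := by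
    refine ⟨fun i => (continuous_trunc 1).measurable.comp (hWm i),
      fun i z => abs_trunc_le zero_le_one _, fun i s => ?_⟩
    filter_upwards [hφ' s i, hWb i s] with r h1 h2
    rw [h1]
    exact trunc_eq_self h2
  have hlim : ∀ i t, ∀ f : Torus d → ℝ, Measurable f → (∃ C, ∀ r, ‖f r‖ ≤ C) →
      Tendsto (fun n => ∫ r, w (ψ n) i (t, r) * f r) atTop (𝓝 (∫ r, w' i (t, r) * f r)) := by
    intro i t f hf hb
    have e1 : ∫ r, w' i (t, r) * f r = ∫ r, W i (t, r) * f r := by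
      refine integral_congr_ae ?_
      filter_upwards [hWb i t] with r h2
      simp only [w', trunc_eq_self h2]
    rw [e1]
    refine (hWlim i t f hf hb).congr fun n => integral_congr_ae ?_
    filter_upwards [(h (ψ n)).rep.ae_eq i t] with r hr
    rw [hr]
  have hpt : Tendsto (fun n => φ (ψ n)) atTop (𝓝 φ') := by
    refine tendsto_pi_nhds.2 fun t => B11.tendsto_of_tendsto_pair hH fun i k => ?_
    have e1 : (φ' t).pair i (H k) = ∫ r, W i (t, r) * H k r := by
      refine integral_congr_ae ?_
      filter_upwards [hφ' t i] with r hr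
      rw [hr, mul_comm]
    have e2 : ∀ n, (φ (ψ n) t).pair i (H k) = ∫ r, (φ (ψ n) t).fn i r * H k r := fun n => by
      unfold B11.pair
      congr 1 with r
      rw [mul_comm]
    simp only [e1, e2]
    exact hWlim i t _ (H k).continuous.measurable ⟨_, (H k).norm_coe_le_norm⟩
  -- On the compact interval, equicontinuity makes pointwise convergence uniform.
  have hunif : TendstoUniformly (fun n => φ (ψ n)) φ' atTop := by
    have heq : Equicontinuous fun n => φ (ψ n) :=
      IsRep.equicontinuous hM hH fun n => h₀ (ψ n)
    have := (heq.tendsto_uniformFun_iff_pi atTop φ').2 hpt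
    exact UniformFun.tendsto_iff_tendstoUniformly.1 this
  have hcont : Continuous φ' :=
    hunif.continuous (Frequently.of_forall fun n => (h (ψ n)).deriv.cont)
  refine ⟨ψ, hψ₁.comp hψ₂, φ', G, w', ⟨hGm, ⟨hcont, hGi, fun i t' t ht => ?_⟩, hrep, ?_⟩, hunif⟩
  · have : ∀ᵐ r : Torus d, Integrable (fun s => G i (s, r)) (timeMeasure T) := (hGi i).prod_left_ae
    filter_upwards [hφ' t i, hφ' t' i, this] with r h1 h2 h3
    rw [h1, h2]
    have e : ∫ s in Ioc a t, G i (s, r) ∂(timeMeasure T) =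
        (∫ s in Ioc a t', G i (s, r) ∂(timeMeasure T)) +
          ∫ s in Ioc t' t, G i (s, r) ∂(timeMeasure T) := by
      rw [← setIntegral_union _ measurableSet_Ioc h3.integrableOn h3.integrableOn,
        Ioc_union_Ioc_eq_Ioc (ha t') ht]
      exact Ioc_disjoint_Ioc_of_le le_rfl
    simp only [W]
    rw [e]
    ring
  -- For a fixed V both sides of the bound converge; no interchange with the supremum is required.
  · intro V hV
    refine le_of_tendsto_of_tendsto' (f := fun n => ∫ z, ∑ i, M.costAt (w (ψ n)) (g (ψ n)) V i z
      ∂(spaceTime T d)) ?_ (hL.comp (hψ₁.comp hψ₂).tendsto_atTop) fun n => (h (ψ n)).bound V hV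
    have e := fun n => integral_sum_costAt hM (h (ψ n)).rep.meas (h (ψ n)).rep.bound
      (h (ψ n)).g_integrable hV
    simp only [e, integral_sum_costAt hM hrep.meas hrep.bound hGi hV]
    obtain ⟨hVm, C, hC⟩ := hV
    refine tendsto_finsetSum _ fun i _ => (hG' i _ (hVm i) ⟨C, fun z => hC i z⟩).sub
      (Tendsto.const_mul _ ?_)
    exact tendsto_integral_rate (hM.abs_p_le i)
      (fun n => measurable_tanhField hM (h (ψ n)).rep.meas i) (fun n z => abs_tanhField_le _ i z)
      (measurable_tanhField hM hrep.meas i) (fun z => abs_tanhField_le _ i z)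
      (fun n => (h (ψ n)).rep.meas i) (fun n z => (h (ψ n)).rep.bound i z) (hrep.meas i)
      (fun z => hrep.bound i z) (hVm i) (fun z => hC i z)
      (fun z => tendsto_tanhField hM (fun n => (h (ψ n)).rep.meas)
        (fun n => (h (ψ n)).rep.bound) hrep.meas hrep.bound hlim i z)
      (fun f hf hb => tendsto_spaceTime_of_forall_time (fun n => (h (ψ n)).rep.meas i)
        (fun n z => (h (ψ n)).rep.bound i z) (hrep.meas i) (fun z => hrep.bound i z)
        (hlim i) hf hb)

/-! ### Compactness and lower semicontinuity in the Skorohod space -/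

section Topology

variable {E : Type*} [PseudoEMetricSpace E]

/-- A continuous path as an element of the Skorohod space. -/
def Cadlag.ofContinuous (f : Icc (0 : ℝ) T → E) (hf : Continuous f) : Cadlag T E where
  toFun := f
  right_cont _ := hf.continuousWithinAt
  left_lim t := ⟨f t, hf.continuousAt.tendsto.mono_left nhdsWithin_le_nhds⟩

theorem Cadlag.edist_def (x y : Cadlag T E) : edist x y =
    ⨅ κ : Icc (0 : ℝ) T ≃o Icc (0 : ℝ) T,
      max (⨆ t, edist (κ t) t) (⨆ t, edist (x t) (y (κ t))) := rfl

theorem Cadlag.tendsto_of_tendstoUniformly {x : ℕ → Cadlag T E} {y : Cadlag T E}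
    (h : TendstoUniformly (fun n => (x n).toFun) y.toFun atTop) : Tendsto x atTop (𝓝 y) := by
  rw [tendsto_iff_edist_tendsto_0, ENNReal.tendsto_nhds_zero]
  intro ε hε
  filter_upwards [EMetric.tendstoUniformly_iff.1 h ε hε] with n hn
  rw [Cadlag.edist_def]
  refine iInf_le_of_le (OrderIso.refl _) (max_le ?_ ?_)
  · simp
  · refine iSup_le fun t => ?_
    rw [edist_comm]
    exact (hn t).le

/-- A time change close to the identity moves a continuous y little, so at a continuous path
Skorohod closeness gives closeness at each fixed time. -/
theorem Cadlag.edist_apply_eq_zero {x y : Cadlag T E} (hy : Continuous y.toFun)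
    (h : edist x y = 0) (t : Icc (0 : ℝ) T) : edist (x t) (y t) = 0 := by
  refine le_antisymm (ENNReal.le_of_forall_pos_le_add fun ε hε _ => ?_) zero_le
  rw [zero_add]
  have hε2 : (0 : ENNReal) < ε / 2 := by simpa using hε.ne'
  obtain ⟨δ, hδ, hc⟩ := EMetric.tendsto_nhds_nhds.1 (hy.tendsto t) (ε / 2) hε2
  have hlt : edist x y < min δ (ε / 2) := by rw [h]; exact lt_min hδ hε2
  rw [Cadlag.edist_def, iInf_lt_iff] at hlt
  obtain ⟨κ, hκ⟩ := hlt
  rw [max_lt_iff] at hκ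
  have h1 : edist (κ t) t < δ :=
    ((le_iSup (fun t => edist (κ t) t) t).trans_lt hκ.1).trans_le (min_le_left _ _)
  have h2 : edist (x t) (y (κ t)) < ε / 2 :=
    ((le_iSup (fun t => edist (x t) (y (κ t))) t).trans_lt hκ.2).trans_le (min_le_right _ _)
  calc edist (x t) (y t) ≤ edist (x t) (y (κ t)) + edist (y (κ t)) (y t) := edist_triangle _ _ _
    _ ≤ ε / 2 + ε / 2 := add_le_add h2.le (hc h1).le
    _ = ε := ENNReal.add_halves _

theorem Cadlag.ext_of_edist_eq_zero
    (hHd : Metric.closedBall (0 : C(Torus d, ℝ)) 1 ⊆ closure (Set.range H))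
    {x y : Cadlag T (B11 d H)} (hy : Continuous y.toFun) (h : edist x y = 0) : x = y := by
  have : x.toFun = y.toFun := funext fun t =>
    B11.eq_of_edist_eq_zero hHd (Cadlag.edist_apply_eq_zero hy h t)
  cases x; cases y; simp_all

end Topology

/-- Sequential compactness of the sublevel sets, with attainment of the rate functional. -/
theorem exists_subseq_tendsto_of_I0_le (hM : M.Admissible) (hT : 0 ≤ T) (hH : ∀ k, ‖H k‖ ≤ 1)
    {L : ℝ} {φ : ℕ → Cadlag T (B11 d H)} (h : ∀ n, M.I0 (φ n) ≤ (L : EReal)) :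
    ∃ ψ : ℕ → ℕ, StrictMono ψ ∧ ∃ φ' : Cadlag T (B11 d H), ∃ g w,
      IsRep M φ' g w L ∧ Tendsto (φ ∘ ψ) atTop (𝓝 φ') := by
  -- A representation needs a strict bound; the excess vanishes in the limit, so the limiting path
  -- is represented with L itself.
  have hlt : ∀ n : ℕ, M.I0 (φ n) < ((L + 1 / ((n : ℝ) + 1) : ℝ) : EReal) := fun n =>
    (h n).trans_lt (EReal.coe_lt_coe_iff.2 (by
      have : (0 : ℝ) < 1 / ((n : ℝ) + 1) := by positivity
      linarith))
  choose g w hgw using fun n => exists_isRep_of_I0_lt hM hT (hlt n)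
  obtain ⟨ψ, hψ, φ', g', w', hrep, hu⟩ := IsRep.exists_limit hM hT hH (L₀ := L + 1) (L' := L)
    (fun n => by
      have : 1 / ((n : ℝ) + 1) ≤ 1 := by
        rw [div_le_one (by positivity)]
        linarith [(Nat.cast_nonneg n : (0 : ℝ) ≤ n)]
      linarith)
    (by simpa using (tendsto_one_div_add_atTop_nhds_zero_nat (𝕜 := ℝ)).const_add L) hgw
  exact ⟨ψ, hψ, Cadlag.ofContinuous φ' hrep.deriv.cont, g', w', hrep,
    Cadlag.tendsto_of_tendstoUniformly hu⟩

theorem isCompact_I0_le (hM : M.Admissible) (hT : 0 ≤ T) (hH : ∀ k, ‖H k‖ ≤ 1) (L : ℝ) :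
    IsCompact {φ : Cadlag T (B11 d H) | M.I0 φ ≤ (L : EReal)} := by
  refine IsSeqCompact.isCompact fun φ hφ => ?_
  obtain ⟨ψ, hψ, φ', g, w, hrep, hlim⟩ := exists_subseq_tendsto_of_I0_le hM hT hH hφ
  exact ⟨φ', hrep.I0_le hM, ψ, hψ, hlim⟩

/-- The subsequential limit from compactness is a continuous path at distance zero from φ₀, hence
equal to it. -/
theorem exists_isRep_of_tendsto (hM : M.Admissible) (hT : 0 ≤ T) (hH : ∀ k, ‖H k‖ ≤ 1)
    (hHd : Metric.closedBall (0 : C(Torus d, ℝ)) 1 ⊆ closure (Set.range H)) {L : ℝ}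
    {φ : ℕ → Cadlag T (B11 d H)} {φ₀ : Cadlag T (B11 d H)} (h : ∀ n, M.I0 (φ n) ≤ (L : EReal))
    (hlim : Tendsto φ atTop (𝓝 φ₀)) : ∃ g w, IsRep M φ₀ g w L := by
  obtain ⟨ψ, hψ, φ', g, w, hrep, hlim'⟩ := exists_subseq_tendsto_of_I0_le hM hT hH h
  have hins : Inseparable φ₀ φ' :=
    tendsto_nhds_unique_inseparable (hlim.comp hψ.tendsto_atTop) hlim'
  rw [Cadlag.ext_of_edist_eq_zero hHd hrep.deriv.cont (EMetric.inseparable_iff.1 hins)]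
  exact ⟨g, w, hrep⟩

/-- Closedness applied to a constant sequence upgrades the strict bound to a weak one. The case L =
0 describes the zeros of I₀. -/
theorem exists_isRep_of_I0_le (hM : M.Admissible) (hT : 0 ≤ T) (hH : ∀ k, ‖H k‖ ≤ 1)
    (hHd : Metric.closedBall (0 : C(Torus d, ℝ)) 1 ⊆ closure (Set.range H)) {L : ℝ}
    {φ : Cadlag T (B11 d H)} (h : M.I0 φ ≤ (L : EReal)) : ∃ g w, IsRep M φ g w L :=
  exists_isRep_of_tendsto hM hT hH hHd (φ := fun _ => φ) (fun _ => h) tendsto_const_nhds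

theorem lowerSemicontinuous_I0 (hM : M.Admissible) (hT : 0 ≤ T) (hH : ∀ k, ‖H k‖ ≤ 1)
    (hHd : Metric.closedBall (0 : C(Torus d, ℝ)) 1 ⊆ closure (Set.range H)) :
    LowerSemicontinuous fun φ : Cadlag T (B11 d H) => M.I0 φ := by
  rw [lowerSemicontinuous_iff_isClosed_preimage]
  intro y
  induction y using EReal.rec with
  | bot =>
    have : (fun φ : Cadlag T (B11 d H) => M.I0 φ) ⁻¹' Iic ⊥ = ∅ := by
      ext φ
      simp only [mem_preimage, mem_Iic, mem_empty_iff_false, iff_false, not_le]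
      exact EReal.bot_lt_zero.trans_le (I0_nonneg φ)
    rw [this]
    exact isClosed_empty
  | top => simp
  | coe L =>
    refine IsSeqClosed.isClosed fun φ φ₀ hφ hlim => ?_
    obtain ⟨g, w, hrep⟩ := exists_isRep_of_tendsto hM hT hH hHd hφ hlim
    exact hrep.I0_le hM

end

end KacRate

/-! ### Calculus in time: Duhamel's formula and uniqueness -/

namespace KacRate

noncomputable section

variable {d : ℕ} {M : Data d} {T : ℝ} {H : ℕ → C(Torus d, ℝ)}

theorem timeIntegral_eq (hT : 0 ≤ T) (f : Icc (0 : ℝ) T → ℝ) {a t : Icc (0 : ℝ) T} (hat : a ≤ t) :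
    ∫ s in Ioc a t, f s ∂(timeMeasure T) = ∫ x in (a : ℝ)..t, f (projIcc 0 T hT x) := by
  have he : MeasurableEmbedding (Subtype.val : Icc (0 : ℝ) T → ℝ) :=
    MeasurableEmbedding.subtype_coe measurableSet_Icc
  rw [intervalIntegral.integral_of_le (by exact hat)]
  have e1 : (Ioc a t : Set (Icc (0 : ℝ) T)) = Subtype.val ⁻¹' Ioc (a : ℝ) t := rfl
  have e2 : ∀ s : Icc (0 : ℝ) T, f (projIcc 0 T hT s) = f s := fun s => by rw [projIcc_val]
  have e3 := he.setIntegral_map (μ := timeMeasure T) (fun x : ℝ => f (projIcc 0 T hT x))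
    (Ioc (a : ℝ) t)
  simp only [e2] at e3
  rw [e1, ← e3, he.map_comap, Subtype.range_coe, Measure.restrict_restrict measurableSet_Ioc]
  congr 2
  exact inter_eq_left.2 fun x hx => ⟨a.2.1.trans hx.1.le, hx.2.trans t.2.2⟩

theorem Iic_ae_eq_Ioc (hT : 0 ≤ T) (t : Icc (0 : ℝ) T) :
    (Iic t : Set (Icc (0 : ℝ) T)) =ᵐ[timeMeasure T] Ioc ⟨0, le_rfl, hT⟩ t := by
  have h0 : timeMeasure T {(⟨0, le_rfl, hT⟩ : Icc (0 : ℝ) T)} = 0 := by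
    rw [(MeasurableEmbedding.subtype_coe measurableSet_Icc).comap_apply]
    simp
  have hne : ∀ᵐ s ∂(timeMeasure T), s ≠ (⟨0, le_rfl, hT⟩ : Icc (0 : ℝ) T) := by
    rw [ae_iff]
    simpa using h0
  filter_upwards [hne] with s hs
  refine propext ⟨fun h => ⟨lt_of_le_of_ne s.2.1 ?_, h⟩, fun h => h.2⟩
  intro h
  exact hs h.symm

section Duhamel

/-- The solution of `y' = -y + h`, `y 0 = c`. -/
def duhamel (c : ℝ) (h : ℝ → ℝ) (t : ℝ) : ℝ :=
  Real.exp (-t) * (c + ∫ s in (0 : ℝ)..t, Real.exp s * h s)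

variable {h : ℝ → ℝ}

theorem intervalIntegrable_of_bdd (hm : Measurable h) {C : ℝ} (hb : ∀ t, |h t| ≤ C) (a b : ℝ) :
    IntervalIntegrable h volume a b := by
  exact (intervalIntegrable_const (c := C)).mono_fun' hm.aestronglyMeasurable (ae_of_all _ hb)

theorem intervalIntegrable_exp_mul (hm : Measurable h) {C : ℝ} (hb : ∀ t, |h t| ≤ C) (a b : ℝ) :
    IntervalIntegrable (fun s => Real.exp s * h s) volume a b :=
  (intervalIntegrable_of_bdd hm hb a b).continuousOn_mul Real.continuous_exp.continuousOn

/-- Along a càdlàg path the forcing h is only right-continuous, so only a right derivative is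
available; with continuity this suffices for the fundamental theorem of calculus. -/
theorem hasDerivWithinAt_duhamel (c : ℝ) (hm : Measurable h) {C : ℝ} (hb : ∀ t, |h t| ≤ C)
    (hr : ∀ t, ContinuousWithinAt h (Ici t) t) (t : ℝ) :
    HasDerivWithinAt (duhamel c h) (-duhamel c h t + h t) (Ici t) t := by
  have hcm : Measurable fun s => Real.exp s * h s := Real.measurable_exp.mul hm
  have h1 : HasDerivWithinAt (fun u => ∫ s in (0 : ℝ)..u, Real.exp s * h s)
      (Real.exp t * h t) (Ici t) t :=
    intervalIntegral.integral_hasDerivWithinAt_right (intervalIntegrable_exp_mul hm hb 0 t)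
      (s := Ici t) (t := Ioi t) hcm.stronglyMeasurable.stronglyMeasurableAtFilter
      (Real.continuous_exp.continuousWithinAt.mul ((hr t).mono Ioi_subset_Ici_self))
  have h2 : HasDerivWithinAt (fun u => Real.exp (-u)) (Real.exp (-t) * -1) (Ici t) t :=
    ((hasDerivAt_neg t).exp).hasDerivWithinAt
  refine (h2.mul (h1.const_add c)).congr_deriv ?_
  have : Real.exp (-t) * (Real.exp t * h t) = h t := by
    rw [← mul_assoc, ← Real.exp_add]; simp
  rw [this]
  unfold duhamel
  ring

theorem continuous_duhamel (c : ℝ) (hm : Measurable h) {C : ℝ} (hb : ∀ t, |h t| ≤ C) :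
    Continuous (duhamel c h) :=
  (Real.continuous_exp.comp continuous_neg).mul (continuous_const.add
    (intervalIntegral.continuous_primitive (fun a b => intervalIntegrable_exp_mul hm hb a b) 0))

theorem duhamel_zero (c : ℝ) (h : ℝ → ℝ) : duhamel c h 0 = c := by simp [duhamel]

theorem duhamel_sub (c : ℝ) (hm : Measurable h) {C : ℝ} (hb : ∀ t, |h t| ≤ C)
    (hr : ∀ t, ContinuousWithinAt h (Ici t) t) (a b : ℝ) :
    duhamel c h b - duhamel c h a = ∫ s in a..b, (-duhamel c h s + h s) := by
  rw [intervalIntegral.integral_eq_sub_of_hasDeriv_right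
    (continuous_duhamel c hm hb).continuousOn]
  · intro x _
    exact (hasDerivWithinAt_duhamel c hm hb hr x).mono Ioi_subset_Ici_self
  · exact ((continuous_duhamel c hm hb).neg.intervalIntegrable a b).add
      (intervalIntegrable_of_bdd hm hb a b)

/-- Duhamel's formula averages c and the values of h with weights e^{-t} and e^{-(t-s)} ds, of total
mass 1. This is why (E) preserves `B_{p₁,p₂}`. -/
theorem abs_duhamel_le {c p : ℝ} (hc : |c| ≤ p) (hb : ∀ t, |h t| ≤ p) {t : ℝ} (ht : 0 ≤ t) :
    |duhamel c h t| ≤ p := by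
  have h1 : |∫ s in (0 : ℝ)..t, Real.exp s * h s| ≤ ∫ s in (0 : ℝ)..t, Real.exp s * p := by
    rw [← Real.norm_eq_abs]
    refine intervalIntegral.norm_integral_le_of_norm_le (μ := volume) ht (ae_of_all _ fun s _ => ?_)
      ((Real.continuous_exp.mul continuous_const).intervalIntegrable (μ := volume) 0 t)
    rw [norm_mul, Real.norm_of_nonneg (Real.exp_pos s).le]
    exact mul_le_mul_of_nonneg_left (hb s) (Real.exp_pos s).le
  have h2 : ∫ s in (0 : ℝ)..t, Real.exp s * p = (Real.exp t - 1) * p := by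
    rw [intervalIntegral.integral_mul_const, integral_exp, Real.exp_zero]
  unfold duhamel
  rw [abs_mul, abs_of_pos (Real.exp_pos _)]
  calc Real.exp (-t) * |c + ∫ s in (0 : ℝ)..t, Real.exp s * h s|
      ≤ Real.exp (-t) * (p + (Real.exp t - 1) * p) := by
        gcongr
        refine (abs_add_le _ _).trans (add_le_add hc (h1.trans_eq h2))
    _ = (Real.exp (-t) * Real.exp t) * p := by ring
    _ = p := by rw [← Real.exp_add]; simp

/-- Uniqueness for the linear integral equation. -/
theorem eq_zero_of_eq_neg_integral {z : ℝ → ℝ} (hm : Measurable z) {C : ℝ} (hb : ∀ t, |z t| ≤ C)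
    (hr : ∀ t, ContinuousWithinAt z (Ici t) t)
    (hz : ∀ t ∈ Icc 0 T, z t = -∫ s in (0 : ℝ)..t, z s) : ∀ t ∈ Icc 0 T, z t = 0 := by
  -- F is defined on the whole line and is continuous; on [0,T] it equals z, so F' = -F from the
  -- right with F(0) = 0, and Grönwall's inequality applies.
  let F : ℝ → ℝ := fun t => -∫ s in (0 : ℝ)..t, z s
  have hF : Continuous F :=
    (intervalIntegral.continuous_primitive (fun a b => intervalIntegrable_of_bdd hm hb a b) 0).neg
  have hd : ∀ t ∈ Ico 0 T, HasDerivWithinAt F (-z t) (Ici t) t := fun t _ =>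
    (intervalIntegral.integral_hasDerivWithinAt_right (intervalIntegrable_of_bdd hm hb 0 t)
      (s := Ici t) (t := Ioi t) hm.stronglyMeasurable.stronglyMeasurableAtFilter
      ((hr t).mono Ioi_subset_Ici_self)).neg
  have hg := norm_le_gronwallBound_of_norm_deriv_right_le (f := F) (f' := fun t => -z t) (δ := 0)
    (K := 1) (ε := 0) (a := 0) (b := T) hF.continuousOn hd (by simp [F]) (fun t ht => by
      rw [hz t ⟨ht.1, ht.2.le⟩]; simp [F])
  intro t ht
  have := hg t ht
  rw [hz t ht]
  rw [gronwallBound_ε0_δ0] at this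
  exact norm_le_zero_iff.1 this

end Duhamel

end

end KacRate

/-! ### Paths of rate zero solve the limiting equation -/

namespace KacRate

noncomputable section

variable {d : ℕ} {M : Data d} {T : ℝ} {H : ℕ → C(Torus d, ℝ)}

/-- The right side `-u_i + p_i tanh (J * u + a_i θ)` of the limiting equation along a path. -/
def Data.drift (M : Data d) (w : Fin 2 → Icc (0 : ℝ) T × Torus d → ℝ) (i : Fin 2)
    (z : Icc (0 : ℝ) T × Torus d) : ℝ :=
  -w i z + M.p i * M.tanhField w i z

theorem measurable_drift (hM : M.Admissible) {w : Fin 2 → Icc (0 : ℝ) T × Torus d → ℝ}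
    (hw : ∀ j, Measurable (w j)) (i : Fin 2) : Measurable (M.drift w i) :=
  (hw i).neg.add ((measurable_tanhField hM hw i).const_mul _)

theorem abs_drift_le (hM : M.Admissible) {w : Fin 2 → Icc (0 : ℝ) T × Torus d → ℝ}
    (hw : ∀ j z, |w j z| ≤ 1) (i : Fin 2) (z : Icc (0 : ℝ) T × Torus d) : |M.drift w i z| ≤ 2 := by
  refine (abs_add_le _ _).trans ?_
  rw [abs_neg, abs_mul]
  have := mul_le_mul (hM.abs_p_le i) (abs_tanhField_le (M := M) w i z) (abs_nonneg _) zero_le_one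
  linarith [hw i z]

/-- The costs are nonpositive along solutions with values in `B_{p₁,p₂}`. -/
theorem cost_nonpos {p τ u : ℝ} (hτ : |τ| ≤ 1) (hu : |u| ≤ p) (v : ℝ) :
    cost p τ u (-u + p * τ) v ≤ 0 := by
  have h1 := Real.add_one_le_exp (2 * v)
  have h2 := Real.add_one_le_exp (-(2 * v))
  obtain ⟨hτ1, hτ2⟩ := abs_le.1 hτ
  obtain ⟨hu1, hu2⟩ := abs_le.1 hu
  unfold cost
  rw [Real.cosh_eq, Real.sinh_eq]
  -- At the drift, the cost is -1/4 times the sum of the two non-negative products below.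
  have a1 : 0 ≤ (p - u) * (1 + τ) * (Real.exp (2 * v) - 1 - 2 * v) :=
    mul_nonneg (mul_nonneg (by linarith) (by linarith)) (by linarith)
  have a2 : 0 ≤ (p + u) * (1 - τ) * (Real.exp (-(2 * v)) - 1 + 2 * v) :=
    mul_nonneg (mul_nonneg (by linarith) (by linarith)) (by linarith)
  linarith

/-- First order expansion of the cost. -/
theorem le_cost {p τ u g v : ℝ} (hp : |p| ≤ 1) (hτ : |τ| ≤ 1) (hu : |u| ≤ 1) (hv : |v| ≤ 1 / 2) :
    v * (g - (-u + p * τ)) - 8 * v ^ 2 ≤ cost p τ u g v := by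
  have hx : |2 * v| ≤ 1 := by rw [abs_mul, abs_two]; linarith
  have e1 := abs_le.1 (Real.abs_exp_sub_one_sub_id_le hx)
  have e2 := abs_le.1 (Real.abs_exp_sub_one_sub_id_le (x := -(2 * v)) (by rwa [abs_neg]))
  -- Both errors are at most 4v², both coefficients at most 2, and the prefactor is 1/2: together
  -- 8v².
  have c1 : |Real.cosh (2 * v) - 1| ≤ (2 * v) ^ 2 := by
    rw [Real.cosh_eq, abs_le]
    constructor <;> nlinarith [e1.1, e1.2, e2.1, e2.2]
  have c2 : |Real.sinh (2 * v) - 2 * v| ≤ (2 * v) ^ 2 := by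
    rw [Real.sinh_eq, abs_le]
    constructor <;> nlinarith [e1.1, e1.2, e2.1, e2.2]
  have b1 : |p - u * τ| ≤ 2 := (abs_sub _ _).trans (by
    rw [abs_mul]; have := mul_le_one₀ hu (abs_nonneg τ) hτ; linarith)
  have b2 : |p * τ - u| ≤ 2 := (abs_sub _ _).trans (by
    rw [abs_mul]; have := mul_le_one₀ hp (abs_nonneg τ) hτ; linarith)
  have d1 := mul_le_mul b1 c1 (abs_nonneg _) zero_le_two
  have d2 := mul_le_mul b2 c2 (abs_nonneg _) zero_le_two
  rw [← abs_mul] at d1 d2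
  have f1 := (abs_le.1 d1).2
  have f2 := (abs_le.1 d2).2
  unfold cost
  nlinarith

/-- The drift is the derivative of Γ_V/2 at V = 0. Testing with V_i = ε sgn(g_i - drift_i) gives ε ∫
|g_i - drift_i| ≤ 8 ε² m; divide by ε and let ε → 0. -/
theorem IsRep.ae_eq_drift (hM : M.Admissible) {φ : Icc (0 : ℝ) T → B11 d H}
    {g w : Fin 2 → Icc (0 : ℝ) T × Torus d → ℝ} (h : IsRep M φ g w 0) (i : Fin 2) :
    g i =ᵐ[spaceTime T d] M.drift w i := by
  have hkm := measurable_drift hM h.rep.meas i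
  have hki : Integrable (M.drift w i) (spaceTime T d) :=
    Integrable.of_bound hkm.aestronglyMeasurable 2
      (ae_of_all _ fun z => abs_drift_le hM h.rep.bound i z)
  have hgk : Integrable (fun z => g i z - M.drift w i z) (spaceTime T d) :=
    (h.g_integrable i).sub hki
  set m := (spaceTime T d).real univ with hm
  have key : ∀ ε : ℝ, 0 < ε → ε ≤ 1 / 2 →
      ε * ∫ z, |g i z - M.drift w i z| ∂(spaceTime T d) ≤ 8 * ε ^ 2 * m := by
    intro ε hε hε2
    let V : Fin 2 → Icc (0 : ℝ) T × Torus d → ℝ := fun j z =>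
      if j = i then ε * sgn (g i z - M.drift w i z) else 0
    have hVe : ∀ z, |ε * sgn (g i z - M.drift w i z)| = ε := fun z => by
      rw [abs_mul, abs_sgn, abs_of_pos hε, mul_one]
    have hV : BddMeas V := by
      refine ⟨fun j => ?_, ε, fun j z => ?_⟩
      · by_cases hj : j = i
        · simp only [V, if_pos hj]
          exact (measurable_sgn.comp ((h.g_meas i).sub hkm)).const_mul ε
        · simp only [V, if_neg hj]
          exact measurable_const
      · by_cases hj : j = i
        · simp only [V, if_pos hj]
          exact (hVe z).le
        · simp [V, if_neg hj, hε.le]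
    have hi := integrable_finsetSum Finset.univ fun j _ =>
      integrable_costAt hM h.rep.meas h.rep.bound h.g_integrable hV j
    have h1 : ∫ z, (ε * |g i z - M.drift w i z| - 8 * ε ^ 2) ∂(spaceTime T d) ≤
        ∫ z, ∑ j, M.costAt w g V j z ∂(spaceTime T d) := by
      refine integral_mono ((hgk.abs.const_mul ε).sub (integrable_const _)) hi fun z => ?_
      simp only
      rw [Finset.sum_eq_single i (fun j _ hj => by simp [Data.costAt, V, hj]) (by simp)]
      have hVi : V i z = ε * sgn (g i z - M.drift w i z) := by simp [V]
      have h2 := le_cost (g := g i z) (v := V i z) (hM.abs_p_le i)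
        (abs_tanhField_le (M := M) w i z) (h.rep.bound i z) (by rw [hVi, hVe]; exact hε2)
      refine le_trans (le_of_eq ?_) h2
      rw [← sq_abs (V i z), hVi, hVe, mul_assoc, mul_comm (sgn _)]
      congr 2
      exact (mul_sgn _).symm
    have h2 := h1.trans (h.bound V hV)
    rw [integral_sub (hgk.abs.const_mul ε) (integrable_const _), integral_const_mul,
      integral_const, smul_eq_mul] at h2
    linarith
  have h0 : ∫ z, |g i z - M.drift w i z| ∂(spaceTime T d) = 0 := by
    refine le_antisymm (le_of_forall_pos_le_add fun δ hδ => ?_)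
      (integral_nonneg fun z => abs_nonneg _)
    have hm0 : 0 ≤ m := measureReal_nonneg
    set ε := min (1 / 2) (δ / (8 * (m + 1))) with hε
    have hε0 : 0 < ε := lt_min (by norm_num) (by positivity)
    have h1 := key ε hε0 (min_le_left _ _)
    have h2 : ε * (8 * (m + 1)) ≤ δ := by
      have : ε ≤ δ / (8 * (m + 1)) := min_le_right _ _
      rwa [le_div_iff₀ (by positivity)] at this
    have h3 : ε * ∫ z, |g i z - M.drift w i z| ∂(spaceTime T d) ≤ ε * (0 + δ) := by
      refine h1.trans ?_
      have : 8 * ε ^ 2 * m = ε * (8 * ε * m) := by ring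
      rw [this]
      refine mul_le_mul_of_nonneg_left ?_ hε0.le
      linarith
    exact le_of_mul_le_mul_left h3 hε0
  have h1 := (integral_eq_zero_iff_of_nonneg (fun z => abs_nonneg _) hgk.abs).1 h0
  filter_upwards [h1] with z hz
  exact sub_eq_zero.1 (abs_eq_zero.1 hz)

/-- Lower bound of the cost where the density leaves `[-p, p]`. -/
theorem le_cost_of_lt {p τ u c : ℝ} (hp0 : 0 ≤ p) (hp : |p| ≤ 1) (hτ : |τ| ≤ 1) (hu : |u| ≤ 1)
    (hpu : p < |u|) (hc : 0 ≤ c) :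
    (|u| - p) * (1 + sgn u * τ) / 2 * (c + c ^ 2) - 2 * c ≤
      cost p τ u (-u + p * τ) (c * sgn u) := by
  -- The cost is invariant under changing the signs of τ, u, g and v, so u > p may be assumed. Then
  -- e^{2c} has coefficient (u - p)(1 + τ)/4 ≥ 0 and is bounded below by its quadratic Taylor
  -- polynomial.
  have main : ∀ τ u : ℝ, |τ| ≤ 1 → |u| ≤ 1 → p < u →
      (u - p) * (1 + τ) / 2 * (c + c ^ 2) - 2 * c ≤ cost p τ u (-u + p * τ) c := by
    intro τ u hτ hu hpu
    obtain ⟨hτ1, hτ2⟩ := abs_le.1 hτ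
    have h1 := Real.quadratic_le_exp_of_nonneg (x := 2 * c) (by linarith)
    have h2 : Real.exp (-(2 * c)) ≤ 1 := Real.exp_le_one_iff.2 (by linarith)
    have b2 : |p * τ - u| ≤ 2 := (abs_sub _ _).trans (by
      rw [abs_mul]; have := mul_le_one₀ hp (abs_nonneg τ) hτ; linarith)
    have a1 : 0 ≤ (u - p) * (1 + τ) * (Real.exp (2 * c) - (1 + 2 * c + (2 * c) ^ 2 / 2)) :=
      mul_nonneg (mul_nonneg (by linarith) (by linarith)) (by linarith)
    have a2 : 0 ≤ (p + u) * (1 - τ) * (1 - Real.exp (-(2 * c))) :=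
      mul_nonneg (mul_nonneg (by linarith) (by linarith)) (by linarith)
    have a3 : 0 ≤ c * (p * τ - u + 2) := mul_nonneg hc (by linarith [(abs_le.1 b2).1])
    unfold cost
    rw [Real.cosh_eq, Real.sinh_eq]
    nlinarith
  rcases le_or_gt 0 u with h0 | h0
  · have hs : sgn u = 1 := by simp [sgn, h0]
    rw [abs_of_nonneg h0] at hpu ⊢
    have := main τ u hτ hu hpu
    rw [hs, mul_one, one_mul]
    exact this
  · have hs : sgn u = -1 := by simp [sgn, h0]
    rw [abs_of_neg h0] at hpu ⊢
    have := main (-τ) (-u) (by rwa [abs_neg]) (by rwa [abs_neg]) hpu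
    rw [hs]
    refine le_of_eq_of_le (by ring) (this.trans_eq ?_)
    unfold cost
    rw [show 2 * (c * -1) = -(2 * c) by ring, Real.cosh_neg, Real.sinh_neg]
    ring

/-- Outside [-p, p] the cost grows at least quadratically in c along V = c sgn(u), since g is
already known to be the bounded drift. The zero bound gives (c + c²) ∫_E D ≤ 2cm, so c → ∞ forces
∫_E D = 0; as |tanh| < 1 strictly, D > 0 on E, and E is null. -/
theorem IsRep.ae_abs_le (hM : M.Admissible) {φ : Icc (0 : ℝ) T → B11 d H}
    {g w : Fin 2 → Icc (0 : ℝ) T × Torus d → ℝ} (h : IsRep M φ g w 0) (i : Fin 2) :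
    ∀ᵐ z ∂(spaceTime T d), |w i z| ≤ M.p i := by
  let E : Set (Icc (0 : ℝ) T × Torus d) := {z | M.p i < |w i z|}
  have hE : MeasurableSet E := measurableSet_lt measurable_const (h.rep.meas i).abs
  let D : Icc (0 : ℝ) T × Torus d → ℝ := fun z =>
    (|w i z| - M.p i) * (1 + sgn (w i z) * M.tanhField w i z) / 2
  have hDm : Measurable D := (((h.rep.meas i).abs.sub_const _).mul (measurable_const.add
    ((measurable_sgn.comp (h.rep.meas i)).mul (measurable_tanhField hM h.rep.meas i)))).div_const 2
  have hst : ∀ z, |sgn (w i z) * M.tanhField w i z| < 1 := fun z => by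
    rw [abs_mul, abs_sgn, one_mul]
    exact Real.abs_tanh_lt_one _
  have hDb : ∀ z, |D z| ≤ 2 := by
    intro z
    have h1 : |(|w i z| - M.p i)| ≤ 2 := (abs_sub _ _).trans (by
      rw [abs_abs]; linarith [h.rep.bound i z, hM.abs_p_le i])
    have h2 : |1 + sgn (w i z) * M.tanhField w i z| ≤ 2 := (abs_add_le _ _).trans (by
      rw [abs_one]; linarith [hst z])
    simp only [D]
    rw [abs_div, abs_mul, abs_two, div_le_iff₀ two_pos]
    exact mul_le_mul h1 h2 (abs_nonneg _) zero_le_two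
  have hDi : Integrable D (spaceTime T d) :=
    Integrable.of_bound hDm.aestronglyMeasurable 2 (ae_of_all _ hDb)
  have hDpos : ∀ z ∈ E, 0 < D z := fun z hz =>
    div_pos (mul_pos (sub_pos.2 hz) (by linarith [(abs_lt.1 (hst z)).1])) two_pos
  set m := (spaceTime T d).real E with hm
  have hm0 : 0 ≤ m := measureReal_nonneg
  have hae := h.ae_eq_drift hM i
  have key : ∀ c : ℝ, 0 < c → (c + c ^ 2) * ∫ z in E, D z ∂(spaceTime T d) ≤ 2 * c * m := by
    intro c hc
    let V : Fin 2 → Icc (0 : ℝ) T × Torus d → ℝ := fun j =>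
      if j = i then E.indicator fun z => c * sgn (w i z) else fun _ => 0
    have hV : BddMeas V := by
      refine ⟨fun j => ?_, c, fun j z => ?_⟩
      · by_cases hj : j = i
        · simp only [V, if_pos hj]
          exact ((measurable_sgn.comp (h.rep.meas i)).const_mul c).indicator hE
        · simp only [V, if_neg hj]
          exact measurable_const
      · by_cases hj : j = i
        · simp only [V, if_pos hj]
          rw [← Real.norm_eq_abs]
          refine (norm_indicator_le_norm_self _ _).trans ?_
          rw [norm_mul, Real.norm_eq_abs, Real.norm_eq_abs, abs_sgn, abs_of_pos hc, mul_one]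
        · simp [V, if_neg hj, hc.le]
    have hi := integrable_finsetSum Finset.univ fun j _ =>
      integrable_costAt hM h.rep.meas h.rep.bound h.g_integrable hV j
    have hDE : Integrable (fun z => (c + c ^ 2) * D z - 2 * c) (spaceTime T d) :=
      (hDi.const_mul _).sub (integrable_const _)
    have h1 : ∫ z in E, ((c + c ^ 2) * D z - 2 * c) ∂(spaceTime T d) ≤
        ∫ z, ∑ j, M.costAt w g V j z ∂(spaceTime T d) := by
      rw [← integral_indicator hE]
      refine integral_mono_ae (hDE.indicator hE) hi ?_
      filter_upwards [hae] with z hgz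
      rw [Finset.sum_eq_single i (fun j _ hj => by simp [Data.costAt, V, hj]) (by simp)]
      by_cases hz : z ∈ E
      · have hv : V i z = c * sgn (w i z) := by simp [V, indicator_of_mem hz]
        rw [indicator_of_mem hz]
        unfold Data.costAt
        rw [hv, hgz]
        refine le_trans (le_of_eq ?_) (le_cost_of_lt (hM.p_nonneg i) (hM.abs_p_le i)
          (abs_tanhField_le (M := M) w i z) (h.rep.bound i z) hz hc.le)
        simp only [D]
        ring
      · simp [Data.costAt, V, indicator_of_notMem hz]
    have h2 := h1.trans (h.bound V hV)
    rw [integral_sub (hDi.const_mul _).integrableOn (integrable_const _), integral_const_mul,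
      setIntegral_const, smul_eq_mul] at h2
    linarith
  have h0 : ∫ z in E, D z ∂(spaceTime T d) = 0 := by
    refine le_antisymm (le_of_forall_pos_le_add fun δ hδ => ?_)
      (setIntegral_nonneg hE fun z hz => (hDpos z hz).le)
    set c := 2 * m / δ + 1 with hc
    have hc0 : 0 < c := by positivity
    have h1 := key c hc0
    have h2 : 2 * m ≤ δ * c := by
      rw [hc, mul_add, mul_div_cancel₀ _ hδ.ne']
      linarith
    have h3 : (c + c ^ 2) * ∫ z in E, D z ∂(spaceTime T d) ≤ (c + c ^ 2) * (0 + δ) := by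
      refine h1.trans ?_
      nlinarith [mul_le_mul_of_nonneg_left h2 hc0.le, mul_pos hδ hc0]
    exact le_of_mul_le_mul_left h3 (by positivity)
  have h1 := (setIntegral_eq_zero_iff_of_nonneg_ae ((ae_restrict_iff' hE).2
    (ae_of_all _ fun z hz => (hDpos z hz).le)) hDi.integrableOn).1 h0
  rw [Filter.EventuallyEq, ae_restrict_iff' hE] at h1
  filter_upwards [h1] with z hz
  by_contra hc
  exact (hDpos z (not_le.1 hc)).ne' (hz (not_le.1 hc))

theorem timeMeasure_Iio_pos (hT : 0 < T) {δ : ℝ} (hδ : 0 < δ) :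
    0 < timeMeasure T {s : Icc (0 : ℝ) T | (s : ℝ) < δ} := by
  rw [(MeasurableEmbedding.subtype_coe measurableSet_Icc).comap_apply]
  have : Ioo (0 : ℝ) (min δ T) ⊆ Subtype.val '' {s : Icc (0 : ℝ) T | (s : ℝ) < δ} := fun x hx =>
    ⟨⟨x, hx.1.le, hx.2.le.trans (min_le_right _ _)⟩, hx.2.trans_le (min_le_left _ _), rfl⟩
  refine lt_of_lt_of_le ?_ (measure_mono this)
  rw [Real.volume_Ioo, sub_zero]
  exact ENNReal.ofReal_pos.2 (lt_min hδ hT)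

/-- The bound by p_i is known only at almost every time. Good times exist arbitrarily close to 0,
and |g| ≤ 2 makes the path Lipschitz in L¹, so the excess (|φ_i(0)| - p_i)⁺ has integral zero. -/
theorem IsRep.norm_initial_le (hM : M.Admissible) (hT : 0 < T) {φ : Cadlag T (B11 d H)}
    {g w : Fin 2 → Icc (0 : ℝ) T × Torus d → ℝ} (h : IsRep M φ g w 0) (i : Fin 2) :
    ‖(initial hT φ).val i‖ ≤ M.p i := by
  rw [B11.norm_val_le_iff _ _ (hM.p_nonneg i)]
  let a : Icc (0 : ℝ) T := ⟨0, le_rfl, hT.le⟩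
  have hgb : ∀ᵐ z ∂(spaceTime T d), |g i z| ≤ 2 := by
    filter_upwards [h.ae_eq_drift hM i] with z hz
    rw [hz]
    exact abs_drift_le hM h.rep.bound i z
  let f : Torus d → ℝ := fun r => max (|(φ a).fn i r| - M.p i) 0
  have hfi : Integrable f := (((φ a).integrable_fn i).abs.sub (integrable_const _)).pos_part
  have hf0 : ∀ r, 0 ≤ f r := fun r => le_max_right _ _
  set m := (volume : Measure (Torus d)).real univ with hm
  have hm0 : 0 ≤ m := measureReal_nonneg
  have hgood : ∀ᵐ s ∂(timeMeasure T), ∀ᵐ r, |(φ s).fn i r| ≤ M.p i := by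
    filter_upwards [Measure.ae_ae_of_ae_prod (h.ae_abs_le hM i)] with s hs
    filter_upwards [hs, h.rep.ae_eq i s] with r h1 h2
    rwa [← h2]
  have key : ∀ δ : ℝ, 0 < δ → ∫ r, f r ≤ 2 * (δ * m) := by
    intro δ hδ
    obtain ⟨s, hsδ, hs⟩ : ∃ s : Icc (0 : ℝ) T, (s : ℝ) < δ ∧ ∀ᵐ r, |(φ s).fn i r| ≤ M.p i := by
      by_contra hc
      push Not at hc
      refine (timeMeasure_Iio_pos hT hδ).ne' (measure_mono_null (fun s hs => ?_) (ae_iff.1 hgood))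
      exact fun hh => hc s hs (hh.mono fun r hr => not_lt.2 hr)
    have has : a ≤ s := s.2.1
    have h1 : ∫ r, f r ≤ ∫ r, |(φ s).fn i r - (φ a).fn i r| := by
      refine integral_mono_ae hfi (((φ s).integrable_fn i).sub ((φ a).integrable_fn i)).abs ?_
      filter_upwards [hs] with r hr
      refine max_le ?_ (abs_nonneg _)
      rw [abs_sub_comm]
      linarith [abs_sub_abs_le_abs_sub ((φ a).fn i r) ((φ s).fn i r)]
    refine (h1.trans (h.deriv.integral_abs_sub_le i has)).trans ?_
    have hE : MeasurableSet (Ioc a s ×ˢ (univ : Set (Torus d))) := measurableSet_Ioc.prod .univ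
    have h2 : ∫ z in Ioc a s ×ˢ univ, |g i z| ∂(spaceTime T d) ≤
        ∫ z in Ioc a s ×ˢ univ, (2 : ℝ) ∂(spaceTime T d) :=
      integral_mono_ae (h.g_integrable i).abs.integrableOn (integrable_const _)
        (ae_restrict_of_ae hgb)
    refine h2.trans ?_
    rw [setIntegral_const, smul_eq_mul, mul_comm]
    refine mul_le_mul_of_nonneg_left ((spaceTime_real_Ioc_le a s).trans ?_) zero_le_two
    refine mul_le_mul_of_nonneg_right ?_ hm0
    rw [Subtype.dist_eq, dist_comm, Real.dist_eq]
    simp only [a, sub_zero]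
    rw [abs_of_nonneg s.2.1]
    exact hsδ.le
  have h0 : ∫ r, f r = 0 := by
    refine le_antisymm (le_of_forall_pos_le_add fun ε hε => ?_) (integral_nonneg hf0)
    refine (key (ε / (2 * (m + 1))) (by positivity)).trans ?_
    rw [zero_add]
    have : 2 * (ε / (2 * (m + 1)) * m) = ε * (m / (m + 1)) := by field_simp
    rw [this]
    exact mul_le_of_le_one_right hε.le ((div_le_one (by positivity)).2 (by linarith))
  filter_upwards [(integral_eq_zero_iff_of_nonneg hf0 hfi).1 h0] with r hr
  have : |(φ a).fn i r| - M.p i ≤ f r := le_max_left _ _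
  rw [hr] at this
  change |(φ a).fn i r| ≤ M.p i
  simp only [Pi.zero_apply] at this
  linarith

/-- The time integral in the weak formulation as a space-time integral. -/
theorem MeasRep.integral_weak_eq (hM : M.Admissible) (hT : 0 ≤ T) {φ : Icc (0 : ℝ) T → B11 d H}
    {w : Fin 2 → Icc (0 : ℝ) T × Torus d → ℝ} (h : MeasRep φ w) (i : Fin 2) (G : C(Torus d, ℝ))
    (t : Icc (0 : ℝ) T) :
    ∫ s in Iic t, (∫ r, G r * (-(φ s).fn i r + M.p i * Real.tanh (M.field (φ s).fn i r)))
      ∂(timeMeasure T) =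
    ∫ z, M.drift w i z * (Ioc ⟨0, le_rfl, hT⟩ t ×ˢ univ).indicator (fun z => G z.2) z
      ∂(spaceTime T d) := by
  have hi : Integrable (fun z => M.drift w i z *
      (Ioc ⟨0, le_rfl, hT⟩ t ×ˢ univ).indicator (fun z => G z.2) z) (spaceTime T d) := by
    refine integrable_mul_of_bdd (Integrable.of_bound
      (measurable_drift hM h.meas i).aestronglyMeasurable 2
      (ae_of_all _ fun z => abs_drift_le hM h.bound i z))
      ((G.continuous.measurable.comp measurable_snd).indicator (measurableSet_Ioc.prod .univ))
      ⟨‖G‖, fun z => (norm_indicator_le_norm_self _ _).trans (G.norm_coe_le_norm _)⟩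
  rw [integral_prod _ hi, setIntegral_congr_set (Iic_ae_eq_Ioc hT t),
    ← integral_indicator measurableSet_Ioc]
  congr 1 with s
  by_cases hs : s ∈ Ioc (⟨0, le_rfl, hT⟩ : Icc (0 : ℝ) T) t
  · rw [indicator_of_mem hs]
    refine integral_congr_ae ?_
    filter_upwards [h.ae_eq i s] with r hr
    rw [indicator_of_mem (by exact ⟨hs, mem_univ _⟩), mul_comm]
    unfold Data.drift Data.tanhField
    rw [hr, Data.field_congr (fun j => h.ae_eq j s)]
  · rw [indicator_of_notMem hs]
    have : ∀ r : Torus d, (s, r) ∉ Ioc (⟨0, le_rfl, hT⟩ : Icc (0 : ℝ) T) t ×ˢ univ :=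
      fun r hr => hs hr.1
    simp [this]

theorem IsRep.isWeakSolution (hM : M.Admissible) (hT : 0 < T) {φ : Cadlag T (B11 d H)}
    {g w : Fin 2 → Icc (0 : ℝ) T × Torus d → ℝ} (h : IsRep M φ g w 0) : M.IsWeakSolution hT φ := by
  intro i G t
  have h1 := h.deriv.integral_mul_eq G.continuous.measurable ⟨‖G‖, G.norm_coe_le_norm⟩ i
    (a := ⟨0, le_rfl, hT.le⟩) (t := t) t.2.1
  have e : ∀ u : B11 d H, u.pair i G = ∫ r, u.fn i r * G r := fun u => by
    unfold B11.pair
    simp only [mul_comm]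
  rw [h.rep.integral_weak_eq hM hT.le i G t, e, e, h1]
  congr 1
  refine integral_congr_ae ?_
  filter_upwards [h.ae_eq_drift hM i] with z hz
  rw [hz]

end

end KacRate

/-! ### Weak solutions starting in `B_{p₁,p₂}` have rate zero -/

namespace KacRate

noncomputable section

variable {d : ℕ} {M : Data d} {T : ℝ} {H : ℕ → C(Torus d, ℝ)}

/-- The function `r' ↦ J(r - r')`. -/
def Data.Admissible.shiftJ (hM : M.Admissible) (r : Torus d) : C(Torus d, ℝ) :=
  ⟨fun r' => M.J (r - r'), hM.continuous_J.comp (continuous_const.sub continuous_id)⟩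

/-- As a pairing with a continuous function, the field at r is continuous for ρ, hence
right-continuous in time along a càdlàg path. -/
theorem field_eq_pair (hM : M.Admissible) (u : B11 d H) (i : Fin 2) (r : Torus d) :
    M.field u.fn i r = ∑ j, u.pair j (hM.shiftJ r) + M.a i * M.θ := by
  unfold Data.field B11.pair
  rw [← integral_finsetSum _ fun j _ => u.integrable_mul_fn j (hM.shiftJ r)]
  simp only [Finset.mul_sum]
  rfl

theorem continuousWithinAt_comp_projIcc (hT : 0 ≤ T) {f : Icc (0 : ℝ) T → ℝ}
    (hf : ∀ t, ContinuousWithinAt f (Ici t) t) (x : ℝ) :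
    ContinuousWithinAt (fun x => f (projIcc 0 T hT x)) (Ici x) x :=
  (hf (projIcc 0 T hT x)).comp continuous_projIcc.continuousWithinAt
    fun _ hy => monotone_projIcc hT hy

/-- Paths with values in the densities, pointwise given by Duhamel's formula. -/
theorem exists_duhamel_version (hT : 0 ≤ T) {p : ℝ} {c : Torus d → ℝ} (hc : Measurable c)
    (hcp : ∀ r, |c r| ≤ p) {N : Icc (0 : ℝ) T × Torus d → ℝ} (hN : Measurable N)
    (hNp : ∀ z, |N z| ≤ p)
    (hNr : ∀ r t, ContinuousWithinAt (fun s => N (s, r)) (Ici t) t) :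
    ∃ W : Icc (0 : ℝ) T × Torus d → ℝ, Measurable W ∧ (∀ z, |W z| ≤ p) ∧
      (∀ r, Continuous fun s => W (s, r)) ∧ (∀ r, W (⟨0, le_rfl, hT⟩, r) = c r) ∧
      ∀ r t' t, t' ≤ t → W (t, r) - W (t', r) =
        ∫ s in Ioc t' t, (-W (s, r) + N (s, r)) ∂(timeMeasure T) := by
  let a : Icc (0 : ℝ) T := ⟨0, le_rfl, hT⟩
  let h : Torus d → ℝ → ℝ := fun r x => N (projIcc 0 T hT x, r)
  have hhm : ∀ r, Measurable (h r) := fun r =>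
    hN.comp (continuous_projIcc.measurable.prodMk measurable_const)
  have hhb : ∀ r x, |h r x| ≤ p := fun r x => hNp _
  have hhr : ∀ r x, ContinuousWithinAt (h r) (Ici x) x := fun r =>
    continuousWithinAt_comp_projIcc hT (hNr r)
  have hproj : ∀ x ∈ Icc (0 : ℝ) T, ((projIcc 0 T hT x : Icc (0 : ℝ) T) : ℝ) = x := fun x hx => by
    rw [projIcc_of_mem hT hx]
  have hmem : ∀ t' t : Icc (0 : ℝ) T, t' ≤ t → ∀ x ∈ uIcc (t' : ℝ) t, x ∈ Icc (0 : ℝ) T := by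
    intro t' t ht x hx
    rw [uIcc_of_le (by exact ht)] at hx
    exact ⟨t'.2.1.trans hx.1, hx.2.trans t.2.2⟩
  -- Written as a parameter integral over [0,T], W is visibly jointly measurable; `hWd` identifies
  -- it with `duhamel` for the calculus.
  let W : Icc (0 : ℝ) T × Torus d → ℝ := fun z =>
    Real.exp (-(z.1 : ℝ)) * (c z.2 + ∫ s in Ioc a z.1, Real.exp s * N (s, z.2) ∂(timeMeasure T))
  have hWd : ∀ (t : Icc (0 : ℝ) T) (r), W (t, r) = duhamel (c r) (h r) t := by
    intro t r
    have hat : a ≤ t := t.2.1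
    simp only [W, duhamel]
    rw [timeIntegral_eq hT (fun s => Real.exp s * N (s, r)) hat]
    congr 2
    refine intervalIntegral.integral_congr fun x hx => ?_
    simp only [h]
    rw [hproj x (hmem a t hat x hx)]
  refine ⟨W, ?_, ?_, ?_, ?_, ?_⟩
  · have hexp : Measurable fun z : Icc (0 : ℝ) T × Torus d => Real.exp (z.1 : ℝ) :=
      Real.measurable_exp.comp (measurable_subtype_coe.comp measurable_fst)
    have hexp' : Measurable fun z : Icc (0 : ℝ) T × Torus d => Real.exp (-(z.1 : ℝ)) :=
      Real.measurable_exp.comp (measurable_subtype_coe.comp measurable_fst).neg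
    exact hexp'.mul ((hc.comp measurable_snd).add (measurable_timeIntegral (hexp.mul hN) a))
  · rintro ⟨t, r⟩
    rw [hWd]
    exact abs_duhamel_le (hcp r) (hhb r) t.2.1
  · intro r
    simp only [hWd]
    exact (continuous_duhamel (c r) (hhm r) (hhb r)).comp continuous_subtype_val
  · intro r
    rw [hWd]
    exact duhamel_zero _ _
  · intro r t' t ht
    rw [hWd, hWd, duhamel_sub (c r) (hhm r) (hhb r) (hhr r),
      timeIntegral_eq hT (fun s => -W (s, r) + N (s, r)) ht]
    refine intervalIntegral.integral_congr fun x hx => ?_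
    simp only [hWd, h]
    rw [hproj x (hmem t' t ht x hx)]

theorem continuousWithinAt_pair
    (hHd : Metric.closedBall (0 : C(Torus d, ℝ)) 1 ⊆ closure (Set.range H))
    (φ : Cadlag T (B11 d H)) (i : Fin 2) (G : C(Torus d, ℝ)) (t : Icc (0 : ℝ) T) :
    ContinuousWithinAt (fun s => (φ s).pair i G) (Ici t) t :=
  (B11.continuous_pair hHd i G).continuousAt.comp_continuousWithinAt (φ.right_cont t)

/-- `tanh (J * φ + a_i θ)` along a path of the Skorohod space. -/
def Data.pathTanh (M : Data d) (φ : Cadlag T (B11 d H)) (i : Fin 2)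
    (z : Icc (0 : ℝ) T × Torus d) : ℝ :=
  Real.tanh (M.field (φ z.1).fn i z.2)

theorem continuousWithinAt_pathTanh (hM : M.Admissible)
    (hHd : Metric.closedBall (0 : C(Torus d, ℝ)) 1 ⊆ closure (Set.range H))
    (φ : Cadlag T (B11 d H)) (i : Fin 2) (r : Torus d) (t : Icc (0 : ℝ) T) :
    ContinuousWithinAt (fun s => M.pathTanh φ i (s, r)) (Ici t) t := by
  refine continuous_tanh.continuousAt.comp_continuousWithinAt ?_
  simp only [field_eq_pair hM, Fin.sum_univ_two]
  exact ((continuousWithinAt_pair hHd φ 0 _ t).add (continuousWithinAt_pair hHd φ 1 _ t)).add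
    continuousWithinAt_const

/-- A Carathéodory function: continuous in r for fixed s, and measurable in s for fixed r by right
continuity. -/
theorem measurable_pathTanh (hM : M.Admissible)
    (hHd : Metric.closedBall (0 : C(Torus d, ℝ)) 1 ⊆ closure (Set.range H))
    (φ : Cadlag T (B11 d H)) (i : Fin 2) : Measurable (M.pathTanh φ i) := by
  have h1 : Measurable (Function.uncurry fun (r : Torus d) (s : Icc (0 : ℝ) T) =>
      M.pathTanh φ i (s, r)) :=
    measurable_uncurry_of_continuous_of_measurable
      (fun s => continuous_tanh_field hM (fun j => (φ s).integrable_fn j) i)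
      (fun r => measurable_of_right_continuous (continuousWithinAt_pathTanh hM hHd φ i r))
  have h2 : M.pathTanh φ i = (Function.uncurry fun (r : Torus d) (s : Icc (0 : ℝ) T) =>
      M.pathTanh φ i (s, r)) ∘ Prod.swap := rfl
  rw [h2]
  exact h1.comp measurable_swap

theorem integrable_mul_slice {u : Icc (0 : ℝ) T × Torus d → ℝ} (hu : Measurable u)
    (hu1 : ∀ z, |u z| ≤ 1) (G : C(Torus d, ℝ)) (s : Icc (0 : ℝ) T) :
    Integrable fun r => G r * u (s, r) :=
  Integrable.of_bound (G.continuous.measurable.mul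
    (hu.comp measurable_prodMk_left)).aestronglyMeasurable ‖G‖ (ae_of_all _ fun r => by
      rw [norm_mul]
      exact (mul_le_of_le_one_right (norm_nonneg _) (hu1 _)).trans (G.norm_coe_le_norm r))

theorem continuous_integral_slice {u : Icc (0 : ℝ) T × Torus d → ℝ} (hu : Measurable u)
    (hu1 : ∀ z, |u z| ≤ 1) (huc : ∀ r, Continuous fun s => u (s, r)) (G : C(Torus d, ℝ)) :
    Continuous fun s => ∫ r, G r * u (s, r) := by
  refine continuous_of_dominated (bound := fun _ => ‖G‖)
    (fun s => (integrable_mul_slice hu hu1 G s).1) (fun s => ae_of_all _ fun r => ?_)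
    (integrable_const _) (ae_of_all _ fun r => continuous_const.mul (huc r))
  rw [norm_mul]
  exact (mul_le_of_le_one_right (norm_nonneg _) (hu1 _)).trans (G.norm_coe_le_norm r)

theorem abs_integral_slice_le {u : Icc (0 : ℝ) T × Torus d → ℝ} (hu1 : ∀ z, |u z| ≤ 1)
    (G : C(Torus d, ℝ)) (s : Icc (0 : ℝ) T) :
    |∫ r, G r * u (s, r)| ≤ ‖G‖ * (volume : Measure (Torus d)).real univ := by
  rw [← Real.norm_eq_abs]
  refine norm_integral_le_of_norm_le_const (ae_of_all _ fun r => ?_)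
  rw [norm_mul]
  exact (mul_le_of_le_one_right (norm_nonneg _) (hu1 _)).trans (G.norm_coe_le_norm r)

theorem measurable_integral_slice {u : Icc (0 : ℝ) T × Torus d → ℝ} (hu : Measurable u)
    (G : C(Torus d, ℝ)) : Measurable fun s => ∫ r, G r * u (s, r) :=
  (((G.continuous.measurable.comp measurable_snd).mul
    hu).stronglyMeasurable.integral_prod_right' (ν := volume)).measurable

/-- The weak form of the linear equation for a pointwise solution. -/
theorem integral_slice_eq (hT : 0 ≤ T) {W N : Icc (0 : ℝ) T × Torus d → ℝ} (hWm : Measurable W)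
    (hW1 : ∀ z, |W z| ≤ 1) (hNm : Measurable N) (hN1 : ∀ z, |N z| ≤ 1)
    (hWd : ∀ r t' t, t' ≤ t → W (t, r) - W (t', r) =
      ∫ s in Ioc t' t, (-W (s, r) + N (s, r)) ∂(timeMeasure T)) (G : C(Torus d, ℝ))
    (t : Icc (0 : ℝ) T) :
    ∫ r, G r * W (t, r) = (∫ r, G r * W (⟨0, le_rfl, hT⟩, r)) +
      ∫ s in Ioc ⟨0, le_rfl, hT⟩ t, (-(∫ r, G r * W (s, r)) + ∫ r, G r * N (s, r))
        ∂(timeMeasure T) := by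
  let a : Icc (0 : ℝ) T := ⟨0, le_rfl, hT⟩
  have hat : a ≤ t := t.2.1
  let K : Torus d → Icc (0 : ℝ) T → ℝ := fun r s => G r * (-W (s, r) + N (s, r))
  have hKi : Integrable (Function.uncurry K)
      ((volume : Measure (Torus d)).prod ((timeMeasure T).restrict (Ioc a t))) := by
    refine Integrable.of_bound (Measurable.aestronglyMeasurable ?_) (‖G‖ * 2)
      (ae_of_all _ fun z => ?_)
    · exact (G.continuous.measurable.comp measurable_fst).mul
        ((hWm.comp measurable_swap).neg.add (hNm.comp measurable_swap))
    · refine (norm_mul_le _ _).trans (mul_le_mul (G.norm_coe_le_norm _) ?_ (norm_nonneg _)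
        (norm_nonneg _))
      refine (norm_add_le _ _).trans ?_
      rw [norm_neg]
      have h1 := hW1 (z.2, z.1)
      have h2 := hN1 (z.2, z.1)
      rw [← Real.norm_eq_abs] at h1 h2
      linarith
  have h1 : ∀ s, -(∫ r, G r * W (s, r)) + ∫ r, G r * N (s, r) = ∫ r, K r s := by
    intro s
    have hn : Integrable fun r => -(G r * W (s, r)) := (integrable_mul_slice hWm hW1 G s).neg
    rw [← integral_neg, ← integral_add hn
      (integrable_mul_slice hNm hN1 G s)]
    congr 1 with r
    simp only [K]
    ring
  simp only [h1]
  rw [← integral_integral_swap hKi, ← sub_eq_iff_eq_add',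
    ← integral_sub (integrable_mul_slice hWm hW1 G t) (integrable_mul_slice hWm hW1 G a)]
  congr 1 with r
  rw [← mul_sub, hWd r a t hat, ← integral_const_mul]

/-- A weak solution agrees with the pointwise solution of the linear equation driven by its own
field. -/
theorem ae_eq_of_isWeakSolution (hT : 0 < T)
    (hHd : Metric.closedBall (0 : C(Torus d, ℝ)) 1 ⊆ closure (Set.range H))
    {φ : Cadlag T (B11 d H)} (hφ : M.IsWeakSolution hT φ) (i : Fin 2)
    {W N : Icc (0 : ℝ) T × Torus d → ℝ} (hWm : Measurable W) (hW1 : ∀ z, |W z| ≤ 1)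
    (hWc : ∀ r, Continuous fun s => W (s, r)) (hNm : Measurable N) (hN1 : ∀ z, |N z| ≤ 1)
    (hN : ∀ z, N z = M.p i * M.pathTanh φ i z)
    (hW0' : (fun r => W (⟨0, le_rfl, hT.le⟩, r)) =ᵐ[volume] (φ ⟨0, le_rfl, hT.le⟩).fn i)
    (hWd : ∀ r t' t, t' ≤ t → W (t, r) - W (t', r) =
      ∫ s in Ioc t' t, (-W (s, r) + N (s, r)) ∂(timeMeasure T)) (t : Icc (0 : ℝ) T) :
    (fun r => W (t, r)) =ᵐ[volume] (φ t).fn i := by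
  let a : Icc (0 : ℝ) T := ⟨0, le_rfl, hT.le⟩
  set m := (volume : Measure (Torus d)).real univ with hm
  refine (B11.ae_eq_of_forall_integral_eq ((φ t).measurable_fn i)
    (hWm.comp measurable_prodMk_left) ((φ t).ae_abs_fn_le_one i)
    (ae_of_all _ fun r => hW1 _) fun G => ?_).symm
  have hWG := continuous_integral_slice hWm hW1 hWc G
  -- Both terms solve an equation with the same forcing N, built from the field of φ itself. The
  -- forcing cancels, leaving ζ = -∫ ζ, so no Lipschitz estimate on tanh is needed.
  let ζ : Icc (0 : ℝ) T → ℝ := fun s => (φ s).pair i G - ∫ r, G r * W (s, r)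
  have hζr : ∀ t, ContinuousWithinAt ζ (Ici t) t := fun t =>
    (continuousWithinAt_pair hHd φ i G t).sub hWG.continuousWithinAt
  have hζm : Measurable ζ := measurable_of_right_continuous hζr
  have hζb : ∀ s, |ζ s| ≤ ‖G‖ * m + ‖G‖ * m := fun s =>
    (abs_sub _ _).trans (add_le_add ((φ s).abs_pair_le i G) (abs_integral_slice_le hW1 G s))
  have hbi : ∀ (f : Icc (0 : ℝ) T → ℝ) (C : ℝ), Measurable f → (∀ s, |f s| ≤ C) →
      Integrable f (timeMeasure T) := fun f C hf hC =>
    Integrable.of_bound hf.aestronglyMeasurable C (ae_of_all _ hC)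
  have hpi : Integrable (fun s => (φ s).pair i G) (timeMeasure T) :=
    hbi _ _ (measurable_of_right_continuous (continuousWithinAt_pair hHd φ i G)) fun s => (φ s).abs_pair_le i G
  have hWi : Integrable (fun s => ∫ r, G r * W (s, r)) (timeMeasure T) :=
    hbi _ _ hWG.measurable (abs_integral_slice_le hW1 G)
  have hNi : Integrable (fun s => ∫ r, G r * N (s, r)) (timeMeasure T) :=
    hbi _ _ (measurable_integral_slice hNm G) (abs_integral_slice_le hN1 G)
  have hy : ∀ t, (φ t).pair i G = (φ a).pair i G +
      ∫ s in Ioc a t, (-(φ s).pair i G + ∫ r, G r * N (s, r)) ∂(timeMeasure T) := by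
    intro t
    have h1 := hφ i G t
    rw [setIntegral_congr_set (Iic_ae_eq_Ioc hT.le t)] at h1
    rw [h1]
    congr 1
    congr 1 with s
    have e : ∀ r, G r * (-(φ s).fn i r + M.p i * Real.tanh (M.field (φ s).fn i r)) =
        -(G r * (φ s).fn i r) + G r * N (s, r) := fun r => by rw [hN]; unfold Data.pathTanh; ring
    simp only [e]
    have hn : Integrable fun r => -(G r * (φ s).fn i r) := ((φ s).integrable_mul_fn i G).neg
    rw [integral_add hn (integrable_mul_slice hNm hN1 G s),
      integral_neg]
    rfl
  have hv := integral_slice_eq hT.le hWm hW1 hNm hN1 hWd G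
  have h0 : (φ a).pair i G = ∫ r, G r * W (a, r) := by
    refine integral_congr_ae ?_
    filter_upwards [hW0'] with r hr
    rw [hr]
  have hζe : ∀ t, ζ t = -∫ s in Ioc a t, ζ s ∂(timeMeasure T) := by
    intro t
    have e1 : ζ t = (∫ s in Ioc a t, (-(φ s).pair i G + ∫ r, G r * N (s, r)) ∂(timeMeasure T)) -
        ∫ s in Ioc a t, (-(∫ r, G r * W (s, r)) + ∫ r, G r * N (s, r)) ∂(timeMeasure T) := by
      have h1 := hy t
      have h2 := hv t
      simp only [ζ]
      linarith
    have i1 : Integrable (fun s => -(φ s).pair i G + ∫ r, G r * N (s, r)) (timeMeasure T) :=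
      hpi.neg.add hNi
    have i2 : Integrable (fun s => -(∫ r, G r * W (s, r)) + ∫ r, G r * N (s, r))
        (timeMeasure T) := hWi.neg.add hNi
    rw [e1, ← integral_sub i1.integrableOn i2.integrableOn,
      ← integral_neg]
    congr 1 with s
    simp only [ζ]
    ring
  have hz := eq_zero_of_eq_neg_integral (T := T) (z := fun x => ζ (projIcc 0 T hT.le x))
    (hζm.comp continuous_projIcc.measurable) (fun x => hζb _)
    (continuousWithinAt_comp_projIcc hT.le hζr) (fun x hx => by
      rw [hζe, timeIntegral_eq hT.le ζ (a := a) (projIcc 0 T hT.le x).2.1,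
        projIcc_of_mem hT.le hx]) t t.2
  rw [projIcc_val] at hz
  exact sub_eq_zero.1 hz

/-- Weak solutions that start in `B_{p₁,p₂}` have rate zero. -/
theorem exists_isRep_of_isWeakSolution (hM : M.Admissible) (hT : 0 < T) (hH : ∀ k, ‖H k‖ ≤ 1)
    (hHd : Metric.closedBall (0 : C(Torus d, ℝ)) 1 ⊆ closure (Set.range H))
    {φ : Cadlag T (B11 d H)} (hp : ∀ i, ‖(initial hT φ).val i‖ ≤ M.p i)
    (hφ : M.IsWeakSolution hT φ) : ∃ g w, IsRep M φ g w 0 := by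
  let a : Icc (0 : ℝ) T := ⟨0, le_rfl, hT.le⟩
  let N : Fin 2 → Icc (0 : ℝ) T × Torus d → ℝ := fun i z => M.p i * M.pathTanh φ i z
  have hNm : ∀ i, Measurable (N i) := fun i => (measurable_pathTanh hM hHd φ i).const_mul _
  have hNp : ∀ i z, |N i z| ≤ M.p i := fun i z => by
    rw [abs_mul, abs_of_nonneg (hM.p_nonneg i)]
    exact mul_le_of_le_one_right (hM.p_nonneg i) (abs_tanh_le_one _)
  have hW := fun i => exists_duhamel_version hT.le (p := M.p i)
    (c := fun r => trunc (M.p i) ((φ a).fn i r)) (N := N i)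
    ((continuous_trunc _).measurable.comp ((φ a).measurable_fn i))
    (fun r => abs_trunc_le (hM.p_nonneg i) _) (hNm i) (hNp i)
    fun r t => continuousWithinAt_const.mul (continuousWithinAt_pathTanh hM hHd φ i r t)
  choose W hWm hWp hWc hW0 hWd using hW
  have hW1 : ∀ i z, |W i z| ≤ 1 := fun i z => (hWp i z).trans (hM.p_le_one i)
  have hN1 : ∀ i z, |N i z| ≤ 1 := fun i z => (hNp i z).trans (hM.p_le_one i)
  -- The assumption on the initial value enters here: truncation at p_i does not change it.
  have hW0' : ∀ i, (fun r => W i (a, r)) =ᵐ[volume] (φ a).fn i := by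
    intro i
    filter_upwards [((φ a).norm_val_le_iff i (hM.p_nonneg i)).1 (hp i)] with r hr
    rw [hW0 i r, trunc_eq_self hr]
  have hae : ∀ i t, (fun r => W i (t, r)) =ᵐ[volume] (φ t).fn i := fun i t =>
    ae_eq_of_isWeakSolution hT hHd hφ i (hWm i) (hW1 i) (hWc i) (hNm i) (hN1 i) (fun _ => rfl)
      (hW0' i) (hWd i) t
  have hrep : MeasRep φ W := ⟨hWm, hW1, hae⟩
  have hdr : ∀ i z, M.drift W i z = -W i z + N i z := by
    intro i z
    unfold Data.drift Data.tanhField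
    rw [Data.field_congr (fun j => hae j z.1)]
    rfl
  -- φ is a priori only càdlàg; its continuity is inherited from the Duhamel version W.
  have hcont : Continuous φ.toFun := by
    refine continuous_iff_continuousAt.2 fun t =>
      B11.tendsto_of_tendsto_pair hH fun i k => ?_
    have e : ∀ s, (φ s).pair i (H k) = ∫ r, H k r * W i (s, r) := fun s => by
      refine integral_congr_ae ?_
      filter_upwards [hae i s] with r hr
      rw [hr]
    simp only [e]
    exact (continuous_integral_slice (hWm i) (hW1 i) (hWc i) (H k)).tendsto t
  refine ⟨M.drift W, W, measurable_drift hM hWm, ⟨hcont, fun j => ?_, fun j t' t ht => ?_⟩, hrep,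
    fun V hV => integral_nonpos fun z => Finset.sum_nonpos fun i _ => ?_⟩
  · exact Integrable.of_bound (measurable_drift hM hWm j).aestronglyMeasurable 2
      (ae_of_all _ fun z => abs_drift_le hM hW1 j z)
  · filter_upwards [hae j t, hae j t'] with r h1 h2
    rw [← h1, ← h2, hWd j r t' t ht]
    simp only [hdr]
  · unfold Data.costAt Data.drift
    exact cost_nonpos (abs_tanhField_le W i z) (hWp i z) _

theorem I0_eq_zero_iff (hM : M.Admissible) (hT : 0 < T) (hH : ∀ k, ‖H k‖ ≤ 1)
    (hHd : Metric.closedBall (0 : C(Torus d, ℝ)) 1 ⊆ closure (Set.range H))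
    (φ : Cadlag T (B11 d H)) :
    M.I0 φ = 0 ↔ (∀ i, ‖(initial hT φ).val i‖ ≤ M.p i) ∧ M.IsWeakSolution hT φ := by
  constructor
  · intro h
    obtain ⟨g, w, hrep⟩ := exists_isRep_of_I0_le hM hT.le hH hHd (L := 0) (φ := φ) (by simp [h])
    exact ⟨fun i => hrep.norm_initial_le hM hT i, hrep.isWeakSolution hM hT⟩
  · rintro ⟨hp, hφ⟩
    obtain ⟨g, w, hrep⟩ := exists_isRep_of_isWeakSolution hM hT hH hHd hp hφ
    exact le_antisymm (by simpa using hrep.I0_le hM) (I0_nonneg φ)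

theorem Im_eq_zero_iff (hM : M.Admissible) (hT : 0 < T) (hH : ∀ k, ‖H k‖ ≤ 1)
    (hHd : Metric.closedBall (0 : C(Torus d, ℝ)) 1 ⊆ closure (Set.range H))
    {m₀ : C(Torus d, ℝ)} (hm₀ : ∀ r, m₀ r ∈ Icc (-1 : ℝ) 1) (φ : Cadlag T (B11 d H)) :
    M.Im hT m₀ φ = 0 ↔ M.HasInitialDatum hT m₀ φ ∧ M.IsWeakSolution hT φ := by
  unfold Data.Im
  split_ifs with h
  · rw [I0_eq_zero_iff hM hT hH hHd]
    have hp : ∀ i, ‖(initial hT φ).val i‖ ≤ M.p i := fun i => by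
      rw [B11.norm_val_le_iff _ _ (hM.p_nonneg i)]
      filter_upwards [h i] with r hr
      rw [hr, abs_mul, abs_of_nonneg (hM.p_nonneg i)]
      exact mul_le_of_le_one_right (hM.p_nonneg i) (abs_le.2 (hm₀ r))
    exact ⟨fun hh => ⟨h, hh.2⟩, fun hh => ⟨hp, hh.2⟩⟩
  · simp [h]

end

end KacRate

theorem proposition3p7 {d : ℕ} (hd : 0 < d) (M : Data d) (hM : M.Admissible)
    {T : ℝ} (hT : 0 < T)
    (H : ℕ → C(Torus d, ℝ)) (hH : ∀ k, ‖H k‖ ≤ 1)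
    (hHdense : Metric.closedBall (0 : C(Torus d, ℝ)) 1 ⊆ closure (Set.range H)) :
    LowerSemicontinuous (fun φ : Cadlag T (B11 d H) => M.I0 φ) ∧
    (∀ L : ℝ, IsCompact {φ : Cadlag T (B11 d H) | M.I0 φ ≤ (L : EReal)}) ∧
    (∀ φ : Cadlag T (B11 d H), 0 ≤ M.I0 φ) ∧
    (∀ φ : Cadlag T (B11 d H), M.I0 φ = 0 ↔
      (∀ i, ‖(initial hT φ).val i‖ ≤ M.p i) ∧ M.IsWeakSolution hT φ) ∧
    (∀ m₀ : C(Torus d, ℝ), (∀ r, m₀ r ∈ Set.Icc (-1 : ℝ) 1) → ∀ φ : Cadlag T (B11 d H),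
      M.Im hT m₀ φ = 0 ↔ M.HasInitialDatum hT m₀ φ ∧ M.IsWeakSolution hT φ) := by
  exact ⟨lowerSemicontinuous_I0 hM hT.le hH hHdense, isCompact_I0_le hM hT.le hH, I0_nonneg,
    I0_eq_zero_iff hM hT hH hHdense, fun _ hm₀ => Im_eq_zero_iff hM hT hH hHdense hm₀⟩
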